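/- Let $(\mathcal M,g)$ be a nonempty compact smooth Riemannian manifold without boundary, of dimension $m\ge 1$, and let $(\mathcal N,h)$ be a smooth Riemannian manifold without boundary. Let $\phi:\mathcal M\to\mathcal N$ and $f:\mathcal M\to\mathbb R$ be smooth, and let $\alpha\ge 0$ and $\lambda>0$ be real constants such that $((\mathcal M,g),(\mathcal N,h),\phi,f,\lambda)$ is a (shrinking) Ricci-harmonic soliton, that is, $$\operatorname{Ric}_g-\alpha\,\phi^*h+\operatorname{Hess} f=\lambda g,\qquad \tau_g\phi=\langle\nabla\phi,\nabla f\rangle := d\phi(\nabla f),$$ where $\tau_g\phi=\operatorname{trace}_g\nabla d\phi$ is the tension field of $\phi$. Let $S=R-\alpha|\nabla\phi|^2$ be the generalized scalar curvature, where $R$ is the scalar curvature of $g$ and $|\nabla\phi|^2=\operatorname{trace}_g(\phi^*h)$. Then $S$ attains a maximum $S_{\max}$ on $\mathcal M$, and the soliton is harmonic-Einstein, that is, $$\operatorname{Ric}_g-\alpha\,\phi^*h=\lambda g,\qquad \tau_g\phi=0,$$ if and only if $$S_{\max}-m\lambda\le\left(1+\frac2m\right)\frac1{\operatorname{vol}(\mathcal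 M,g)}\int_{\mathcal M}\|\nabla f\|^2 .$$ Here the volume and the integral are taken with respect to the Riemannian volume measure of $g$. -/

import Mathlib

open MeasureTheory Bundle
open scoped Manifold ContDiff

noncomputable section

namespace RicciHarmonic

/-! ### Local coordinate expressions on `ℝᵐ` -/

/-- The coordinate space `ℝᵐ`. -/
abbrev Coord (m : ℕ) : Type := EuclideanSpace ℝ (Fin m)

/-- The partial derivative `∂ᵢ u` at `y`. -/
def pd {m : ℕ} (i : Fin m) (u : Coord m → ℝ) (y : Coord m) : ℝ :=
  fderiv ℝ u y (EuclideanSpace.single i 1)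

/-- The Christoffel symbol `Γᵏᵢⱼ` of the metric with components `G`. -/
def christoffel {m : ℕ} (G : Coord m → Matrix (Fin m) (Fin m) ℝ) (k i j : Fin m)
    (y : Coord m) : ℝ :=
  (1 / 2 : ℝ) * ∑ l, (G y)⁻¹ k l *
    (pd i (fun z => G z j l) y + pd j (fun z => G z i l) y - pd l (fun z => G z i j) y)

/-- The component `Rᵢⱼ` of the Ricci tensor of the metric with components `G`. -/
def ricci {m : ℕ} (G : Coord m → Matrix (Fin m) (Fin m) ℝ) (i j : Fin m) (y : Coord m) : ℝ :=
  ∑ k, (pd k (christoffel G k i j) y - pd j (christoffel G k i k) y)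
    + ∑ k, ∑ l, (christoffel G k k l y * christoffel G l i j y
        - christoffel G k j l y * christoffel G l i k y)

/-- The component `∂ᵢ∂ⱼ u - Γᵏᵢⱼ ∂ₖ u` of the Hessian of `u`. -/
def hess {m : ℕ} (G : Coord m → Matrix (Fin m) (Fin m) ℝ) (u : Coord m → ℝ) (i j : Fin m)
    (y : Coord m) : ℝ :=
  pd i (pd j u) y - ∑ k, christoffel G k i j y * pd k u y

/-- The trace `gⁱʲ Bᵢⱼ` of a bilinear form with components `B`. -/
def metricTrace {m : ℕ} (G B : Matrix (Fin m) (Fin m) ℝ) : ℝ :=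
  ∑ i, ∑ j, G⁻¹ i j * B i j

/-- The pairing `⟨∇u, ∇v⟩ = gⁱʲ ∂ᵢu ∂ⱼv`. -/
def gradInner {m : ℕ} (G : Coord m → Matrix (Fin m) (Fin m) ℝ) (u v : Coord m → ℝ)
    (y : Coord m) : ℝ :=
  metricTrace (G y) (fun i j => pd i u y * pd j v y)

/-- The component `gⁱʲ (∂ᵢ∂ⱼ Φᵃ - Γᵏᵢⱼ ∂ₖ Φᵃ + Γ'ᵃ_{bc}(Φ) ∂ᵢΦᵇ ∂ⱼΦᶜ)` of the tension field
of a map `Φ` between coordinate domains with metrics `G` and `H`. -/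
def tension {m n : ℕ} (G : Coord m → Matrix (Fin m) (Fin m) ℝ)
    (H : Coord n → Matrix (Fin n) (Fin n) ℝ) (Φ : Coord m → Coord n) (a : Fin n)
    (y : Coord m) : ℝ :=
  metricTrace (G y) (fun i j => hess G (fun z => Φ z a) i j y
    + ∑ b, ∑ c, christoffel H a b c (Φ y)
        * pd i (fun z => Φ z b) y * pd j (fun z => Φ z c) y)

/-! ### Riemannian manifolds -/

/-- Smooth Riemannian metrics on a manifold `M` modelled on `ℝᵐ`. -/
abbrev RiemMetric (m : ℕ) (M : Type*) [TopologicalSpace M] [ChartedSpace (Coord m) M]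
    [IsManifold (𝓡 m) ∞ M] : Type _ :=
  ContMDiffRiemannianMetric (𝓡 m) ∞ (Coord m) (fun p : M => TangentSpace (𝓡 m) p)

section Domain

variable {m : ℕ} {M : Type*} [TopologicalSpace M] [ChartedSpace (Coord m) M]
  [IsManifold (𝓡 m) ∞ M]

/-- The coordinate vector field `∂ᵢ` of the chart `e`, at the point with coordinates `y`. -/
def coordVec (e : OpenPartialHomeomorph M (Coord m)) (y : Coord m) (i : Fin m) :
    TangentSpace (𝓡 m) (e.symm y) :=
  mfderiv (𝓡 m) (𝓡 m) e.symm y (EuclideanSpace.single i (1 : ℝ) : Coord m)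

/-- The components `gᵢⱼ = g(∂ᵢ, ∂ⱼ)` of the metric in the chart `e`. -/
def gram (g : RiemMetric m M) (e : OpenPartialHomeomorph M (Coord m)) (y : Coord m) :
    Matrix (Fin m) (Fin m) ℝ :=
  fun i j => g.inner (e.symm y) (coordVec e y i) (coordVec e y j)

/-- The Riemannian volume of the domain of the chart `e`, i.e. `√(det gᵢⱼ) dy`. -/
def chartVolume [MeasurableSpace M] (g : RiemMetric m M) (e : OpenPartialHomeomorph M (Coord m)) :
    Measure M :=
  Measure.map e.symm ((volume.restrict e.target).withDensity
    (fun y => ENNReal.ofReal (Real.sqrt (gram g e y).det)))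

/-- The Riemannian volume measure. The measures `chartVolume g e` agree on the overlaps of the
chart domains, so that their supremum is the measure which restricts to `chartVolume g e` on
the domain of each chart `e` of the smooth structure. -/
def riemannianVolume [MeasurableSpace M] (g : RiemMetric m M) : Measure M :=
  ⨆ e ∈ IsManifold.maximalAtlas (𝓡 m) ∞ M, chartVolume g e

/-- `‖∇f‖²`. -/
def gradNormSq (g : RiemMetric m M) (f : M → ℝ) (p : M) : ℝ :=
  let e := chartAt (Coord m) p
  gradInner (gram g e) (fun y => f (e.symm y)) (fun y => f (e.symm y)) (e p)

/-- The scalar curvature `R = gⁱʲ Rᵢⱼ`. -/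
def scalarCurvature (g : RiemMetric m M) (p : M) : ℝ :=
  let e := chartAt (Coord m) p
  metricTrace (gram g e (e p)) (fun i j => ricci (gram g e) i j (e p))

end Domain

section Map

variable {m n : ℕ} {M : Type*} [TopologicalSpace M] [ChartedSpace (Coord m) M]
  [IsManifold (𝓡 m) ∞ M] {N : Type*} [TopologicalSpace N] [ChartedSpace (Coord n) N]
  [IsManifold (𝓡 n) ∞ N]

/-- The components `h(dφ ∂ᵢ, dφ ∂ⱼ)` of the pull-back `∇φ ⊗ ∇φ = φ*h` in the chart `e`. -/
def pullback (h : RiemMetric n N) (φ : M → N) (e : OpenPartialHomeomorph M (Coord m))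
    (y : Coord m) : Matrix (Fin m) (Fin m) ℝ :=
  fun i j => h.inner (φ (e.symm y)) (mfderiv (𝓡 m) (𝓡 n) φ (e.symm y) (coordVec e y i))
    (mfderiv (𝓡 m) (𝓡 n) φ (e.symm y) (coordVec e y j))

/-- `|∇φ|² = gⁱʲ (φ*h)ᵢⱼ`. -/
def mapNormSq (g : RiemMetric m M) (h : RiemMetric n N) (φ : M → N) (p : M) : ℝ :=
  let e := chartAt (Coord m) p
  metricTrace (gram g e (e p)) (pullback h φ e (e p))

/-- The generalized scalar curvature `S = R - α |∇φ|²`. -/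
def genScalarCurvature (g : RiemMetric m M) (h : RiemMetric n N) (φ : M → N) (α : ℝ) (p : M) : ℝ :=
  scalarCurvature g p - α * mapNormSq g h φ p

/-- Harmonic-Einstein: `Ric - α ∇φ ⊗ ∇φ = lam g` and `τ φ = 0`, as identities between the
components in all charts of the two smooth structures. -/
structure IsHarmonicEinstein (g : RiemMetric m M) (h : RiemMetric n N) (φ : M → N) (α lam : ℝ) :
    Prop where
  einstein : ∀ e ∈ IsManifold.maximalAtlas (𝓡 m) ∞ M, ∀ y ∈ e.target, ∀ i j : Fin m,
    ricci (gram g e) i j y - α * pullback h φ e y i j = lam * gram g e y i j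
  harmonic : ∀ e ∈ IsManifold.maximalAtlas (𝓡 m) ∞ M,
    ∀ e' ∈ IsManifold.maximalAtlas (𝓡 n) ∞ N,
    ∀ y ∈ e.target, φ (e.symm y) ∈ e'.source → ∀ a : Fin n,
    tension (gram g e) (gram h e') (fun z => e' (φ (e.symm z))) a y = 0

/-- Ricci-harmonic soliton: `α ≥ 0`, `Ric - α ∇φ ⊗ ∇φ + Hess f = lam g` and
`τ φ = ⟨∇φ, ∇f⟩`, as identities between the components in all charts of the two smooth
structures. -/
structure IsRicciHarmonicSoliton (g : RiemMetric m M) (h : RiemMetric n N) (φ : M → N) (f : M → ℝ)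
    (α lam : ℝ) : Prop where
  coupling_nonneg : 0 ≤ α
  soliton : ∀ e ∈ IsManifold.maximalAtlas (𝓡 m) ∞ M, ∀ y ∈ e.target, ∀ i j : Fin m,
    ricci (gram g e) i j y - α * pullback h φ e y i j
      + hess (gram g e) (fun z => f (e.symm z)) i j y = lam * gram g e y i j
  map_eq : ∀ e ∈ IsManifold.maximalAtlas (𝓡 m) ∞ M,
    ∀ e' ∈ IsManifold.maximalAtlas (𝓡 n) ∞ N,
    ∀ y ∈ e.target, φ (e.symm y) ∈ e'.source → ∀ a : Fin n,
    tension (gram g e) (gram h e') (fun z => e' (φ (e.symm z))) a y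
      = gradInner (gram g e) (fun z => e' (φ (e.symm z)) a) (fun z => f (e.symm z)) y

end Map

end RicciHarmonic

end

/-! Tracing the soliton equation gives S = mλ - Δf, so everything is a statement about f. If the
soliton is harmonic-Einstein, then Hess f = 0, S = mλ everywhere, and the inequality reads 0 ≤ c
∫|∇f|². The content is the converse.

Two identities carry it. First, W = S + |∇f|² - 2λf is locally constant (`pd_conserved`). The
divergence of Hess f is dΔf + Ric(∇f, ·) by commuting derivatives, and ½dΔf + α⟨τφ, dφ⟩ by the
contracted Bianchi identity; equating the two and applying the soliton equations to ∇f gives dW = 0.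
Second, at a critical point of S the Laplacian of S is 2(λΔf - α|τφ|² - |Hess f|²). At a minimum
this is nonnegative, and completing squares yields S ≥ 0 on all of M (`conserved_nonneg`). Both are
checked at the centre of a chart with G = 1 and dG = 0 (`exists_normal_chart`); invariance under
change of charts carries them to every point and every chart.

M need not be connected, so let F(p) be the maximum of f over the level set of W through p. It is
locally constant. Put u = F - f ≥ 0. At a point of that level set where f attains F the gradient
vanishes, so constancy of W gives Smax ≥ S + |∇f|² + 2λu pointwise. Since ∫Δf = 0, integration and
the assumed inequality give 2λ∫u ≤ (2/m)∫|∇f|². Green's formula ∫uΔf = ∫|∇f|² turns this into ∫uS =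
mλ∫u - ∫|∇f|² ≤ 0. As u, S ≥ 0 are continuous and the volume charges open sets, uS = 0. Where u = 0,
u is minimal, so S = mλ + Δu > 0; hence {u ≠ 0} = {S ≤ 0} is open and closed. A minimum of u on it
would again force S > 0, so it is empty (`eq_zero_of_mul_eq_zero`). Thus f = F is locally constant,
and the terms in f drop out of the soliton equations.

The integral facts rest on the identification of the volume measure in each chart
(`riemannianVolume_apply`), the divergence form of the Laplacian (`sqrt_det_mul_laplacian`) and a
partition of unity. -/

namespace RicciHarmonic

set_option linter.unusedSectionVars false

/-! ### Calculus of partial derivatives -/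

section Pd

variable {m : ℕ} {U : Set (Coord m)} {u v : Coord m → ℝ} {y : Coord m}

theorem _root_.ContDiffOn.differentiableAt_of_isOpen (hu : ContDiffOn ℝ ∞ u U) (hU : IsOpen U)
    (hy : y ∈ U) : DifferentiableAt ℝ u y :=
  (hu.differentiableOn (by simp)).differentiableAt (hU.mem_nhds hy)

theorem pd_congr (hU : IsOpen U) (h : Set.EqOn u v U) (hy : y ∈ U) (i : Fin m) :
    pd i u y = pd i v y := by
  have : u =ᶠ[nhds y] v := Filter.eventuallyEq_of_mem (hU.mem_nhds hy) h
  rw [pd, pd, this.fderiv_eq]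

theorem contDiffOn_pd (hU : IsOpen U) (hu : ContDiffOn ℝ ∞ u U) (i : Fin m) :
    ContDiffOn ℝ ∞ (pd i u) U := by
  have := hu.fderiv_of_isOpen hU (m := ∞) (by simp)
  exact this.clm_apply contDiffOn_const

@[simp] theorem pd_const (c : ℝ) (i : Fin m) (y : Coord m) : pd i (fun _ => c) y = 0 := by
  simp [pd]

theorem pd_add (hu : DifferentiableAt ℝ u y) (hv : DifferentiableAt ℝ v y) (i : Fin m) :
    pd i (fun z => u z + v z) y = pd i u y + pd i v y := by
  simp [pd, fderiv_fun_add hu hv]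

theorem pd_sub (hu : DifferentiableAt ℝ u y) (hv : DifferentiableAt ℝ v y) (i : Fin m) :
    pd i (fun z => u z - v z) y = pd i u y - pd i v y := by
  simp [pd, fderiv_fun_sub hu hv]

theorem pd_mul (hu : DifferentiableAt ℝ u y) (hv : DifferentiableAt ℝ v y) (i : Fin m) :
    pd i (fun z => u z * v z) y = pd i u y * v y + u y * pd i v y := by
  simp [pd, fderiv_fun_mul hu hv]; ring

theorem pd_const_mul (hu : DifferentiableAt ℝ u y) (c : ℝ) (i : Fin m) :
    pd i (fun z => c * u z) y = c * pd i u y := by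
  simp [pd, fderiv_const_mul hu]

theorem pd_sum {ι : Type*} {s : Finset ι} {w : ι → Coord m → ℝ}
    (hw : ∀ k ∈ s, DifferentiableAt ℝ (w k) y) (i : Fin m) :
    pd i (fun z => ∑ k ∈ s, w k z) y = ∑ k ∈ s, pd i (w k) y := by
  simp [pd, fderiv_fun_sum hw]

theorem pd_comm (hU : IsOpen U) (hu : ContDiffOn ℝ ∞ u U) (hy : y ∈ U) (i j : Fin m) :
    pd i (pd j u) y = pd j (pd i u) y := by
  have hc : ContDiffAt ℝ ∞ u y := hu.contDiffAt (hU.mem_nhds hy)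
  have hs : IsSymmSndFDerivAt ℝ u y := hc.isSymmSndFDerivAt (by simpa using ENat.LEInfty.out)
  have hd : DifferentiableAt ℝ (fderiv ℝ u) y :=
    (hc.fderiv_right (m := ∞) (by simp)).differentiableAt (by simp)
  have key : ∀ i j : Fin m, pd i (pd j u) y
      = fderiv ℝ (fderiv ℝ u) y (EuclideanSpace.single i 1) (EuclideanSpace.single j 1) := by
    intro i j
    have : pd j u = fun z => fderiv ℝ u z (EuclideanSpace.single j 1) := rfl
    rw [this, pd, fderiv_clm_apply hd (differentiableAt_const _)]
    simp
  rw [key, key, hs.eq]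

theorem fderiv_apply_eq_sum_pd (u : Coord m → ℝ) (y v : Coord m) :
    fderiv ℝ u y v = ∑ i, v i * pd i u y := by
  conv_lhs => rw [show v = ∑ i, v i • (EuclideanSpace.single i (1 : ℝ) : Coord m) by
    ext j; simp [Finset.sum_apply, Pi.single_apply]]
  simp [pd]

theorem fderiv_eq_zero_of_pd (h : ∀ i, pd i u y = 0) : fderiv ℝ u y = 0 := by
  ext v
  rw [fderiv_apply_eq_sum_pd]
  simp [h]

end Pd

/-! ### Smooth metrics on open subsets of the coordinate space -/

/-- `G` is a smooth Riemannian metric on the open set `U`. -/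
structure IsMetricOn {m : ℕ} (G : Coord m → Matrix (Fin m) (Fin m) ℝ) (U : Set (Coord m)) :
    Prop where
  isOpen : IsOpen U
  smooth : ∀ i j, ContDiffOn ℝ ∞ (fun z => G z i j) U
  posDef : ∀ z ∈ U, (G z).PosDef

/-- The Laplacian `gⁱʲ (Hess u)ᵢⱼ`. -/
noncomputable def coordLaplacian {m : ℕ} (G : Coord m → Matrix (Fin m) (Fin m) ℝ)
    (u : Coord m → ℝ) (y : Coord m) : ℝ :=
  metricTrace (G y) (fun i j => hess G u i j y)

theorem contDiffOn_det {m : ℕ} {ι : Type*} [Fintype ι] [DecidableEq ι] {U : Set (Coord m)}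
    {A : Coord m → Matrix ι ι ℝ}
    (h : ∀ i j, ContDiffOn ℝ ∞ (fun z => A z i j) U) : ContDiffOn ℝ ∞ (fun z => (A z).det) U := by
  simp only [Matrix.det_apply]
  refine ContDiffOn.sum fun σ _ => ?_
  simp only [Units.smul_def, zsmul_eq_mul]
  exact contDiffOn_const.mul (contDiffOn_prod fun i _ => h _ _)

namespace IsMetricOn

variable {m : ℕ} {G : Coord m → Matrix (Fin m) (Fin m) ℝ} {U : Set (Coord m)}
  {u v : Coord m → ℝ} {y : Coord m}

theorem apply_symm (hG : IsMetricOn G U) (hy : y ∈ U) (i j : Fin m) : G y i j = G y j i := by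
  simpa using (hG.posDef y hy).1.apply j i

theorem inv_apply_symm (hG : IsMetricOn G U) (hy : y ∈ U) (i j : Fin m) :
    (G y)⁻¹ i j = (G y)⁻¹ j i := by
  simpa using (hG.posDef y hy).inv.1.apply j i

theorem inv_mul (hG : IsMetricOn G U) (hy : y ∈ U) : (G y)⁻¹ * G y = 1 :=
  Matrix.nonsing_inv_mul _ (hG.posDef y hy).det_pos.ne'.isUnit

theorem mul_inv (hG : IsMetricOn G U) (hy : y ∈ U) : G y * (G y)⁻¹ = 1 :=
  Matrix.mul_nonsing_inv _ (hG.posDef y hy).det_pos.ne'.isUnit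

theorem differentiableAt (hG : IsMetricOn G U) (hy : y ∈ U) (i j : Fin m) :
    DifferentiableAt ℝ (fun z => G z i j) y :=
  (hG.smooth i j).differentiableAt_of_isOpen hG.isOpen hy

/-- Cramer's rule: the inverse is the adjugate over the determinant, and each entry of the adjugate
is itself a determinant of smooth entries. -/
theorem smooth_inv (hG : IsMetricOn G U) (k l : Fin m) :
    ContDiffOn ℝ ∞ (fun z => (G z)⁻¹ k l) U := by
  have hd : ContDiffOn ℝ ∞ (fun z => (G z).det) U := contDiffOn_det hG.smooth
  have ha : ContDiffOn ℝ ∞ (fun z => (G z).adjugate k l) U := by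
    simp only [Matrix.adjugate_apply]
    refine contDiffOn_det fun i j => ?_
    by_cases h : i = l
    · subst h
      simpa [Matrix.updateRow_self] using contDiffOn_const
    · simpa [Matrix.updateRow_ne h] using hG.smooth i j
  have := (hd.inv fun z hz => (hG.posDef z hz).det_pos.ne').mul ha
  refine this.congr fun z _ => ?_
  simp [Matrix.inv_def]

theorem smooth_pd (hG : IsMetricOn G U) (l i j : Fin m) :
    ContDiffOn ℝ ∞ (pd l (fun z => G z i j)) U := contDiffOn_pd hG.isOpen (hG.smooth i j) l

theorem smooth_christoffel (hG : IsMetricOn G U) (k i j : Fin m) :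
    ContDiffOn ℝ ∞ (christoffel G k i j) U :=
  contDiffOn_const.mul (ContDiffOn.sum fun l _ => (hG.smooth_inv k l).mul
    (((hG.smooth_pd i j l).add (hG.smooth_pd j i l)).sub (hG.smooth_pd l i j)))

theorem smooth_hess (hG : IsMetricOn G U) (hu : ContDiffOn ℝ ∞ u U) (i j : Fin m) :
    ContDiffOn ℝ ∞ (hess G u i j) U :=
  (contDiffOn_pd hG.isOpen (contDiffOn_pd hG.isOpen hu j) i).sub
    (ContDiffOn.sum fun k _ => (hG.smooth_christoffel k i j).mul (contDiffOn_pd hG.isOpen hu k))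

theorem smooth_gradInner (hG : IsMetricOn G U) (hu : ContDiffOn ℝ ∞ u U)
    (hv : ContDiffOn ℝ ∞ v U) : ContDiffOn ℝ ∞ (gradInner G u v) U := by
  unfold gradInner metricTrace
  exact ContDiffOn.sum fun i _ => ContDiffOn.sum fun j _ => (hG.smooth_inv i j).mul
    ((contDiffOn_pd hG.isOpen hu i).mul (contDiffOn_pd hG.isOpen hv j))

theorem smooth_laplacian (hG : IsMetricOn G U) (hu : ContDiffOn ℝ ∞ u U) :
    ContDiffOn ℝ ∞ (coordLaplacian G u) U := by
  unfold coordLaplacian metricTrace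
  exact ContDiffOn.sum fun i _ => ContDiffOn.sum fun j _ => (hG.smooth_inv i j).mul
    (hG.smooth_hess hu i j)

theorem smooth_ricci (hG : IsMetricOn G U) (i j : Fin m) :
    ContDiffOn ℝ ∞ (ricci G i j) U := by
  have hΓ := hG.smooth_christoffel
  exact (ContDiffOn.sum fun k _ => (contDiffOn_pd hG.isOpen (hΓ k i j) k).sub
    (contDiffOn_pd hG.isOpen (hΓ k i k) j)).add
    (ContDiffOn.sum fun k _ => ContDiffOn.sum fun l _ =>
      ((hΓ k k l).mul (hΓ l i j)).sub ((hΓ k j l).mul (hΓ l i k)))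

/-! ### Algebra of the Levi-Civita connection in coordinates -/

theorem pd_symm (hG : IsMetricOn G U) (hy : y ∈ U) (l i j : Fin m) :
    pd l (fun z => G z i j) y = pd l (fun z => G z j i) y :=
  pd_congr hG.isOpen (fun _ hz => hG.apply_symm hz i j) hy l

theorem christoffel_symm (hG : IsMetricOn G U) (hy : y ∈ U) (k i j : Fin m) :
    christoffel G k i j y = christoffel G k j i y := by
  unfold christoffel
  congr 1
  refine Finset.sum_congr rfl fun l _ => ?_
  rw [hG.pd_symm hy l i j]; ring

theorem sum_inv_mul (hG : IsMetricOn G U) (hy : y ∈ U) (i j : Fin m) :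
    ∑ k, (G y)⁻¹ i k * G y k j = if i = j then 1 else 0 := by
  have := congrFun (congrFun (hG.inv_mul hy) i) j
  rwa [Matrix.mul_apply, Matrix.one_apply] at this

theorem sum_mul_inv (hG : IsMetricOn G U) (hy : y ∈ U) (i j : Fin m) :
    ∑ k, G y i k * (G y)⁻¹ k j = if i = j then 1 else 0 := by
  have := congrFun (congrFun (hG.mul_inv hy) i) j
  rwa [Matrix.mul_apply, Matrix.one_apply] at this

/-- Lowering the upper index of the Christoffel symbols. -/
theorem sum_mul_christoffel (hG : IsMetricOn G U) (hy : y ∈ U) (b i j : Fin m) :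
    ∑ k, G y b k * christoffel G k i j y = (1 / 2 : ℝ) *
      (pd i (fun z => G z j b) y + pd j (fun z => G z i b) y - pd b (fun z => G z i j) y) := by
  simp only [christoffel, Finset.mul_sum]
  rw [Finset.sum_comm]
  have : ∀ l, ∑ k, G y b k * ((1 / 2 : ℝ) * ((G y)⁻¹ k l *
      (pd i (fun z => G z j l) y + pd j (fun z => G z i l) y - pd l (fun z => G z i j) y)))
      = (if b = l then 1 else 0) * ((1 / 2 : ℝ) *
      (pd i (fun z => G z j l) y + pd j (fun z => G z i l) y - pd l (fun z => G z i j) y)) := by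
    intro l
    rw [← hG.sum_mul_inv hy, Finset.sum_mul]
    exact Finset.sum_congr rfl fun k _ => by ring
  rw [Finset.sum_congr rfl fun l _ => this l]
  simp

/-- Compatibility of the Levi-Civita connection with the metric. -/
theorem pd_eq_christoffel (hG : IsMetricOn G U) (hy : y ∈ U) (c a b : Fin m) :
    pd c (fun z => G z a b) y
      = ∑ k, G y b k * christoffel G k c a y + ∑ k, G y a k * christoffel G k c b y := by
  rw [hG.sum_mul_christoffel hy, hG.sum_mul_christoffel hy, hG.pd_symm hy c b a,
    hG.pd_symm hy a c b, hG.pd_symm hy b c a, hG.pd_symm hy a b c]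
  rw [hG.pd_symm hy b a c]
  ring

/-- Differentiate G⁻¹G = 1 and multiply by G⁻¹ on the right. -/
theorem pd_inv (hG : IsMetricOn G U) (hy : y ∈ U) (i k l : Fin m) :
    pd i (fun z => (G z)⁻¹ k l) y
      = - ∑ a, ∑ b, (G y)⁻¹ k a * pd i (fun z => G z a b) y * (G y)⁻¹ b l := by
  set dI : Matrix (Fin m) (Fin m) ℝ := .of fun k l => pd i (fun z => (G z)⁻¹ k l) y with hdI
  set dG : Matrix (Fin m) (Fin m) ℝ := .of fun k l => pd i (fun z => G z k l) y with hdG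
  have h0 : dI * G y + (G y)⁻¹ * dG = 0 := by
    ext a b
    have hc : pd i (fun z => ∑ k, (G z)⁻¹ a k * G z k b) y = 0 := by
      rw [pd_congr hG.isOpen (v := fun _ => if a = b then 1 else 0)
        (fun z hz => hG.sum_inv_mul hz a b) hy i]
      simp
    have hI := fun k => (hG.smooth_inv a k).differentiableAt_of_isOpen hG.isOpen hy
    rw [pd_sum (fun k _ => (hI k).fun_mul (hG.differentiableAt hy k b))] at hc
    simp only [pd_mul (hI _) (hG.differentiableAt hy _ b), Finset.sum_add_distrib] at hc
    simpa [Matrix.mul_apply, hdI, hdG] using hc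
  have h1 : dI = -((G y)⁻¹ * dG * (G y)⁻¹) := by
    have := congrArg (· * (G y)⁻¹) h0
    simp only [add_mul, zero_mul, Matrix.mul_assoc, hG.mul_inv hy, mul_one] at this
    rw [Matrix.mul_assoc]
    exact eq_neg_of_add_eq_zero_left this
  have := congrFun (congrFun h1 k) l
  simp only [hdI, hdG, Matrix.of_apply, Matrix.neg_apply, Matrix.mul_apply, Finset.sum_mul] at this
  rw [this, Finset.sum_comm]

/-- The differential of `|∇u|²` is `2 Hess u (∇u, ·)`. -/
theorem pd_gradInner_self (hG : IsMetricOn G U) (hu : ContDiffOn ℝ ∞ u U) (hy : y ∈ U)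
    (i : Fin m) :
    pd i (gradInner G u u) y
      = 2 * ∑ k, hess G u i k y * ∑ l, (G y)⁻¹ k l * pd l u y := by
  have hI := fun k l => (hG.smooth_inv k l).differentiableAt_of_isOpen hG.isOpen hy
  have hd := fun k => (contDiffOn_pd hG.isOpen hu k).differentiableAt_of_isOpen hG.isOpen hy
  -- `w` is the gradient of u with raised index. Differentiating |∇u|² gives -(∂ᵢg)(w, w) + 2 ∂ᵢ∂ₖu
  -- wᵏ; the first term has to be matched with the Christoffel part of the Hessian.
  set w : Fin m → ℝ := fun k => ∑ l, (G y)⁻¹ k l * pd l u y with hw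
  have hw' : ∀ k, w k = ∑ l, pd l u y * (G y)⁻¹ l k := fun k =>
    Finset.sum_congr rfl fun l _ => by rw [hG.inv_apply_symm hy, mul_comm]
  have e1 : pd i (gradInner G u u) y
      = (- ∑ a, ∑ b, pd i (fun z => G z a b) y * w a * w b)
        + 2 * ∑ k, pd i (pd k u) y * w k := by
    have : gradInner G u u = fun z => ∑ k, ∑ l, (G z)⁻¹ k l * (pd k u z * pd l u z) := rfl
    rw [this, pd_sum (fun k _ => DifferentiableAt.fun_sum fun l _ => (hI k l).fun_mul ((hd k).fun_mul (hd l)))]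
    have e : ∀ k, pd i (fun z => ∑ l, (G z)⁻¹ k l * (pd k u z * pd l u z)) y
        = ∑ l, pd i (fun z => (G z)⁻¹ k l) y * (pd k u y * pd l u y)
        + ∑ l, (G y)⁻¹ k l * (pd i (pd k u) y * pd l u y)
        + ∑ l, (G y)⁻¹ k l * (pd k u y * pd i (pd l u) y) := by
      intro k
      rw [pd_sum (fun l _ => (hI k l).fun_mul ((hd k).fun_mul (hd l))), ← Finset.sum_add_distrib,
        ← Finset.sum_add_distrib]
      refine Finset.sum_congr rfl fun l _ => ?_
      rw [pd_mul (hI k l) ((hd k).fun_mul (hd l)), pd_mul (hd k) (hd l)]; ring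
    simp only [e, Finset.sum_add_distrib]
    have t2 : ∑ k, ∑ l, (G y)⁻¹ k l * (pd i (pd k u) y * pd l u y)
        = ∑ k, pd i (pd k u) y * w k := by
      simp only [hw, Finset.mul_sum]
      exact Finset.sum_congr rfl fun k _ => Finset.sum_congr rfl fun l _ => by ring
    have t3 : ∑ k, ∑ l, (G y)⁻¹ k l * (pd k u y * pd i (pd l u) y)
        = ∑ k, pd i (pd k u) y * w k := by
      rw [Finset.sum_comm]
      simp only [hw', Finset.mul_sum]
      exact Finset.sum_congr rfl fun k _ => Finset.sum_congr rfl fun l _ => by ring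
    have t1 : ∑ k, ∑ l, pd i (fun z => (G z)⁻¹ k l) y * (pd k u y * pd l u y)
        = - ∑ a, ∑ b, pd i (fun z => G z a b) y * w a * w b := by
      simp only [hG.pd_inv hy, neg_mul, Finset.sum_neg_distrib, Finset.sum_mul]
      congr 1
      have : ∀ a b, pd i (fun z => G z a b) y * w a * w b
          = ∑ k, ∑ l, (G y)⁻¹ k a * pd i (fun z => G z a b) y * (G y)⁻¹ b l
            * (pd k u y * pd l u y) := by
        intro a b
        rw [hw' a]
        simp only [hw, Finset.mul_sum, Finset.sum_mul]
        rw [Finset.sum_comm]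
        exact Finset.sum_congr rfl fun k _ => Finset.sum_congr rfl fun l _ => by ring
      simp only [this]
      calc _ = ∑ k, ∑ a, ∑ l, ∑ b, (G y)⁻¹ k a * pd i (fun z => G z a b) y * (G y)⁻¹ b l
            * (pd k u y * pd l u y) :=
            Finset.sum_congr rfl fun k _ => Finset.sum_comm
        _ = ∑ a, ∑ k, ∑ b, ∑ l, (G y)⁻¹ k a * pd i (fun z => G z a b) y * (G y)⁻¹ b l
            * (pd k u y * pd l u y) := by
            rw [Finset.sum_comm]
            exact Finset.sum_congr rfl fun a _ => Finset.sum_congr rfl fun k _ => Finset.sum_comm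
        _ = _ := Finset.sum_congr rfl fun a _ => Finset.sum_comm
    rw [t1, t2, t3]; ring
  have e2 : ∀ k, ∑ a, christoffel G a i k y * pd a u y = (1 / 2 : ℝ) * ∑ l, w l *
      (pd i (fun z => G z k l) y + pd k (fun z => G z i l) y - pd l (fun z => G z i k) y) := by
    intro k
    simp only [christoffel, hw', Finset.mul_sum, Finset.sum_mul]
    rw [Finset.sum_comm]
    exact Finset.sum_congr rfl fun a _ => Finset.sum_congr rfl fun l _ => by ring
  -- An expression antisymmetric in k, l is contracted with the symmetric w ⊗ w, so only the ∂ᵢg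
  -- term of Γ survives.
  have e3 : ∑ k, (∑ l, w l * (pd k (fun z => G z i l) y - pd l (fun z => G z i k) y)) * w k
      = 0 := by
    have : ∀ k l, w l * (pd k (fun z => G z i l) y - pd l (fun z => G z i k) y) * w k
      = w k * w l * pd k (fun z => G z i l) y - w l * w k * pd l (fun z => G z i k) y := by
      intros; ring
    simp only [Finset.sum_mul, this, Finset.sum_sub_distrib]
    rw [sub_eq_zero]
    exact Finset.sum_comm
  have e4 : ∑ k, (∑ a, christoffel G a i k y * pd a u y) * w k
      = (1 / 2 : ℝ) * ∑ a, ∑ b, pd i (fun z => G z a b) y * w a * w b := by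
    have : ∀ k, (∑ a, christoffel G a i k y * pd a u y) * w k
        = (1 / 2 : ℝ) * (∑ l, pd i (fun z => G z k l) y * w k * w l)
        + (1 / 2 : ℝ) * ((∑ l, w l * (pd k (fun z => G z i l) y - pd l (fun z => G z i k) y))
            * w k) := by
      intro k
      rw [e2, ← mul_add, mul_assoc]
      congr 1
      simp only [Finset.sum_mul, ← Finset.sum_add_distrib]
      exact Finset.sum_congr rfl fun l _ => by ring
    simp only [this, Finset.sum_add_distrib, ← Finset.mul_sum, e3]
    ring
  simp only [hess, sub_mul, Finset.sum_sub_distrib]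
  rw [e1, e4]
  ring

end IsMetricOn

/-! ### Change of coordinates -/

/-- The Jacobian matrix `∂ᵢ ψᵃ`. -/
noncomputable def jac {m n : ℕ} (ψ : Coord m → Coord n) (z : Coord m) :
    Matrix (Fin n) (Fin m) ℝ :=
  .of fun a i => pd i (fun x => ψ x a) z

section Chain

variable {m n : ℕ} {ψ : Coord m → Coord n} {V : Set (Coord m)} {U : Set (Coord n)} {z : Coord m}

theorem contDiffOn_coord (hψ : ContDiffOn ℝ ∞ ψ V) (a : Fin n) :
    ContDiffOn ℝ ∞ (fun x => ψ x a) V :=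
  (EuclideanSpace.proj (𝕜 := ℝ) a : Coord n →L[ℝ] ℝ).contDiff.comp_contDiffOn hψ

theorem fderiv_apply_coord (hψ : DifferentiableAt ℝ ψ z) (a : Fin n) (w : Coord m) :
    fderiv ℝ (fun x => ψ x a) z w = fderiv ℝ ψ z w a := by
  have h : (fun x => ψ x a) = (EuclideanSpace.proj (𝕜 := ℝ) a : Coord n →L[ℝ] ℝ) ∘ ψ := rfl
  rw [h, fderiv_comp z (ContinuousLinearMap.differentiableAt _) hψ, ContinuousLinearMap.fderiv]
  rfl

theorem jac_apply (hψ : DifferentiableAt ℝ ψ z) (a : Fin n) (i : Fin m) :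
    jac ψ z a i = fderiv ℝ ψ z (EuclideanSpace.single i 1) a :=
  fderiv_apply_coord hψ a _

/-- The chain rule for partial derivatives. -/
theorem pd_comp {u : Coord n → ℝ} (hψ : DifferentiableAt ℝ ψ z)
    (hu : DifferentiableAt ℝ u (ψ z)) (i : Fin m) :
    pd i (fun x => u (ψ x)) z = ∑ a, jac ψ z a i * pd a u (ψ z) := by
  have h : (fun x => u (ψ x)) = u ∘ ψ := rfl
  rw [h, pd, fderiv_comp z hu hψ, ContinuousLinearMap.comp_apply, fderiv_apply_eq_sum_pd]
  simp only [jac_apply hψ]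

theorem contDiffOn_jac (hV : IsOpen V) (hψ : ContDiffOn ℝ ∞ ψ V) (a : Fin n) (i : Fin m) :
    ContDiffOn ℝ ∞ (fun x => jac ψ x a i) V :=
  contDiffOn_pd hV (contDiffOn_coord hψ a) i

end Chain

theorem metricTrace_eq_trace {m : ℕ} (G B : Matrix (Fin m) (Fin m) ℝ) :
    metricTrace G B = (G⁻¹ * B.transpose).trace := by
  simp [metricTrace, Matrix.trace, Matrix.mul_apply]

/-- The trace with respect to a metric does not depend on the coordinates. -/
theorem metricTrace_conj {m : ℕ} (G B J : Matrix (Fin m) (Fin m) ℝ) (hJ : IsUnit J.det) :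
    metricTrace (J.transpose * G * J) (J.transpose * B * J) = metricTrace G B := by
  have hJ' : IsUnit J.transpose.det := by rwa [Matrix.det_transpose]
  simp only [metricTrace_eq_trace, Matrix.transpose_mul, Matrix.mul_inv_rev,
    Matrix.transpose_transpose]
  rw [show J⁻¹ * (G⁻¹ * J.transpose⁻¹) * (J.transpose * (B.transpose * J))
      = J⁻¹ * (G⁻¹ * (J.transpose⁻¹ * J.transpose) * B.transpose * J) by
      simp only [Matrix.mul_assoc], Matrix.nonsing_inv_mul _ hJ', Matrix.mul_one,
    Matrix.trace_mul_comm, Matrix.mul_assoc, Matrix.mul_nonsing_inv _ hJ, Matrix.mul_one]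

namespace IsMetricOn

variable {m : ℕ} {G G' : Coord m → Matrix (Fin m) (Fin m) ℝ} {U V : Set (Coord m)}
  {ψ : Coord m → Coord m} {z : Coord m} {u v : Coord m → ℝ}

/-- The determinant of the transformed metric is nonzero and has det J as a factor, so ψ need not be
assumed a local diffeomorphism. -/
theorem isUnit_det_jac (hG' : IsMetricOn G' V)
    (h : ∀ x ∈ V, G' x = (jac ψ x).transpose * G (ψ x) * jac ψ x) (hz : z ∈ V) :
    IsUnit (jac ψ z).det := by
  have := (hG'.posDef z hz).det_pos.ne'
  rw [h z hz, Matrix.det_mul] at this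
  exact (right_ne_zero_of_mul this).isUnit

/-- The derivative of the transformed metric. -/
theorem pd_transform (hG : IsMetricOn G U) (hV : IsOpen V) (hψ : ContDiffOn ℝ ∞ ψ V)
    (hm : Set.MapsTo ψ V U)
    (h : ∀ x ∈ V, G' x = (jac ψ x).transpose * G (ψ x) * jac ψ x) (hz : z ∈ V) (l i j : Fin m) :
    pd l (fun x => G' x i j) z
      = ∑ a, ∑ b, pd l (fun x => jac ψ x a i) z * jac ψ z b j * G (ψ z) a b
      + ∑ a, ∑ b, pd l (fun x => jac ψ x a j) z * jac ψ z b i * G (ψ z) a b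
      + ∑ a, ∑ b, ∑ c, jac ψ z a i * jac ψ z b j * jac ψ z c l
          * pd c (fun x => G x a b) (ψ z) := by
  have hJ := fun a i => (contDiffOn_jac hV hψ a i).differentiableAt_of_isOpen hV hz
  have hψd : DifferentiableAt ℝ ψ z := (hψ.differentiableOn (by simp)).differentiableAt
    (hV.mem_nhds hz)
  have hGd := fun a b => hG.differentiableAt (hm hz) a b
  have hGψ : ∀ a b, DifferentiableAt ℝ (fun x => G (ψ x) a b) z := fun a b =>
    (hGd a b).comp z hψd
  rw [pd_congr hV (v := fun x => ∑ a, ∑ b, jac ψ x a i * jac ψ x b j * G (ψ x) a b) ?_ hz]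
  · rw [pd_sum (fun a _ => DifferentiableAt.fun_sum fun b _ =>
      ((hJ a i).fun_mul (hJ b j)).fun_mul (hGψ a b))]
    -- The second term is written with G b a, so that exchanging the two sums puts it in the form of
    -- the statement.
    have e : ∀ a b, pd l (fun x => jac ψ x a i * jac ψ x b j * G (ψ x) a b) z
        = pd l (fun x => jac ψ x a i) z * jac ψ z b j * G (ψ z) a b
        + pd l (fun x => jac ψ x b j) z * jac ψ z a i * G (ψ z) b a
        + ∑ c, jac ψ z a i * jac ψ z b j * jac ψ z c l * pd c (fun x => G x a b) (ψ z) := by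
      intro a b
      rw [pd_mul ((hJ a i).fun_mul (hJ b j)) (hGψ a b), pd_mul (hJ a i) (hJ b j),
        pd_comp (u := fun x => G x a b) hψd (hGd a b), hG.apply_symm (hm hz) b a, Finset.mul_sum]
      have : ∀ c, jac ψ z a i * jac ψ z b j * (jac ψ z c l * pd c (fun x => G x a b) (ψ z))
        = jac ψ z a i * jac ψ z b j * jac ψ z c l * pd c (fun x => G x a b) (ψ z) := by
        intro c; ring
      simp only [this]; ring
    have e' : ∀ a, pd l (fun x => ∑ b, jac ψ x a i * jac ψ x b j * G (ψ x) a b) z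
        = ∑ b, pd l (fun x => jac ψ x a i) z * jac ψ z b j * G (ψ z) a b
        + ∑ b, pd l (fun x => jac ψ x b j) z * jac ψ z a i * G (ψ z) b a
        + ∑ b, ∑ c, jac ψ z a i * jac ψ z b j * jac ψ z c l * pd c (fun x => G x a b) (ψ z) := by
      intro a
      rw [pd_sum (fun b _ => ((hJ a i).fun_mul (hJ b j)).fun_mul (hGψ a b))]
      simp only [e, Finset.sum_add_distrib]
    simp only [e', Finset.sum_add_distrib]
    congr 2
    exact Finset.sum_comm
  · intro x hx
    simp only [h x hx, Matrix.mul_apply, Matrix.transpose_apply, Finset.sum_mul]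
    rw [Finset.sum_comm]
    exact Finset.sum_congr rfl fun a _ => Finset.sum_congr rfl fun b _ => by ring

theorem pd_jac_comm (hV : IsOpen V) (hψ : ContDiffOn ℝ ∞ ψ V) (hz : z ∈ V) (a l i : Fin m) :
    pd l (fun x => jac ψ x a i) z = pd i (fun x => jac ψ x a l) z :=
  pd_comm hV (contDiffOn_coord hψ a) hz l i

/-- The transformation law of the Christoffel symbols. -/
theorem christoffel_transform (hG : IsMetricOn G U) (hG' : IsMetricOn G' V)
    (hψ : ContDiffOn ℝ ∞ ψ V) (hm : Set.MapsTo ψ V U)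
    (h : ∀ x ∈ V, G' x = (jac ψ x).transpose * G (ψ x) * jac ψ x) (hz : z ∈ V) (c i j : Fin m) :
    ∑ k, jac ψ z c k * christoffel G' k i j z
      = pd i (fun x => jac ψ x c j) z
        + ∑ a, ∑ b, christoffel G c a b (ψ z) * jac ψ z a i * jac ψ z b j := by
  have hV := hG'.isOpen
  have hJu := isUnit_det_jac hG' h hz
  set J := jac ψ z with hJ
  set lhs : Fin m → ℝ := fun c => ∑ k, J c k * christoffel G' k i j z with hlhs
  set rhs : Fin m → ℝ := fun c => pd i (fun x => jac ψ x c j) z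
        + ∑ a, ∑ b, christoffel G c a b (ψ z) * J a i * J b j with hrhs
  suffices hh : lhs = rhs from congrFun hh c
  -- Multiplying by the invertible matrix Jᵀ G lowers the free index; both sides then involve only
  -- first derivatives of the metrics and of the Jacobian.
  have hK : IsUnit (J.transpose * G (ψ z)).det := by
    rw [Matrix.det_mul, Matrix.det_transpose]
    exact hJu.mul (hG.posDef _ (hm hz)).det_pos.ne'.isUnit
  suffices hh : (J.transpose * G (ψ z)).mulVec lhs = (J.transpose * G (ψ z)).mulVec rhs from
    Matrix.mulVec_injective_of_isUnit ((Matrix.isUnit_iff_isUnit_det _).2 hK) hh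
  have hl : (J.transpose * G (ψ z)).mulVec lhs
      = (G' z).mulVec fun k => christoffel G' k i j z := by
    have : lhs = J.mulVec fun k => christoffel G' k i j z := by
      ext c; simp [hlhs, Matrix.mulVec, dotProduct]
    rw [this, Matrix.mulVec_mulVec, h z hz]
  rw [hl]
  ext l
  have e1 : (G' z).mulVec (fun k => christoffel G' k i j z) l
      = ∑ k, G' z l k * christoffel G' k i j z := by simp [Matrix.mulVec, dotProduct]
  rw [e1, hG'.sum_mul_christoffel hz]
  set A : Fin m → Fin m → Fin m → ℝ := fun l i j =>
    ∑ a, ∑ b, pd l (fun x => jac ψ x a i) z * J b j * G (ψ z) a b with hA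
  set C : Fin m → Fin m → Fin m → ℝ := fun l i j =>
    ∑ a, ∑ b, ∑ c, J a i * J b j * J c l * pd c (fun x => G x a b) (ψ z) with hC
  have hp : ∀ l i j, pd l (fun x => G' x i j) z = A l i j + A l j i + C l i j := fun l i j =>
    hG.pd_transform hV hψ hm h hz l i j
  have hAs : ∀ l i j, A l i j = A i l j := fun l i j => by
    simp only [hA]
    exact Finset.sum_congr rfl fun a _ => Finset.sum_congr rfl fun b _ => by
      rw [pd_jac_comm hV hψ hz]
  have er : (J.transpose * G (ψ z)).mulVec rhs l
      = A i j l + (1 / 2 : ℝ) * (C i j l + C j i l - C l i j) := by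
    have e2 : (J.transpose * G (ψ z)).mulVec rhs l = ∑ d, J d l * ∑ c, G (ψ z) d c * rhs c := by
      rw [← Matrix.mulVec_mulVec]
      simp [Matrix.mulVec, dotProduct]
    have e3 : ∀ d, ∑ c, G (ψ z) d c * rhs c
        = ∑ c, pd i (fun x => jac ψ x c j) z * G (ψ z) c d
        + ∑ a, ∑ b, (J a i * J b j) * ((1 / 2 : ℝ) * (pd a (fun x => G x b d) (ψ z)
            + pd b (fun x => G x a d) (ψ z) - pd d (fun x => G x a b) (ψ z))) := by
      intro d
      simp only [hrhs, mul_add, Finset.sum_add_distrib, ← hG.sum_mul_christoffel (hm hz)]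
      congr 1
      · exact Finset.sum_congr rfl fun c _ => by rw [hG.apply_symm (hm hz), mul_comm]
      · simp only [Finset.mul_sum]
        rw [Finset.sum_comm]
        refine Finset.sum_congr rfl fun a _ => ?_
        rw [Finset.sum_comm]
        exact Finset.sum_congr rfl fun b _ => Finset.sum_congr rfl fun c _ => by ring
    have e4 : ∑ d, J d l * ∑ c, pd i (fun x => jac ψ x c j) z * G (ψ z) c d = A i j l := by
      simp only [hA, Finset.mul_sum]
      rw [Finset.sum_comm]
      exact Finset.sum_congr rfl fun c _ => Finset.sum_congr rfl fun b _ => by ring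
    have c1 : C i j l = ∑ d, ∑ a, ∑ b, J d l * J a i * J b j * pd a (fun x => G x b d) (ψ z) := by
      simp only [hC]
      rw [Finset.sum_comm]
      refine Finset.sum_congr rfl fun d _ => ?_
      rw [Finset.sum_comm]
      exact Finset.sum_congr rfl fun c _ => Finset.sum_congr rfl fun b _ => by ring
    have c2 : C j i l = ∑ d, ∑ a, ∑ b, J d l * J a i * J b j * pd b (fun x => G x a d) (ψ z) := by
      simp only [hC]
      rw [Finset.sum_comm]
      refine Finset.sum_congr rfl fun d _ => ?_
      exact Finset.sum_congr rfl fun c _ => Finset.sum_congr rfl fun b _ => by ring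
    have c3 : C l i j = ∑ d, ∑ a, ∑ b, J d l * J a i * J b j * pd d (fun x => G x a b) (ψ z) := by
      simp only [hC]
      calc _ = ∑ a, ∑ d, ∑ b, J a i * J b j * J d l * pd d (fun x => G x a b) (ψ z) :=
            Finset.sum_congr rfl fun a _ => Finset.sum_comm
        _ = ∑ d, ∑ a, ∑ b, J a i * J b j * J d l * pd d (fun x => G x a b) (ψ z) :=
            Finset.sum_comm
        _ = _ := Finset.sum_congr rfl fun a _ => Finset.sum_congr rfl fun b _ =>
            Finset.sum_congr rfl fun c _ => by ring
    rw [e2, c1, c2, c3]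
    simp only [e3, mul_add, Finset.sum_add_distrib]
    rw [e4]
    congr 1
    simp only [← Finset.sum_add_distrib, ← Finset.sum_sub_distrib, Finset.mul_sum]
    exact Finset.sum_congr rfl fun a _ => Finset.sum_congr rfl fun b _ =>
            Finset.sum_congr rfl fun c _ => by ring
  rw [er, hp, hp, hp, hAs j i l, hAs i l j, hAs j l i]
  ring

/-- The Hessian is a tensor. -/
theorem hess_transform (hG : IsMetricOn G U) (hG' : IsMetricOn G' V)
    (hψ : ContDiffOn ℝ ∞ ψ V) (hm : Set.MapsTo ψ V U)
    (h : ∀ x ∈ V, G' x = (jac ψ x).transpose * G (ψ x) * jac ψ x) (hz : z ∈ V)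
    (hu : ContDiffOn ℝ ∞ u U) :
    Matrix.of (fun i j => hess G' (fun x => u (ψ x)) i j z)
      = (jac ψ z).transpose * Matrix.of (fun a b => hess G u a b (ψ z)) * jac ψ z := by
  have hV := hG'.isOpen
  have hψd : ∀ x ∈ V, DifferentiableAt ℝ ψ x := fun x hx =>
    (hψ.differentiableOn (by simp)).differentiableAt (hV.mem_nhds hx)
  have hud : ∀ x ∈ V, DifferentiableAt ℝ u (ψ x) := fun x hx =>
    hu.differentiableAt_of_isOpen hG.isOpen (hm hx)
  have hudd : ∀ a, DifferentiableAt ℝ (pd a u) (ψ z) := fun a =>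
    (contDiffOn_pd hG.isOpen hu a).differentiableAt_of_isOpen hG.isOpen (hm hz)
  have hJ := fun a i => (contDiffOn_jac hV hψ a i).differentiableAt_of_isOpen hV hz
  have huc : ∀ a, DifferentiableAt ℝ (fun x => pd a u (ψ x)) z := fun a =>
    (hudd a).comp z (hψd z hz)
  have h1 : ∀ i x, x ∈ V → pd i (fun x => u (ψ x)) x = ∑ a, jac ψ x a i * pd a u (ψ x) :=
    fun i x hx => pd_comp (hψd x hx) (hud x hx) i
  ext i j
  have e1 : pd i (pd j (fun x => u (ψ x))) z
      = ∑ a, pd i (fun x => jac ψ x a j) z * pd a u (ψ z)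
      + ∑ a, ∑ b, jac ψ z a i * jac ψ z b j * pd a (pd b u) (ψ z) := by
    rw [pd_congr hV (h1 j) hz, pd_sum (fun a _ => (hJ a j).fun_mul (huc a))]
    have : ∀ b, pd i (fun x => jac ψ x b j * pd b u (ψ x)) z
        = pd i (fun x => jac ψ x b j) z * pd b u (ψ z)
        + ∑ a, jac ψ z a i * jac ψ z b j * pd a (pd b u) (ψ z) := by
      intro b
      rw [pd_mul (hJ b j) (huc b), pd_comp (u := pd b u) (hψd z hz) (hudd b), Finset.mul_sum]
      congr 1
      exact Finset.sum_congr rfl fun a _ => by ring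
    simp only [this, Finset.sum_add_distrib]
    congr 1
    exact Finset.sum_comm
  -- The inhomogeneous term of the Christoffel law is the second-derivative term of the chain rule
  -- in `e1`; they cancel in the Hessian.
  have e2 : ∑ k, christoffel G' k i j z * pd k (fun x => u (ψ x)) z
      = ∑ c, pd i (fun x => jac ψ x c j) z * pd c u (ψ z)
      + ∑ a, ∑ b, jac ψ z a i * jac ψ z b j * ∑ c, christoffel G c a b (ψ z) * pd c u (ψ z) := by
    have : ∑ k, christoffel G' k i j z * pd k (fun x => u (ψ x)) z
        = ∑ c, (∑ k, jac ψ z c k * christoffel G' k i j z) * pd c u (ψ z) := by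
      simp only [h1 _ z hz, Finset.mul_sum, Finset.sum_mul]
      rw [Finset.sum_comm]
      exact Finset.sum_congr rfl fun a _ => Finset.sum_congr rfl fun b _ => by ring
    rw [this]
    simp only [hG.christoffel_transform hG' hψ hm h hz, add_mul, Finset.sum_add_distrib]
    congr 1
    simp only [Finset.sum_mul, Finset.mul_sum]
    rw [Finset.sum_comm]
    refine Finset.sum_congr rfl fun a _ => ?_
    rw [Finset.sum_comm]
    exact Finset.sum_congr rfl fun b _ => Finset.sum_congr rfl fun c _ => by ring
  simp only [Matrix.of_apply, hess, Matrix.mul_apply, Matrix.transpose_apply, e1, e2,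
    Finset.sum_mul]
  rw [add_sub_add_left_eq_sub, ← Finset.sum_sub_distrib, Finset.sum_comm (γ := Fin m)]
  refine Finset.sum_congr rfl fun a _ => ?_
  rw [← Finset.sum_sub_distrib]
  exact Finset.sum_congr rfl fun b _ => by ring

/-- The Laplacian does not depend on the coordinates. -/
theorem laplacian_transform (hG : IsMetricOn G U) (hG' : IsMetricOn G' V)
    (hψ : ContDiffOn ℝ ∞ ψ V) (hm : Set.MapsTo ψ V U)
    (h : ∀ x ∈ V, G' x = (jac ψ x).transpose * G (ψ x) * jac ψ x) (hz : z ∈ V)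
    (hu : ContDiffOn ℝ ∞ u U) :
    coordLaplacian G' (fun x => u (ψ x)) z = coordLaplacian G u (ψ z) := by
  have := hG.hess_transform hG' hψ hm h hz hu
  change metricTrace (G' z) (Matrix.of fun i j => hess G' (fun x => u (ψ x)) i j z)
    = metricTrace (G (ψ z)) (Matrix.of fun i j => hess G u i j (ψ z))
  rw [this, h z hz, metricTrace_conj _ _ _ (isUnit_det_jac hG' h hz)]

/-- The pairing of gradients does not depend on the coordinates. -/
theorem gradInner_transform (hG' : IsMetricOn G' V)
    (h : ∀ x ∈ V, G' x = (jac ψ x).transpose * G (ψ x) * jac ψ x) (hz : z ∈ V)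
    (hψ : DifferentiableAt ℝ ψ z) (hu : DifferentiableAt ℝ u (ψ z))
    (hv : DifferentiableAt ℝ v (ψ z)) :
    gradInner G' (fun x => u (ψ x)) (fun x => v (ψ x)) z = gradInner G u v (ψ z) := by
  change metricTrace _ _
    = metricTrace (G (ψ z)) (Matrix.of fun i j => pd i u (ψ z) * pd j v (ψ z))
  rw [← metricTrace_conj _ _ _ (isUnit_det_jac hG' h hz), h z hz]
  congr 1
  ext i j
  simp only [Matrix.mul_apply, Matrix.transpose_apply, Matrix.of_apply, pd_comp hψ hu, pd_comp hψ hv,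
    Finset.sum_mul, Finset.mul_sum]
  refine Finset.sum_congr rfl fun a _ => Finset.sum_congr rfl fun b _ => ?_
  ring

end IsMetricOn

/-! ### Identities at the centre of normal coordinates -/

/-- The coordinates are normal at `y` up to first order: `G = 1` and `dG = 0` at `y`. -/
structure IsNormalAt {m : ℕ} (G : Coord m → Matrix (Fin m) (Fin m) ℝ) (U : Set (Coord m))
    (y : Coord m) : Prop where
  metric : IsMetricOn G U
  mem : y ∈ U
  eq_one : G y = 1
  pd_eq_zero : ∀ l i j, pd l (fun z => G z i j) y = 0

theorem metricTrace_one {m : ℕ} (B : Matrix (Fin m) (Fin m) ℝ) :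
    metricTrace 1 B = ∑ i, B i i := by
  simp [metricTrace, Matrix.one_apply]

/-- The Leibniz rule of second order. -/
theorem pd_pd_mul {m : ℕ} {U : Set (Coord m)} {u v : Coord m → ℝ} {y : Coord m} (hU : IsOpen U)
    (hu : ContDiffOn ℝ ∞ u U) (hv : ContDiffOn ℝ ∞ v U) (hy : y ∈ U) (p l : Fin m) :
    pd p (pd l (fun z => u z * v z)) y = pd p (pd l u) y * v y + pd l u y * pd p v y
      + (pd p u y * pd l v y + u y * pd p (pd l v) y) := by
  have d := fun {w : Coord m → ℝ} (hw : ContDiffOn ℝ ∞ w U) {z} (hz : z ∈ U) =>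
    hw.differentiableAt_of_isOpen hU hz
  have hu' := d (contDiffOn_pd hU hu l) hy
  have hv' := d (contDiffOn_pd hU hv l) hy
  rw [pd_congr hU (fun z hz => pd_mul (d hu hz) (d hv hz) l) hy,
    pd_add (hu'.fun_mul (d hv hy)) ((d hu hy).fun_mul hv'), pd_mul hu' (d hv hy),
    pd_mul (d hu hy) hv']

theorem pd_pd_sum {m : ℕ} {ι : Type*} {s : Finset ι} {U : Set (Coord m)} {w : ι → Coord m → ℝ}
    {y : Coord m} (hU : IsOpen U)
    (hw : ∀ k ∈ s, ContDiffOn ℝ ∞ (w k) U) (hy : y ∈ U) (p l : Fin m) :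
    pd p (pd l (fun z => ∑ k ∈ s, w k z)) y = ∑ k ∈ s, pd p (pd l (w k)) y := by
  rw [pd_congr hU (fun z hz => pd_sum
    (fun k hk => (hw k hk).differentiableAt_of_isOpen hU hz) l) hy,
    pd_sum fun k hk => (contDiffOn_pd hU (hw k hk) l).differentiableAt_of_isOpen hU hy]

namespace IsNormalAt

variable {m : ℕ} {G : Coord m → Matrix (Fin m) (Fin m) ℝ} {U : Set (Coord m)}
  {u : Coord m → ℝ} {y : Coord m}

theorem diff (h : IsNormalAt G U y) (hu : ContDiffOn ℝ ∞ u U) : DifferentiableAt ℝ u y :=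
  hu.differentiableAt_of_isOpen h.metric.isOpen h.mem

theorem inv_eq_one (h : IsNormalAt G U y) : (G y)⁻¹ = 1 := by simp [h.eq_one]

theorem pd_inv (h : IsNormalAt G U y) (l i j : Fin m) : pd l (fun z => (G z)⁻¹ i j) y = 0 := by
  simp [h.metric.pd_inv h.mem, h.pd_eq_zero]

theorem christoffel_eq_zero (h : IsNormalAt G U y) (k i j : Fin m) :
    christoffel G k i j y = 0 := by
  simp [christoffel, h.pd_eq_zero]

/-- Only the derivative falling on the bracket of first derivatives survives, because the inverse
metric is stationary at the centre. -/
theorem pd_christoffel (h : IsNormalAt G U y) (l k i j : Fin m) :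
    pd l (christoffel G k i j) y = (1 / 2 : ℝ) * (pd l (pd i fun z => G z j k) y
      + pd l (pd j fun z => G z i k) y - pd l (pd k fun z => G z i j) y) := by
  have hs := h.metric.smooth_pd
  have hA : ∀ a, ContDiffOn ℝ ∞ (fun z => pd i (fun z => G z j a) z
      + pd j (fun z => G z i a) z - pd a (fun z => G z i j) z) U := fun a =>
    ((hs i j a).add (hs j i a)).sub (hs a i j)
  have hI := fun a => h.metric.smooth_inv k a
  unfold christoffel
  rw [pd_const_mul (DifferentiableAt.fun_sum fun a _ => (h.diff (hI a)).fun_mul (h.diff (hA a))),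
    pd_sum (fun a _ => (h.diff (hI a)).fun_mul (h.diff (hA a)))]
  congr 1
  have : ∀ a, pd l (fun z => (G z)⁻¹ k a * (pd i (fun z => G z j a) z
      + pd j (fun z => G z i a) z - pd a (fun z => G z i j) z)) y
      = (1 : Matrix (Fin m) (Fin m) ℝ) k a * (pd l (pd i fun z => G z j a) y
      + pd l (pd j fun z => G z i a) y - pd l (pd a fun z => G z i j) y) := by
    intro a
    rw [pd_mul (h.diff (hI a)) (h.diff (hA a)), h.pd_inv, h.inv_eq_one,
      pd_sub ((h.diff (hs i j a)).fun_add (h.diff (hs j i a))) (h.diff (hs a i j)),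
      pd_add (h.diff (hs i j a)) (h.diff (hs j i a))]
    ring
  simp [this, Matrix.one_apply]

/-- In the second-order Leibniz rule the mixed terms contain a first derivative of G⁻¹, and the
second derivative of G⁻¹ multiplies the bracket, which is zero at y. Third derivatives of G alone
remain. -/
theorem pd_pd_christoffel (h : IsNormalAt G U y) (p l k i j : Fin m) :
    pd p (pd l (christoffel G k i j)) y = (1 / 2 : ℝ) * (pd p (pd l (pd i fun z => G z j k)) y
      + pd p (pd l (pd j fun z => G z i k)) y - pd p (pd l (pd k fun z => G z i j)) y) := by
  have hU := h.metric.isOpen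
  have hs := h.metric.smooth_pd
  have hA : ∀ a, ContDiffOn ℝ ∞ (fun z => pd i (fun z => G z j a) z
      + pd j (fun z => G z i a) z - pd a (fun z => G z i j) z) U := fun a =>
    ((hs i j a).add (hs j i a)).sub (hs a i j)
  have hI := fun a => h.metric.smooth_inv k a
  have hc : christoffel G k i j = fun z => ∑ a, ((1 / 2 : ℝ) * (G z)⁻¹ k a) *
      (pd i (fun z => G z j a) z + pd j (fun z => G z i a) z - pd a (fun z => G z i j) z) := by
    ext z
    simp only [christoffel, Finset.mul_sum, mul_assoc]
  have hI' : ∀ a, ContDiffOn ℝ ∞ (fun z => (1 / 2 : ℝ) * (G z)⁻¹ k a) U := fun a =>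
    contDiffOn_const.mul (hI a)
  rw [hc, pd_pd_sum hU (fun a _ => (hI' a).mul (hA a)) h.mem]
  have : ∀ a, pd p (pd l (fun z => ((1 / 2 : ℝ) * (G z)⁻¹ k a) * (pd i (fun z => G z j a) z
      + pd j (fun z => G z i a) z - pd a (fun z => G z i j) z))) y
      = (1 : Matrix (Fin m) (Fin m) ℝ) k a * ((1 / 2 : ℝ) * (pd p (pd l (pd i fun z => G z j a)) y
      + pd p (pd l (pd j fun z => G z i a)) y - pd p (pd l (pd a fun z => G z i j)) y)) := by
    intro a
    have d := fun {w : Coord m → ℝ} (hw : ContDiffOn ℝ ∞ w U) {z} (hz : z ∈ U) =>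
      hw.differentiableAt_of_isOpen hU hz
    have hs' := fun q i j => contDiffOn_pd hU (hs q i j) l
    rw [pd_pd_mul hU (hI' a) (hA a) h.mem, pd_const_mul (h.diff (hI a)),
      pd_const_mul (h.diff (hI a)), h.pd_inv, h.pd_inv, h.inv_eq_one, h.pd_eq_zero, h.pd_eq_zero,
      h.pd_eq_zero, pd_congr hU (fun z hz => (pd_sub ((d (hs i j a) hz).fun_add
        (d (hs j i a) hz)) (d (hs a i j) hz) l).trans
        (congrArg (· - _) (pd_add (d (hs i j a) hz) (d (hs j i a) hz) l))) h.mem,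
      pd_sub ((h.diff (hs' i j a)).fun_add (h.diff (hs' j i a))) (h.diff (hs' a i j)),
      pd_add (h.diff (hs' i j a)) (h.diff (hs' j i a))]
    ring
  rw [Finset.sum_congr rfl fun a _ => this a]
  simp [Matrix.one_apply]

theorem ricci_apply (h : IsNormalAt G U y) (i j : Fin m) :
    ricci G i j y = ∑ k, (pd k (christoffel G k i j) y - pd j (christoffel G k i k) y) := by
  simp [ricci, h.christoffel_eq_zero]

/-- The quadratic terms ΓΓ do not contribute: after one differentiation each still contains an
undifferentiated Γ, which vanishes at y. -/
theorem pd_ricci (h : IsNormalAt G U y) (l i j : Fin m) :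
    pd l (ricci G i j) y
      = ∑ k, (pd l (pd k (christoffel G k i j)) y - pd l (pd j (christoffel G k i k)) y) := by
  have hU := h.metric.isOpen
  have hΓ := h.metric.smooth_christoffel
  have hΓ' := fun q k i j => contDiffOn_pd hU (hΓ k i j) q
  have d1 : ∀ k, DifferentiableAt ℝ (fun z => pd k (christoffel G k i j) z
      - pd j (christoffel G k i k) z) y := fun k =>
    (h.diff (hΓ' k k i j)).fun_sub (h.diff (hΓ' j k i k))
  have d2 : ∀ k l, DifferentiableAt ℝ (fun z => christoffel G k k l z * christoffel G l i j z
      - christoffel G k j l z * christoffel G l i k z) y := fun k l =>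
    ((h.diff (hΓ k k l)).fun_mul (h.diff (hΓ l i j))).fun_sub
      ((h.diff (hΓ k j l)).fun_mul (h.diff (hΓ l i k)))
  unfold ricci
  rw [pd_add (DifferentiableAt.fun_sum fun k _ => d1 k)
    (DifferentiableAt.fun_sum fun k _ => DifferentiableAt.fun_sum fun l _ => d2 k l),
    pd_sum (fun k _ => d1 k), pd_sum (fun k _ => DifferentiableAt.fun_sum fun l _ => d2 k l)]
  have z : ∀ k, pd l (fun z => ∑ l, (christoffel G k k l z * christoffel G l i j z
      - christoffel G k j l z * christoffel G l i k z)) y = 0 := by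
    intro k
    rw [pd_sum fun l _ => d2 k l]
    refine Finset.sum_eq_zero fun q _ => ?_
    rw [pd_sub ((h.diff (hΓ k k q)).fun_mul (h.diff (hΓ q i j)))
      ((h.diff (hΓ k j q)).fun_mul (h.diff (hΓ q i k))),
      pd_mul (h.diff (hΓ k k q)) (h.diff (hΓ q i j)),
      pd_mul (h.diff (hΓ k j q)) (h.diff (hΓ q i k))]
    simp [h.christoffel_eq_zero]
  simp only [z, Finset.sum_const_zero, add_zero]
  exact Finset.sum_congr rfl fun k _ => pd_sub (h.diff (hΓ' k k i j)) (h.diff (hΓ' j k i k)) l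

/-- The contracted second Bianchi identity. -/
theorem sum_pd_ricci (h : IsNormalAt G U y) (j : Fin m) :
    ∑ i, pd i (ricci G i j) y = (1 / 2 : ℝ) * ∑ i, pd j (ricci G i i) y := by
  have hU := h.metric.isOpen
  -- At the centre the identity is linear in the third derivatives of G. These are symmetric in the
  -- three derivative slots and in the two metric slots, and reindexing the double sums matches all
  -- terms.
  set T : Fin m → Fin m → Fin m → Fin m → Fin m → ℝ := fun p l i j k =>
    pd p (pd l (pd i fun z => G z j k)) y with hT
  have T1 : ∀ p l i j k, T p l i j k = T l p i j k := fun p l i j k =>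
    pd_comm hU (h.metric.smooth_pd i j k) h.mem p l
  have T2 : ∀ p l i j k, T p l i j k = T p i l j k := fun p l i j k =>
    pd_congr hU (fun z hz => pd_comm hU (h.metric.smooth j k) hz l i) h.mem p
  have T3 : ∀ p l i j k, T p l i j k = T p l i k j := fun p l i j k =>
    pd_congr hU (fun z hz => pd_congr hU (fun z hz => h.metric.pd_symm hz i j k) hz l) h.mem p
  have hR : ∀ l i j, pd l (ricci G i j) y = (1 / 2 : ℝ) *
      ∑ k, (T l k i j k + T l k j i k - T l k k i j - T l j i k k) := by
    intro l i j
    rw [h.pd_ricci, Finset.mul_sum]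
    refine Finset.sum_congr rfl fun k _ => ?_
    rw [h.pd_pd_christoffel, h.pd_pd_christoffel]
    simp only [hT]
    ring
  simp only [hR, ← Finset.mul_sum]
  congr 1
  simp only [Finset.sum_add_distrib, Finset.sum_sub_distrib]
  have s1 : ∑ i, ∑ k, T i k i j k = ∑ i, ∑ k, T i k k i j := by
    rw [Finset.sum_comm]
    exact Finset.sum_congr rfl fun i _ => Finset.sum_congr rfl fun k _ => by
      rw [T1, T3]
  have s2 : ∑ i, ∑ k, T i k j i k = ∑ i, ∑ k, T j k i i k :=
    Finset.sum_congr rfl fun i _ => Finset.sum_congr rfl fun k _ => by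
      rw [T2, T1, T2]
  have s3 : ∑ i, ∑ k, T i j i k k = ∑ i, ∑ k, T j i i k k :=
    Finset.sum_congr rfl fun i _ => Finset.sum_congr rfl fun k _ => by
      rw [T1]
  have s4 : ∑ i, ∑ k, T j k k i i = ∑ i, ∑ k, T j i i k k := Finset.sum_comm
  rw [s1, s2, s3, s4]
  ring

theorem hess_apply (h : IsNormalAt G U y) (u : Coord m → ℝ) (i j : Fin m) :
    hess G u i j y = pd i (pd j u) y := by
  simp [hess, h.christoffel_eq_zero]

theorem pd_hess (h : IsNormalAt G U y) (hu : ContDiffOn ℝ ∞ u U) (l i j : Fin m) :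
    pd l (hess G u i j) y
      = pd l (pd i (pd j u)) y - ∑ k, pd l (christoffel G k i j) y * pd k u y := by
  have hU := h.metric.isOpen
  have hΓ := fun k => h.diff (h.metric.smooth_christoffel k i j)
  have hd := fun k => h.diff (contDiffOn_pd hU hu k)
  unfold hess
  rw [pd_sub (h.diff (contDiffOn_pd hU (contDiffOn_pd hU hu j) i))
    (DifferentiableAt.fun_sum fun k _ => (hΓ k).fun_mul (hd k)),
    pd_sum fun k _ => (hΓ k).fun_mul (hd k)]
  congr 1
  refine Finset.sum_congr rfl fun k _ => ?_
  rw [pd_mul (hΓ k) (hd k), h.christoffel_eq_zero]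
  ring

/-- The divergence of the Hessian is `dΔu + Ric(∇u, ·)`. -/
theorem sum_pd_hess (h : IsNormalAt G U y) (hu : ContDiffOn ℝ ∞ u U) (j : Fin m) :
    ∑ i, pd i (hess G u i j) y
      = ∑ i, pd j (hess G u i i) y + ∑ k, ricci G j k y * pd k u y := by
  have hU := h.metric.isOpen
  set D : Fin m → Fin m → Fin m → Fin m → ℝ := fun l i j k =>
    pd l (pd i fun z => G z j k) y with hD
  have D1 : ∀ l i j k, D l i j k = D i l j k := fun l i j k =>
    pd_comm hU (h.metric.smooth j k) h.mem l i
  have D3 : ∀ l i j k, D l i j k = D l i k j := fun l i j k =>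
    pd_congr hU (fun z hz => h.metric.pd_symm hz i j k) h.mem l
  have hΓ : ∀ l k i j, pd l (christoffel G k i j) y
      = (1 / 2 : ℝ) * (D l i j k + D l j i k - D l k i j) := h.pd_christoffel
  -- This is the curvature term produced by commuting covariant derivatives: the two contractions of
  -- dΓ occurring in div Hess and in dΔ differ by Ricci.
  have hR : ∀ k, ∑ i, pd i (christoffel G k i j) y + ricci G j k y
      = ∑ i, pd j (christoffel G k i i) y := by
    intro k
    rw [h.ricci_apply, ← Finset.sum_add_distrib]
    refine Finset.sum_congr rfl fun i _ => ?_
    simp only [hΓ]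
    rw [D1 i j i k, D3 j i i k, D1 i k i j, D3 k i i j, D3 k i j i, D3 j i k i, D1 k j i i,
      D1 i j k i, D1 i k j i]
    rw [D3 j i k i, D3 k i j i]
    ring
  have e : ∀ i, pd i (pd i (pd j u)) y = pd j (pd i (pd i u)) y := fun i => by
    rw [pd_congr hU (fun z hz => pd_comm hU hu hz i j) h.mem,
      pd_comm hU (contDiffOn_pd hU hu i) h.mem]
  simp only [h.pd_hess hu, Finset.sum_sub_distrib, e]
  rw [Finset.sum_comm (s := Finset.univ) (t := Finset.univ)
    (f := fun i k => pd i (christoffel G k i j) y * pd k u y),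
    Finset.sum_comm (s := Finset.univ) (t := Finset.univ)
    (f := fun i k => pd j (christoffel G k i i) y * pd k u y)]
  simp only [← Finset.sum_mul, ← hR, add_mul, Finset.sum_add_distrib]
  ring

theorem pd_laplacian (h : IsNormalAt G U y) (hu : ContDiffOn ℝ ∞ u U) (j : Fin m) :
    pd j (coordLaplacian G u) y = ∑ i, pd j (hess G u i i) y := by
  have hI := fun k l => h.diff (h.metric.smooth_inv k l)
  have hH := fun k l => h.diff (h.metric.smooth_hess hu k l)
  unfold coordLaplacian metricTrace
  rw [pd_sum fun k _ => DifferentiableAt.fun_sum fun l _ => (hI k l).fun_mul (hH k l)]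
  refine Finset.sum_congr rfl fun k _ => ?_
  rw [pd_sum fun l _ => (hI k l).fun_mul (hH k l)]
  have : ∀ l, pd j (fun z => (G z)⁻¹ k l * hess G u k l z) y
      = (1 : Matrix (Fin m) (Fin m) ℝ) k l * pd j (hess G u k l) y := fun l => by
    rw [pd_mul (hI k l) (hH k l), h.pd_inv, h.inv_eq_one]; ring
  simp [this, Matrix.one_apply]

theorem laplacian_apply (h : IsNormalAt G U y) (u : Coord m → ℝ) :
    coordLaplacian G u y = ∑ i, hess G u i i y := by
  rw [coordLaplacian, h.eq_one]
  exact metricTrace_one _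

theorem gradInner_apply (h : IsNormalAt G U y) (u v : Coord m → ℝ) :
    gradInner G u v y = ∑ i, pd i u y * pd i v y := by
  rw [gradInner, h.eq_one]
  exact metricTrace_one _

end IsNormalAt

/-! ### The soliton equations in coordinates -/

/-- The components of the pull-back of the metric `H` under `Φ`. -/
noncomputable def coordPullback {m n : ℕ} (H : Coord n → Matrix (Fin n) (Fin n) ℝ)
    (Φ : Coord m → Coord n) (z : Coord m) : Matrix (Fin m) (Fin m) ℝ :=
  .of fun i j => ∑ a, ∑ b, H (Φ z) a b * (jac Φ z a i * jac Φ z b j)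

section

variable {m n : ℕ} {G : Coord m → Matrix (Fin m) (Fin m) ℝ} {U : Set (Coord m)}
  {H : Coord n → Matrix (Fin n) (Fin n) ℝ} {U' : Set (Coord n)} {Φ : Coord m → Coord n}
  {f : Coord m → ℝ} {y : Coord m} {α lam : ℝ}

theorem contDiffOn_coordPullback (hU : IsOpen U) (hH : IsMetricOn H U')
    (hΦ : ContDiffOn ℝ ∞ Φ U) (hm : Set.MapsTo Φ U U') (i j : Fin m) :
    ContDiffOn ℝ ∞ (fun z => coordPullback H Φ z i j) U := by
  simp only [coordPullback, Matrix.of_apply]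
  exact ContDiffOn.sum fun a _ => ContDiffOn.sum fun b _ => ((hH.smooth a b).comp hΦ hm).mul
    ((contDiffOn_jac hU hΦ a i).mul (contDiffOn_jac hU hΦ b j))

theorem coordPullback_apply_of_normal (hH : IsNormalAt H U' (Φ y)) (i j : Fin m) :
    coordPullback H Φ y i j = ∑ a, jac Φ y a i * jac Φ y a j := by
  simp [coordPullback, hH.eq_one, Matrix.one_apply]

/-- Normality of the target metric at Φ y makes the derivative of H ∘ Φ vanish by the chain rule, so
only the Jacobians are differentiated. -/
theorem pd_coordPullback (hU : IsOpen U) (hy : y ∈ U) (hH : IsNormalAt H U' (Φ y))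
    (hΦ : ContDiffOn ℝ ∞ Φ U) (l i j : Fin m) :
    pd l (fun z => coordPullback H Φ z i j) y
      = ∑ a, (pd l (fun z => jac Φ z a i) y * jac Φ y a j
        + jac Φ y a i * pd l (fun z => jac Φ z a j) y) := by
  have hΦd : DifferentiableAt ℝ Φ y := (hΦ.differentiableOn (by simp)).differentiableAt
    (hU.mem_nhds hy)
  have hJ := fun a i => (contDiffOn_jac hU hΦ a i).differentiableAt_of_isOpen hU hy
  have hHd := fun a b => hH.diff (hH.metric.smooth a b)
  have hHΦ : ∀ a b, DifferentiableAt ℝ (fun x => H (Φ x) a b) y := fun a b =>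
    (hHd a b).comp y hΦd
  have hz : ∀ a b, pd l (fun x => H (Φ x) a b) y = 0 := fun a b => by
    rw [pd_comp (u := fun x => H x a b) hΦd (hHd a b)]
    simp [hH.pd_eq_zero]
  have hd := fun a b => (hHΦ a b).fun_mul ((hJ a i).fun_mul (hJ b j))
  simp only [coordPullback, Matrix.of_apply]
  rw [pd_sum fun a _ => DifferentiableAt.fun_sum fun b _ => hd a b]
  refine Finset.sum_congr rfl fun a _ => ?_
  rw [pd_sum fun b _ => hd a b]
  have : ∀ b, pd l (fun z => H (Φ z) a b * (jac Φ z a i * jac Φ z b j)) y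
      = (1 : Matrix (Fin n) (Fin n) ℝ) a b * (pd l (fun z => jac Φ z a i) y * jac Φ y b j
        + jac Φ y a i * pd l (fun z => jac Φ z b j) y) := fun b => by
    rw [pd_mul (hHΦ a b) ((hJ a i).fun_mul (hJ b j)), pd_mul (hJ a i) (hJ b j), hz, hH.eq_one]
    ring
  simp [this, Matrix.one_apply]

theorem tension_apply_of_normal (hG : IsNormalAt G U y) (hH : IsNormalAt H U' (Φ y)) (a : Fin n) :
    tension G H Φ a y = ∑ i, pd i (fun z => jac Φ z a i) y := by
  rw [tension, hG.eq_one]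
  refine (metricTrace_one _).trans (Finset.sum_congr rfl fun i _ => ?_)
  simp only [hG.hess_apply, hH.christoffel_eq_zero, zero_mul, Finset.sum_const_zero, add_zero]
  rfl

/-- The divergence of the stress-energy tensor of a map is the tension field paired with the
differential. -/
theorem sum_pd_coordPullback (hG : IsNormalAt G U y) (hH : IsNormalAt H U' (Φ y))
    (hΦ : ContDiffOn ℝ ∞ Φ U) (j : Fin m) :
    ∑ i, pd i (fun z => coordPullback H Φ z i j) y
      = (1 / 2 : ℝ) * ∑ i, pd j (fun z => coordPullback H Φ z i i) y
        + ∑ a, tension G H Φ a y * jac Φ y a j := by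
  have hU := hG.metric.isOpen
  simp only [pd_coordPullback hU hG.mem hH hΦ, tension_apply_of_normal hG hH, Finset.sum_mul]
  have hc : ∀ a i, pd j (fun z => jac Φ z a i) y = pd i (fun z => jac Φ z a j) y := fun a i =>
    pd_comm hU (contDiffOn_coord hΦ a) hG.mem j i
  rw [Finset.sum_comm (s := Finset.univ (α := Fin n)) (t := Finset.univ (α := Fin m)),
    Finset.mul_sum, ← Finset.sum_add_distrib]
  refine Finset.sum_congr rfl fun i _ => ?_
  rw [Finset.mul_sum, ← Finset.sum_add_distrib]
  refine Finset.sum_congr rfl fun a _ => ?_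
  rw [hc a i]
  ring

/-- Contraction of the soliton equation with the Bianchi identity. -/
theorem sum_pd_hess_of_soliton (hG : IsNormalAt G U y) (hH : IsNormalAt H U' (Φ y))
    (hΦ : ContDiffOn ℝ ∞ Φ U) (hm : Set.MapsTo Φ U U') (hf : ContDiffOn ℝ ∞ f U)
    (hsol : ∀ z ∈ U, ∀ i j, ricci G i j z - α * coordPullback H Φ z i j + hess G f i j z
      = lam * G z i j) (j : Fin m) :
    ∑ i, pd i (hess G f i j) y = (1 / 2 : ℝ) * pd j (coordLaplacian G f) y
      + α * ∑ a, tension G H Φ a y * jac Φ y a j := by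
  have hU := hG.metric.isOpen
  have hQ := contDiffOn_coordPullback hU hH.metric hΦ hm
  have hd : ∀ l i j, pd l (ricci G i j) y - α * pd l (fun z => coordPullback H Φ z i j) y
      + pd l (hess G f i j) y = 0 := by
    intro l i j
    have dR := hG.diff (hG.metric.smooth_ricci i j)
    have dQ := hG.diff (hQ i j)
    have dH := hG.diff (hG.metric.smooth_hess hf i j)
    have e := pd_congr hU (fun z hz => hsol z hz i j) hG.mem l
    rw [pd_add (dR.fun_sub (dQ.const_mul α)) dH, pd_sub dR (dQ.const_mul α), pd_const_mul dQ,
      pd_const_mul (hG.metric.differentiableAt hG.mem i j), hG.pd_eq_zero, mul_zero] at e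
    exact e
  -- `h1` is the divergence of the soliton equation and `h2` the derivative of its trace; the term
  -- λg is gone because dG = 0 at y. In `h1` minus half of `h2` the traces of Ricci and of the
  -- pull-back cancel.
  have h1 : ∑ i, (pd i (ricci G i j) y - α * pd i (fun z => coordPullback H Φ z i j) y
      + pd i (hess G f i j) y) = 0 := Finset.sum_eq_zero fun i _ => hd i i j
  have h2 : ∑ i, (pd j (ricci G i i) y - α * pd j (fun z => coordPullback H Φ z i i) y
      + pd j (hess G f i i) y) = 0 := Finset.sum_eq_zero fun i _ => hd j i i
  simp only [Finset.sum_add_distrib, Finset.sum_sub_distrib, ← Finset.mul_sum] at h1 h2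
  rw [hG.sum_pd_ricci, sum_pd_coordPullback hG hH hΦ] at h1
  rw [hG.pd_laplacian hf]
  linarith

theorem tension_eq_of_soliton (hG : IsNormalAt G U y)
    (hmap : ∀ a, tension G H Φ a y = gradInner G (fun z => Φ z a) f y) (a : Fin n) :
    tension G H Φ a y = ∑ k, jac Φ y a k * pd k f y := by
  rw [hmap, hG.gradInner_apply]
  rfl

/-- On a soliton, `S + |∇f|² - 2λf` is locally constant, where `S = mλ - Δf`. -/
theorem pd_conserved (hG : IsNormalAt G U y) (hH : IsNormalAt H U' (Φ y))
    (hΦ : ContDiffOn ℝ ∞ Φ U) (hm : Set.MapsTo Φ U U') (hf : ContDiffOn ℝ ∞ f U)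
    (hsol : ∀ z ∈ U, ∀ i j, ricci G i j z - α * coordPullback H Φ z i j + hess G f i j z
      = lam * G z i j)
    (hmap : ∀ a, tension G H Φ a y = gradInner G (fun z => Φ z a) f y) (j : Fin m) :
    pd j (fun z => m * lam - coordLaplacian G f z + gradInner G f f z - 2 * lam * f z) y = 0 := by
  have hU := hG.metric.isOpen
  have dL := hG.diff (hG.metric.smooth_laplacian hf)
  have dg := hG.diff (hG.metric.smooth_gradInner hf hf)
  have df := hG.diff hf
  rw [pd_sub (((differentiableAt_const _).fun_sub dL).fun_add dg) (df.const_mul _),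
    pd_add ((differentiableAt_const _).fun_sub dL) dg, pd_sub (differentiableAt_const _) dL,
    pd_const, pd_const_mul df, hG.metric.pd_gradInner_self hf hG.mem]
  -- Two evaluations of div Hess f are equated: ½dΔf + α⟨τ, dφ⟩ and dΔf + Ric(∇f, ·). By `h2` the
  -- tension term is the pull-back metric applied to ∇f, and `h3` is the soliton equation applied to
  -- ∇f.
  have h1 := sum_pd_hess_of_soliton hG hH hΦ hm hf hsol j
  rw [hG.sum_pd_hess hf, ← hG.pd_laplacian hf] at h1
  have h2 : ∑ a, tension G H Φ a y * jac Φ y a j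
      = ∑ k, coordPullback H Φ y j k * pd k f y := by
    simp only [tension_eq_of_soliton hG hmap, coordPullback_apply_of_normal hH, Finset.sum_mul]
    rw [Finset.sum_comm]
    exact Finset.sum_congr rfl fun k _ => Finset.sum_congr rfl fun a _ => by ring
  have h3 : ∑ k, ricci G j k y * pd k f y - α * ∑ k, coordPullback H Φ y j k * pd k f y
      + ∑ k, hess G f j k y * pd k f y = lam * pd j f y := by
    have : ∀ k, ricci G j k y * pd k f y - α * (coordPullback H Φ y j k * pd k f y)
      + hess G f j k y * pd k f y = lam * ((1 : Matrix (Fin m) (Fin m) ℝ) j k * pd k f y) := by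
      intro k
      have := hsol y hG.mem j k
      rw [hG.eq_one] at this
      rw [← mul_assoc lam, ← this]; ring
    rw [Finset.mul_sum, ← Finset.sum_sub_distrib, ← Finset.sum_add_distrib,
      Finset.sum_congr rfl fun k _ => this k, ← Finset.mul_sum]
    simp [Matrix.one_apply]
  have h4 : ∀ k, ∑ l, (G y)⁻¹ k l * pd l f y = pd k f y := fun k => by
    simp [hG.inv_eq_one, Matrix.one_apply]
  simp only [h4]
  rw [h2] at h1
  linarith

/-- The Laplacian of `S` at a critical point of `S`. -/
theorem sum_pd_pd_conserved (hG : IsNormalAt G U y) (hH : IsNormalAt H U' (Φ y))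
    (hΦ : ContDiffOn ℝ ∞ Φ U) (hm : Set.MapsTo Φ U U') (hf : ContDiffOn ℝ ∞ f U)
    (hsol : ∀ z ∈ U, ∀ i j, ricci G i j z - α * coordPullback H Φ z i j + hess G f i j z
      = lam * G z i j)
    (hmap : ∀ a, tension G H Φ a y = gradInner G (fun z => Φ z a) f y)
    (hcons : ∀ z ∈ U, ∀ j, pd j (fun z => m * lam - coordLaplacian G f z + gradInner G f f z
      - 2 * lam * f z) z = 0)
    (hcrit : ∀ j, pd j (fun z => m * lam - coordLaplacian G f z) y = 0) :
    ∑ i, pd i (pd i (fun z => m * lam - coordLaplacian G f z)) y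
      = 2 * (lam * coordLaplacian G f y - α * ∑ a, tension G H Φ a y ^ 2
        - ∑ i, ∑ k, hess G f i k y ^ 2) := by
  have hU := hG.metric.isOpen
  have d := fun {w : Coord m → ℝ} (hw : ContDiffOn ℝ ∞ w U) {z} (hz : z ∈ U) =>
    hw.differentiableAt_of_isOpen hU hz
  have sL := hG.metric.smooth_laplacian hf
  have sS : ContDiffOn ℝ ∞ (fun z => m * lam - coordLaplacian G f z) U := contDiffOn_const.sub sL
  have sg := hG.metric.smooth_gradInner hf hf
  have sH := hG.metric.smooth_hess hf
  have sf := fun k => contDiffOn_pd hU hf k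
  have sI := hG.metric.smooth_inv
  have sv : ∀ k, ContDiffOn ℝ ∞ (fun z => ∑ l, (G z)⁻¹ k l * pd l f z) U := fun k =>
    ContDiffOn.sum fun l _ => (sI k l).mul (sf l)
  -- dS = 2λ df - 2 Hess f(∇f, ·) is needed on all of U, not only at the centre, since it is
  -- differentiated once more.
  have h1 : ∀ i, ∀ z ∈ U, pd i (fun z => m * lam - coordLaplacian G f z) z
      = 2 * lam * pd i f z - 2 * ∑ k, hess G f i k z * ∑ l, (G z)⁻¹ k l * pd l f z := by
    intro i z hz
    have := hcons z hz i
    rw [pd_sub ((d sS hz).fun_add (d sg hz)) ((d hf hz).const_mul _), pd_add (d sS hz) (d sg hz),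
      pd_const_mul (d hf hz), hG.metric.pd_gradInner_self hf hz] at this
    linarith
  have hv : ∀ k, ∑ l, (G y)⁻¹ k l * pd l f y = pd k f y := fun k => by
    simp [hG.inv_eq_one, Matrix.one_apply]
  have hdv : ∀ i k, pd i (fun z => ∑ l, (G z)⁻¹ k l * pd l f z) y = pd i (pd k f) y := by
    intro i k
    rw [pd_sum fun l _ => (hG.diff (sI k l)).fun_mul (hG.diff (sf l))]
    have : ∀ l, pd i (fun z => (G z)⁻¹ k l * pd l f z) y
        = (1 : Matrix (Fin m) (Fin m) ℝ) k l * pd i (pd l f) y := fun l => by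
      rw [pd_mul (hG.diff (sI k l)) (hG.diff (sf l)), hG.pd_inv, hG.inv_eq_one]; ring
    simp [this, Matrix.one_apply]
  have h2 : ∀ i, pd i (pd i (fun z => m * lam - coordLaplacian G f z)) y
      = 2 * lam * hess G f i i y - 2 * (∑ k, pd i (hess G f i k) y * pd k f y
        + ∑ k, hess G f i k y ^ 2) := by
    intro i
    have dm := fun k => (hG.diff (sH i k)).fun_mul (hG.diff (sv k))
    rw [pd_congr hU (h1 i) hG.mem, pd_sub ((hG.diff (sf i)).const_mul _)
      ((DifferentiableAt.fun_sum fun k _ => dm k).const_mul _), pd_const_mul (hG.diff (sf i)),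
      pd_const_mul (DifferentiableAt.fun_sum fun k _ => dm k), pd_sum fun k _ => dm k,
      hG.hess_apply, ← Finset.sum_add_distrib]
    congr 2
    refine Finset.sum_congr rfl fun k _ => ?_
    rw [pd_mul (hG.diff (sH i k)) (hG.diff (sv k)), hv, hdv, hG.hess_apply]
    ring
  -- At a critical point of S also dΔf = 0, so the third-order term of the Laplacian of S reduces to
  -- the tension term; contracted with ∇f it gives α|τ|².
  have h3 : ∀ k, ∑ i, pd i (hess G f i k) y = α * ∑ a, tension G H Φ a y * jac Φ y a k := by
    intro k
    have := hcrit k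
    rw [pd_sub (differentiableAt_const _) (hG.diff sL), pd_const] at this
    rw [sum_pd_hess_of_soliton hG hH hΦ hm hf hsol k, show pd k (coordLaplacian G f) y = 0 by
      linarith]
    ring
  have h4 : ∑ i, ∑ k, pd i (hess G f i k) y * pd k f y = α * ∑ a, tension G H Φ a y ^ 2 := by
    rw [Finset.sum_comm]
    simp only [← Finset.sum_mul, h3, mul_assoc, ← Finset.mul_sum]
    congr 1
    have : ∀ a, tension G H Φ a y ^ 2 = ∑ k, tension G H Φ a y * jac Φ y a k * pd k f y := by
      intro a
      rw [sq]
      nth_rw 2 [tension_eq_of_soliton hG hmap]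
      rw [Finset.mul_sum]
      exact Finset.sum_congr rfl fun k _ => by ring
    simp only [this, Finset.sum_mul]
    exact Finset.sum_comm
  simp only [h2, Finset.sum_sub_distrib, ← Finset.mul_sum, Finset.sum_add_distrib, h4,
    hG.laplacian_apply]
  ring

/-- `S` is nonnegative at its minima. -/
theorem conserved_nonneg (hG : IsNormalAt G U y) (hH : IsNormalAt H U' (Φ y))
    (hΦ : ContDiffOn ℝ ∞ Φ U) (hm : Set.MapsTo Φ U U') (hf : ContDiffOn ℝ ∞ f U)
    (hsol : ∀ z ∈ U, ∀ i j, ricci G i j z - α * coordPullback H Φ z i j + hess G f i j z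
      = lam * G z i j)
    (hmap : ∀ a, tension G H Φ a y = gradInner G (fun z => Φ z a) f y)
    (hcons : ∀ z ∈ U, ∀ j, pd j (fun z => m * lam - coordLaplacian G f z + gradInner G f f z
      - 2 * lam * f z) z = 0)
    (hcrit : ∀ j, pd j (fun z => m * lam - coordLaplacian G f z) y = 0)
    (hmin : ∀ i, 0 ≤ pd i (pd i (fun z => m * lam - coordLaplacian G f z)) y)
    (hα : 0 ≤ α) (hlam : 0 < lam) : 0 ≤ m * lam - coordLaplacian G f y := by
  have h1 := Finset.sum_nonneg fun i (_ : i ∈ Finset.univ) => hmin i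
  rw [sum_pd_pd_conserved hG hH hΦ hm hf hsol hmap hcons hcrit] at h1
  have h2 : 0 ≤ α * ∑ a, tension G H Φ a y ^ 2 :=
    mul_nonneg hα (Finset.sum_nonneg fun a _ => sq_nonneg _)
  -- The minimum condition gives ∑ (Hess f)ᵢᵢ² ≤ λΔf. Expanding squares centred at λ then leaves 0 ≤
  -- mλ² - λΔf = λS.
  have h3 : 0 ≤ ∑ i, (lam - hess G f i i y) ^ 2 := Finset.sum_nonneg fun i _ => sq_nonneg _
  have h4 : ∑ i, hess G f i i y ^ 2 ≤ ∑ i, ∑ k, hess G f i k y ^ 2 :=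
    Finset.sum_le_sum fun i _ => Finset.single_le_sum (f := fun k => hess G f i k y ^ 2)
      (fun k _ => sq_nonneg _) (Finset.mem_univ i)
  have h5 : ∑ i, (lam - hess G f i i y) ^ 2
      = m * lam ^ 2 - 2 * lam * coordLaplacian G f y + ∑ i, hess G f i i y ^ 2 := by
    have : ∀ i, (lam - hess G f i i y) ^ 2
        = lam ^ 2 - 2 * lam * hess G f i i y + hess G f i i y ^ 2 := fun i => by ring
    simp only [this, Finset.sum_add_distrib, Finset.sum_sub_distrib, ← Finset.mul_sum,
      hG.laplacian_apply]
    simp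
  have h6 : 0 ≤ lam * (m * lam - coordLaplacian G f y) := by nlinarith
  exact nonneg_of_mul_nonneg_right h6 hlam

end

/-! ### The metric in the charts of a manifold -/

section Charts

variable {m n : ℕ} {M : Type*} [TopologicalSpace M] [ChartedSpace (Coord m) M]
  [IsManifold (𝓡 m) ∞ M] {N : Type*} [TopologicalSpace N] [ChartedSpace (Coord n) N]
  [IsManifold (𝓡 n) ∞ N] {e e₁ : OpenPartialHomeomorph M (Coord m)}
  {e' : OpenPartialHomeomorph N (Coord n)}

/-- The differential of a map between manifolds as a linear map between the model spaces. -/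
noncomputable def modelDeriv (m n : ℕ) {M N : Type*} [TopologicalSpace M] [ChartedSpace (Coord m) M]
    [TopologicalSpace N] [ChartedSpace (Coord n) N] (φ : M → N) (p : M) :
    Coord m →L[ℝ] Coord n :=
  mfderiv (𝓡 m) (𝓡 n) φ p

/-- The metric at `p` as a bilinear form on the model space. -/
noncomputable def innerAt (g : RiemMetric m M) (p : M) : Coord m →L[ℝ] Coord m →L[ℝ] ℝ :=
  g.inner p

theorem contDiffOn_comp_symm (he : e ∈ IsManifold.maximalAtlas (𝓡 m) ∞ M) {u : M → ℝ}
    (hu : ContMDiff (𝓡 m) 𝓘(ℝ, ℝ) ∞ u) : ContDiffOn ℝ ∞ (fun z => u (e.symm z)) e.target :=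
  contMDiffOn_iff_contDiffOn.1 (hu.comp_contMDiffOn (contMDiffOn_symm_of_mem_maximalAtlas he))

theorem contDiffOn_chart_map (he : e ∈ IsManifold.maximalAtlas (𝓡 m) ∞ M)
    (he' : e' ∈ IsManifold.maximalAtlas (𝓡 n) ∞ N) {φ : M → N}
    (hφ : ContMDiff (𝓡 m) (𝓡 n) ∞ φ) :
    ContDiffOn ℝ ∞ (fun z => e' (φ (e.symm z)))
      (e.target ∩ (fun z => φ (e.symm z)) ⁻¹' e'.source) := by
  have h1 : ContMDiffOn (𝓡 m) (𝓡 n) ∞ (fun z => φ (e.symm z)) e.target :=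
    hφ.comp_contMDiffOn (contMDiffOn_symm_of_mem_maximalAtlas he)
  exact contMDiffOn_iff_contDiffOn.1 ((contMDiffOn_of_mem_maximalAtlas he').comp
    (h1.mono Set.inter_subset_left) Set.inter_subset_right)

theorem isOpen_chart_map (e : OpenPartialHomeomorph M (Coord m))
    (e' : OpenPartialHomeomorph N (Coord n)) {φ : M → N} (hφ : Continuous φ) :
    IsOpen (e.target ∩ (fun z => φ (e.symm z)) ⁻¹' e'.source) :=
  (hφ.comp_continuousOn e.continuousOn_symm).isOpen_inter_preimage e.open_target e'.open_source

/-- The differential of a map in terms of coordinate vector fields. -/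
theorem modelDeriv_symm_apply (he : e ∈ IsManifold.maximalAtlas (𝓡 m) ∞ M)
    (he' : e' ∈ IsManifold.maximalAtlas (𝓡 n) ∞ N) {φ : M → N}
    (hφ : ContMDiff (𝓡 m) (𝓡 n) ∞ φ) {z : Coord m} (hz : z ∈ e.target)
    (hz' : φ (e.symm z) ∈ e'.source) (i : Fin m) :
    modelDeriv m n φ (e.symm z) (modelDeriv m m e.symm z (EuclideanSpace.single i 1))
      = ∑ a, jac (fun x => e' (φ (e.symm x))) z a i •
          modelDeriv n n e'.symm (e' (φ (e.symm z))) (EuclideanSpace.single a 1) := by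
  have hV := isOpen_chart_map e e' hφ.continuous
  set Φ : Coord m → Coord n := fun x => e' (φ (e.symm x)) with hΦ
  have hΦd : DifferentiableAt ℝ Φ z :=
    ((contDiffOn_chart_map he he' hφ).differentiableOn (by simp)).differentiableAt
      (hV.mem_nhds ⟨hz, hz'⟩)
  have hes : MDifferentiableAt (𝓡 m) (𝓡 m) e.symm z :=
    (contMDiffAt_symm_of_mem_maximalAtlas he hz).mdifferentiableAt (by simp)
  have hes' : MDifferentiableAt (𝓡 n) (𝓡 n) e'.symm (Φ z) :=
    (contMDiffAt_symm_of_mem_maximalAtlas he' (e'.map_source hz')).mdifferentiableAt (by simp)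
  have hφd : MDifferentiableAt (𝓡 m) (𝓡 n) φ (e.symm z) := hφ.mdifferentiable (by simp) _
  have heq : (φ ∘ e.symm) =ᶠ[nhds z] (e'.symm ∘ Φ) := by
    filter_upwards [hV.mem_nhds ⟨hz, hz'⟩] with x hx
    exact (e'.left_inv hx.2).symm
  have h1 : modelDeriv m n (φ ∘ e.symm) z = (modelDeriv m n φ (e.symm z)).comp (modelDeriv m m e.symm z) :=
    mfderiv_comp z hφd hes
  have h2 : modelDeriv m n (e'.symm ∘ Φ) z = (modelDeriv n n e'.symm (Φ z)).comp (fderiv ℝ Φ z) := by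
    have := mfderiv_comp z hes' hΦd.mdifferentiableAt
    rw [mfderiv_eq_fderiv] at this
    exact this
  have h3 : modelDeriv m n (φ ∘ e.symm) z = modelDeriv m n (e'.symm ∘ Φ) z := heq.mfderiv_eq
  have h4 : fderiv ℝ Φ z (EuclideanSpace.single i (1 : ℝ))
      = ∑ a, jac Φ z a i • (EuclideanSpace.single a (1 : ℝ) : Coord n) := by
    ext b
    simp [jac_apply hΦd, Pi.single_apply, Finset.sum_apply]
  rw [← ContinuousLinearMap.comp_apply, ← h1, h3, h2, ContinuousLinearMap.comp_apply, h4, map_sum]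
  simp only [map_smul]
  rfl

theorem innerAt_sum (g : RiemMetric m M) (p : M) {ι : Type*} [Fintype ι] (c d : ι → ℝ)
    (v w : ι → Coord m) :
    innerAt g p (∑ a, c a • v a) (∑ b, d b • w b)
      = ∑ a, ∑ b, innerAt g p (v a) (w b) * (c a * d b) := by
  simp only [map_sum, map_smul, _root_.sum_apply, _root_.smul_apply, smul_eq_mul, Finset.mul_sum]
  rw [Finset.sum_comm]
  exact Finset.sum_congr rfl fun a _ => Finset.sum_congr rfl fun b _ => by ring

theorem gram_apply (g : RiemMetric m M) (e : OpenPartialHomeomorph M (Coord m)) (z : Coord m)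
    (i j : Fin m) : gram g e z i j = innerAt g (e.symm z)
      (modelDeriv m m e.symm z (EuclideanSpace.single i 1))
      (modelDeriv m m e.symm z (EuclideanSpace.single j 1)) := rfl

/-- The pull-back of the metric in coordinates. -/
theorem pullback_eq_coordPullback (he : e ∈ IsManifold.maximalAtlas (𝓡 m) ∞ M)
    (he' : e' ∈ IsManifold.maximalAtlas (𝓡 n) ∞ N) (h : RiemMetric n N) {φ : M → N}
    (hφ : ContMDiff (𝓡 m) (𝓡 n) ∞ φ) {z : Coord m} (hz : z ∈ e.target)
    (hz' : φ (e.symm z) ∈ e'.source) :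
    pullback h φ e z = coordPullback (gram h e') (fun x => e' (φ (e.symm x))) z := by
  ext i j
  change innerAt h (φ (e.symm z))
    (modelDeriv m n φ (e.symm z) (modelDeriv m m e.symm z (EuclideanSpace.single i 1)))
    (modelDeriv m n φ (e.symm z) (modelDeriv m m e.symm z (EuclideanSpace.single j 1))) = _
  rw [modelDeriv_symm_apply he he' hφ hz hz', modelDeriv_symm_apply he he' hφ hz hz', innerAt_sum]
  simp only [coordPullback, Matrix.of_apply, gram_apply, e'.left_inv hz']

/-- This makes the change-of-chart law for the metric the special case φ = id of the coordinate
formula for pull-backs. -/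
theorem gram_eq_pullback_id (g : RiemMetric m M) (e : OpenPartialHomeomorph M (Coord m))
    (z : Coord m) : gram g e z = pullback g id e z := by
  ext i j
  simp only [pullback, mfderiv_id]
  rfl

/-- The change of the metric coefficients under a change of charts. -/
theorem gram_transform (he : e ∈ IsManifold.maximalAtlas (𝓡 m) ∞ M)
    (he₁ : e₁ ∈ IsManifold.maximalAtlas (𝓡 m) ∞ M) (g : RiemMetric m M) {z : Coord m}
    (hz : z ∈ e₁.target) (hz' : e₁.symm z ∈ e.source) :
    gram g e₁ z = (jac (fun x => e (e₁.symm x)) z).transpose * gram g e (e (e₁.symm z))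
      * jac (fun x => e (e₁.symm x)) z := by
  rw [gram_eq_pullback_id, pullback_eq_coordPullback he₁ he g contMDiff_id hz hz']
  ext i j
  simp only [coordPullback, Matrix.of_apply, id, Matrix.mul_apply, Matrix.transpose_apply,
    Finset.sum_mul]
  rw [Finset.sum_comm]
  exact Finset.sum_congr rfl fun a _ => Finset.sum_congr rfl fun b _ => by ring

/-- The coordinate fields are images of constant fields under the tangent map of the inverse chart,
hence smooth; the smooth bundle metric is then evaluated on them. -/
theorem contDiffOn_gram (he : e ∈ IsManifold.maximalAtlas (𝓡 m) ∞ M) (g : RiemMetric m M)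
    (i j : Fin m) : ContDiffOn ℝ ∞ (fun z => gram g e z i j) e.target := by
  have hes := contMDiffOn_symm_of_mem_maximalAtlas he
  have hv : ∀ i : Fin m, ContMDiffOn (𝓡 m) ((𝓡 m).prod (𝓡 m)) ∞
      (fun z => TotalSpace.mk' (Coord m) (E := fun p : M => TangentSpace (𝓡 m) p) (e.symm z)
        (coordVec e z i)) e.target := by
    intro i
    have h1 := hes.contMDiffOn_tangentMapWithin (m := ∞) (by simp)
      e.open_target.uniqueMDiffOn
    have h2 : ContMDiff (𝓡 m) ((𝓡 m).prod (𝓡 m)) ∞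
      (fun z : Coord m => TotalSpace.mk' (Coord m) (E := fun p : Coord m => TangentSpace (𝓡 m) p) z
        (EuclideanSpace.single i (1 : ℝ) : Coord m)) := by
      exact contMDiff_vectorSpace_iff_contDiff.2 contDiff_const
    have h3 := h1.comp h2.contMDiffOn (fun z hz => hz)
    refine h3.congr fun z hz => ?_
    simp only [Function.comp, tangentMapWithin]
    rw [mfderivWithin_of_isOpen e.open_target hz]
    rfl
  have h0 : ContMDiffOn (𝓡 m) ((𝓡 m).prod 𝓘(ℝ, ℝ)) ∞
      (fun z => TotalSpace.mk' ℝ (E := Bundle.Trivial M ℝ) (e.symm z)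
        (g.inner (e.symm z) (coordVec e z i) (coordVec e z j))) e.target := by
    apply ContMDiffOn.clm_bundle_apply₂ (F₁ := Coord m) (F₂ := Coord m)
    · exact g.contMDiff.comp_contMDiffOn hes
    · exact hv i
    · exact hv j
  intro z hz
  have := h0 z hz
  simp only [contMDiffWithinAt_totalSpace] at this
  exact contMDiffWithinAt_iff_contDiffWithinAt.1 this.2

theorem isMetricOn_gram (he : e ∈ IsManifold.maximalAtlas (𝓡 m) ∞ M) (g : RiemMetric m M) :
    IsMetricOn (gram g e) e.target where
  isOpen := e.open_target
  smooth := contDiffOn_gram he g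
  posDef := by
    intro z hz
    have hd : e.MDifferentiable (𝓡 m) (𝓡 m) :=
      ⟨(contMDiffOn_of_mem_maximalAtlas he).mdifferentiableOn (by simp),
        (contMDiffOn_symm_of_mem_maximalAtlas he).mdifferentiableOn (by simp)⟩
    -- Injectivity of the differential of the inverse chart transfers positivity of g on tangent
    -- vectors to the coefficient matrix.
    have hinj : Function.Injective (modelDeriv m m e.symm z) :=
      hd.symm.mfderiv_injective hz
    refine Matrix.PosDef.of_dotProduct_mulVec_pos ?_ fun x hx => ?_
    · ext i j
      simpa [gram] using g.symm _ _ _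
    · have e1 : star x ⬝ᵥ (gram g e z).mulVec x = innerAt g (e.symm z)
          (∑ a, x a • modelDeriv m m e.symm z (EuclideanSpace.single a 1))
          (∑ a, x a • modelDeriv m m e.symm z (EuclideanSpace.single a 1)) := by
        rw [innerAt_sum]
        simp only [dotProduct, Matrix.mulVec, Finset.mul_sum]
        refine Finset.sum_congr rfl fun a _ => Finset.sum_congr rfl fun b _ => ?_
        simp only [gram_apply, Pi.star_apply, star_trivial]
        ring
      have e2 : (∑ a, x a • modelDeriv m m e.symm z (EuclideanSpace.single a 1))
          = modelDeriv m m e.symm z (WithLp.toLp 2 x) := by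
        conv_rhs => rw [show WithLp.toLp 2 x
          = ∑ a, x a • (EuclideanSpace.single a (1 : ℝ) : Coord m) by
          ext j; simp [Finset.sum_apply, Pi.single_apply]]
        rw [map_sum]
        simp only [map_smul]
      rw [e1]
      refine g.pos _ _ fun h0 => hx ?_
      have h0' : (∑ a, x a • modelDeriv m m e.symm z (EuclideanSpace.single a 1)) = 0 := h0
      rw [e2] at h0'
      have := hinj (h0'.trans (map_zero _).symm)
      ext i
      exact congrFun (congrArg WithLp.ofLp this) i

end Charts

/-! ### Normal charts -/

theorem fderiv_eq_jac_mulVec {m n : ℕ} {ψ : Coord m → Coord n} {z : Coord m}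
    (hψ : DifferentiableAt ℝ ψ z) (v : Coord m) :
    fderiv ℝ ψ z v = WithLp.toLp 2 ((jac ψ z).mulVec v.ofLp) := by
  ext a
  rw [← fderiv_apply_coord hψ, fderiv_apply_eq_sum_pd]
  simp only [Matrix.mulVec, dotProduct]
  exact Finset.sum_congr rfl fun i _ => mul_comm _ _

theorem exists_hasFDerivAt_equiv {m : ℕ} {ψ : Coord m → Coord m} {z : Coord m}
    (hψ : DifferentiableAt ℝ ψ z) (hd : IsUnit (jac ψ z).det) :
    ∃ L : Coord m ≃L[ℝ] Coord m, HasFDerivAt ψ (L : Coord m →L[ℝ] Coord m) z := by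
  have hinj : Function.Injective (fderiv ℝ ψ z) := by
    intro v w hvw
    rw [fderiv_eq_jac_mulVec hψ, fderiv_eq_jac_mulVec hψ] at hvw
    have := Matrix.mulVec_injective_of_isUnit ((Matrix.isUnit_iff_isUnit_det _).2 hd)
      (WithLp.toLp_injective 2 hvw)
    exact WithLp.ofLp_injective 2 this
  refine ⟨(LinearEquiv.ofInjectiveEndo (fderiv ℝ ψ z : Coord m →ₗ[ℝ] Coord m)
    hinj).toContinuousLinearEquiv, ?_⟩
  convert hψ.hasFDerivAt using 1
  ext v
  rfl

section

variable {m : ℕ} {M : Type*} [TopologicalSpace M] [ChartedSpace (Coord m) M]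
  [IsManifold (𝓡 m) ∞ M]

/-- Composition of a chart with the local inverse of a smooth map. -/
theorem exists_chart_of_contDiff {e : OpenPartialHomeomorph M (Coord m)}
    (he : e ∈ IsManifold.maximalAtlas (𝓡 m) ∞ M) {p : M} (hp : p ∈ e.source)
    {ψ : Coord m → Coord m} (hψ : ContDiff ℝ ∞ ψ) {z : Coord m} (hz : ψ z = e p)
    (hd : IsUnit (jac ψ z).det) :
    ∃ e₁ ∈ IsManifold.maximalAtlas (𝓡 m) ∞ M, p ∈ e₁.source ∧ e₁ p = z ∧
      ∀ x ∈ e₁.target, e₁.symm x ∈ e.source ∧ e (e₁.symm x) = ψ x := by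
  have hdiff : ∀ x, DifferentiableAt ℝ ψ x := fun x => hψ.differentiable (by simp) x
  obtain ⟨L, hL⟩ := exists_hasFDerivAt_equiv (hdiff z) hd
  set P₀ := hψ.contDiffAt.toOpenPartialHomeomorph ψ hL (by simp) with hP₀
  have hP₀c : (P₀ : Coord m → Coord m) = ψ := rfl
  -- Shrinking to points with invertible Jacobian makes the local inverse smooth on its whole
  -- domain, rather than only at the image of z.
  set W : Set (Coord m) := {x | (jac ψ x).det ≠ 0} with hW
  have hWo : IsOpen W := by
    have : Continuous fun x => (jac ψ x).det := by
      rw [← continuousOn_univ]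
      exact (contDiffOn_det fun a i => contDiffOn_jac isOpen_univ hψ.contDiffOn a i).continuousOn
    exact isOpen_ne.preimage this
  set P := P₀.restrOpen W hWo with hP
  have hPc : (P : Coord m → Coord m) = ψ := rfl
  have hzP : z ∈ P.source := by
    rw [hP, OpenPartialHomeomorph.restrOpen_source]
    exact ⟨hψ.contDiffAt.mem_toOpenPartialHomeomorph_source hL (by simp), hd.ne_zero⟩
  have hPs : ContDiffOn ℝ ∞ P.symm P.target := by
    intro y hy
    have hy' := P.map_target hy
    have hdy : IsUnit (jac ψ (P.symm y)).det := by
      rw [hP, OpenPartialHomeomorph.restrOpen_source] at hy'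
      exact (Ne.isUnit hy'.2)
    obtain ⟨L', hL'⟩ := exists_hasFDerivAt_equiv (hdiff (P.symm y)) hdy
    exact (P.contDiffAt_symm hy hL' hψ.contDiffAt).contDiffWithinAt
  have hcoe : ∀ x, (e.trans P.symm).symm x = e.symm (ψ x) := fun x => rfl
  refine ⟨e.trans P.symm, ?_, ?_, ?_, ?_⟩
  · refine OpenPartialHomeomorph.mem_maximalAtlas_of_contMDiffOn _ ?_ ?_
    · have h1 : ContMDiffOn (𝓡 m) (𝓡 m) ∞ e (e.trans P.symm).source :=
        (contMDiffOn_of_mem_maximalAtlas he).mono fun x hx => hx.1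
      exact (contMDiffOn_iff_contDiffOn.2 hPs).comp h1 fun x hx => hx.2
    · have h1 : ContMDiffOn (𝓡 m) (𝓡 m) ∞ P (e.trans P.symm).target := by
        rw [hPc]; exact hψ.contMDiff.contMDiffOn
      exact (contMDiffOn_symm_of_mem_maximalAtlas he).comp h1 fun x hx => hx.2
  · refine ⟨hp, ?_⟩
    change e p ∈ P.target
    rw [← hz, ← hPc]
    exact P.map_source hzP
  · change P.symm (e p) = z
    rw [← hz, ← hPc]
    exact P.left_inv hzP
  · intro x hx
    have hx2 : ψ x ∈ e.target := hx.2
    rw [hcoe]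
    exact ⟨e.map_target hx2, e.right_inv hx2⟩

theorem pd_coord (i j : Fin m) (z : Coord m) :
    pd i (fun x : Coord m => x j) z = if i = j then 1 else 0 := by
  have : (fun x : Coord m => x j) = (EuclideanSpace.proj (𝕜 := ℝ) j : Coord m →L[ℝ] ℝ) := rfl
  rw [pd, this, ContinuousLinearMap.fderiv]
  simp [eq_comm]

theorem contDiff_coord (j : Fin m) : ContDiff ℝ ∞ (fun x : Coord m => x j) :=
  (EuclideanSpace.proj (𝕜 := ℝ) j : Coord m →L[ℝ] ℝ).contDiff

/-- A quadratic map with given Taylor expansion at the origin. -/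
theorem exists_quadratic_map (y : Coord m) (A : Matrix (Fin m) (Fin m) ℝ)
    (C : Fin m → Fin m → Fin m → ℝ) (hC : ∀ c i j, C c i j = C c j i) :
    ∃ ψ : Coord m → Coord m, ContDiff ℝ ∞ ψ ∧ ψ 0 = y ∧ jac ψ 0 = A ∧
      ∀ c i j, pd i (fun x => jac ψ x c j) 0 = C c i j := by
  set ψ : Coord m → Coord m := fun x => WithLp.toLp 2 fun c =>
    y c + ∑ i, A c i * x i + (1 / 2 : ℝ) * ∑ i, ∑ j, C c i j * (x i * x j) with hψ
  have hx := contDiff_coord (m := m)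
  have d : ∀ j z, DifferentiableAt ℝ (fun x : Coord m => x j) z := fun j z =>
    (hx j).differentiable (by simp) z
  have hs : ContDiff ℝ ∞ ψ := by
    rw [contDiff_euclidean]
    intro c
    exact (contDiff_const.add (ContDiff.sum fun i _ => contDiff_const.mul (hx i))).add
      (contDiff_const.mul (ContDiff.sum fun i _ => ContDiff.sum fun j _ =>
        contDiff_const.mul ((hx i).mul (hx j))))
  -- The quadratic term contributes twice, equally by the symmetry of C, which the factor 1/2
  -- compensates.
  have hJ : ∀ c j z, jac ψ z c j = A c j + ∑ i, C c j i * z i := by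
    intro c l z
    have d1 : ∀ i, DifferentiableAt ℝ (fun x : Coord m => A c i * x i) z := fun i =>
      (d i z).const_mul _
    have d2 : ∀ i j, DifferentiableAt ℝ (fun x : Coord m => C c i j * (x i * x j)) z := fun i j =>
      ((d i z).fun_mul (d j z)).const_mul _
    have d3 : ∀ i, DifferentiableAt ℝ (fun x : Coord m => ∑ j, C c i j * (x i * x j)) z :=
      fun i => DifferentiableAt.fun_sum fun j _ => d2 i j
    change pd l (fun x : Coord m => y c + ∑ i, A c i * x i
      + (1 / 2 : ℝ) * ∑ i, ∑ j, C c i j * (x i * x j)) z = _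
    rw [pd_add ((differentiableAt_const _).fun_add (DifferentiableAt.fun_sum fun i _ => d1 i))
      ((DifferentiableAt.fun_sum fun i _ => d3 i).const_mul _),
      pd_add (differentiableAt_const _) (DifferentiableAt.fun_sum fun i _ => d1 i), pd_const,
      pd_sum fun i _ => d1 i, pd_const_mul (DifferentiableAt.fun_sum fun i _ => d3 i),
      pd_sum fun i _ => d3 i]
    have e3 : ∀ i, pd l (fun x : Coord m => ∑ j, C c i j * (x i * x j)) z
        = ∑ j, C c i j * ((if l = i then 1 else 0) * z j + z i * (if l = j then 1 else 0)) := by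
      intro i
      rw [pd_sum fun j _ => d2 i j]
      refine Finset.sum_congr rfl fun j _ => ?_
      rw [pd_const_mul ((d i z).fun_mul (d j z)), pd_mul (d i z) (d j z), pd_coord, pd_coord]
    simp only [e3, pd_const_mul (d _ z), pd_coord, mul_add, Finset.sum_add_distrib]
    have e4 : ∑ i, ∑ j, C c i j * ((if l = i then 1 else 0) * z j) = ∑ i, C c l i * z i := by
      simp
    have e5 : ∑ i, ∑ j, C c i j * (z i * (if l = j then 1 else 0)) = ∑ i, C c l i * z i := by
      simp [hC c l]
    rw [e4, e5]
    simp
    ring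
  refine ⟨ψ, hs, ?_, ?_, ?_⟩
  · ext c; simp [hψ]
  · ext c j; simp [hJ]
  · intro c i j
    simp only [hJ]
    rw [pd_add (differentiableAt_const _) (DifferentiableAt.fun_sum fun k _ =>
      (d k 0).const_mul _), pd_const, pd_sum fun k _ => (d k 0).const_mul _]
    simp [pd_const_mul (d _ 0), pd_coord, hC c j i]

/-- Write A = yᵀy with y invertible and take B = y⁻¹. -/
theorem exists_conj_eq_one {A : Matrix (Fin m) (Fin m) ℝ} (hA : A.PosDef) :
    ∃ B : Matrix (Fin m) (Fin m) ℝ, IsUnit B.det ∧ B.transpose * A * B = 1 := by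
  open scoped MatrixOrder Matrix.Norms.L2Operator in
  obtain ⟨y, hy, rfl⟩ := CStarAlgebra.isStrictlyPositive_iff_eq_star_mul_self.mp
    hA.isStrictlyPositive
  have hd : IsUnit y.det := (Matrix.isUnit_iff_isUnit_det _).1 hy
  refine ⟨y⁻¹, Matrix.isUnit_nonsing_inv_det _ hd, ?_⟩
  rw [Matrix.star_eq_conjTranspose, Matrix.conjTranspose_eq_transpose_of_trivial,
    Matrix.transpose_nonsing_inv, ← Matrix.mul_assoc, Matrix.mul_assoc, Matrix.mul_nonsing_inv _ hd,
    Matrix.nonsing_inv_mul _ (by rwa [Matrix.det_transpose]), Matrix.mul_one]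

/-- Around each point there is a chart which is normal at that point up to first order. -/
theorem exists_normal_chart (g : RiemMetric m M) (p : M) :
    ∃ e ∈ IsManifold.maximalAtlas (𝓡 m) ∞ M, p ∈ e.source ∧
      IsNormalAt (gram g e) e.target (e p) := by
  set e := chartAt (Coord m) p with he_def
  have he : e ∈ IsManifold.maximalAtlas (𝓡 m) ∞ M := IsManifold.chart_mem_maximalAtlas p
  have hp : p ∈ e.source := mem_chart_source _ p
  have hG := isMetricOn_gram he g
  have hy := e.map_source hp
  obtain ⟨A, hAu, hA⟩ := exists_conj_eq_one (hG.posDef _ hy)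
  -- The linear part orthonormalises the metric; the second derivatives are chosen to cancel Γ in
  -- the transformation law of the Christoffel symbols. Vanishing of the new symbols then gives dG =
  -- 0 by metric compatibility.
  obtain ⟨ψ, hψ, hψ0, hψ1, hψ2⟩ := exists_quadratic_map (e p) A
    (fun c i j => - ∑ a, ∑ b, christoffel (gram g e) c a b (e p) * A a i * A b j) (by
      intro c i j
      rw [Finset.sum_comm]
      congr 1
      refine Finset.sum_congr rfl fun a _ => Finset.sum_congr rfl fun b _ => ?_
      rw [hG.christoffel_symm hy]; ring)
  obtain ⟨e₁, he₁, hp₁, hz₁, hψ₁⟩ := exists_chart_of_contDiff he hp hψ hψ0 (by rwa [hψ1])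
  have hG₁ := isMetricOn_gram he₁ g
  have hz : (0 : Coord m) ∈ e₁.target := hz₁ ▸ e₁.map_source hp₁
  have htr : ∀ x ∈ e₁.target, gram g e₁ x = (jac ψ x).transpose * gram g e (ψ x) * jac ψ x := by
    intro x hx
    have hj : jac (fun x => e (e₁.symm x)) x = jac ψ x := by
      ext a i
      exact pd_congr e₁.open_target (fun w hw => congrArg (fun q : Coord m => q a) (hψ₁ w hw).2) hx i
    rw [gram_transform he he₁ g hx (hψ₁ x hx).1, hj, (hψ₁ x hx).2]
  have hmaps : Set.MapsTo ψ e₁.target e.target := fun x hx => by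
    rw [← (hψ₁ x hx).2]; exact e.map_source (hψ₁ x hx).1
  have hΓ : ∀ k i j, christoffel (gram g e₁) k i j 0 = 0 := by
    intro k i j
    have h0 : A.mulVec (fun k => christoffel (gram g e₁) k i j 0) = A.mulVec 0 := by
      ext c
      have := hG.christoffel_transform hG₁ hψ.contDiffOn hmaps htr hz c i j
      rw [hψ1, hψ2, hψ0, neg_add_cancel] at this
      simpa [Matrix.mulVec, dotProduct] using this
    exact congrFun (Matrix.mulVec_injective_of_isUnit
      ((Matrix.isUnit_iff_isUnit_det _).2 hAu) h0) k
  refine ⟨e₁, he₁, hp₁, hz₁ ▸ ⟨hG₁, hz, ?_, ?_⟩⟩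
  · rw [htr 0 hz, hψ1, hψ0, hA]
  · intro l i j
    simp [hG₁.pd_eq_christoffel hz, hΓ]

end

/-! ### The Laplacian on a manifold -/

theorem IsMetricOn.mono {m : ℕ} {G : Coord m → Matrix (Fin m) (Fin m) ℝ} {U V : Set (Coord m)}
    (hG : IsMetricOn G U) (hV : IsOpen V) (h : V ⊆ U) : IsMetricOn G V :=
  ⟨hV, fun i j => (hG.smooth i j).mono h, fun z hz => hG.posDef z (h hz)⟩

theorem IsNormalAt.mono {m : ℕ} {G : Coord m → Matrix (Fin m) (Fin m) ℝ} {U V : Set (Coord m)}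
    {y : Coord m} (hG : IsNormalAt G U y) (hV : IsOpen V) (h : V ⊆ U) (hy : y ∈ V) :
    IsNormalAt G V y :=
  ⟨hG.metric.mono hV h, hy, hG.eq_one, hG.pd_eq_zero⟩

theorem hess_congr {m : ℕ} {G : Coord m → Matrix (Fin m) (Fin m) ℝ} {U : Set (Coord m)}
    {u v : Coord m → ℝ} {y : Coord m} (hU : IsOpen U) (h : Set.EqOn u v U) (hy : y ∈ U)
    (i j : Fin m) : hess G u i j y = hess G v i j y := by
  simp only [hess, pd_congr hU (fun z hz => pd_congr hU h hz j) hy, pd_congr hU h hy]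

theorem coordLaplacian_congr {m : ℕ} {G : Coord m → Matrix (Fin m) (Fin m) ℝ} {U : Set (Coord m)}
    {u v : Coord m → ℝ} {y : Coord m} (hU : IsOpen U) (h : Set.EqOn u v U) (hy : y ∈ U) :
    coordLaplacian G u y = coordLaplacian G v y := by
  simp only [coordLaplacian, hess_congr hU h hy]

theorem gradInner_congr {m : ℕ} {G : Coord m → Matrix (Fin m) (Fin m) ℝ} {U : Set (Coord m)}
    {u v : Coord m → ℝ} {y : Coord m} (hU : IsOpen U) (h : Set.EqOn u v U) (hy : y ∈ U) :
    gradInner G u u y = gradInner G v v y := by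
  simp only [gradInner, pd_congr hU h hy]

/-- The necessary condition of second order at a local minimum. -/
theorem pd_pd_nonneg_of_isLocalMin {m : ℕ} {U : Set (Coord m)} {u : Coord m → ℝ} {y : Coord m}
    (hU : IsOpen U) (hu : ContDiffOn ℝ ∞ u U) (hy : y ∈ U) (hmin : IsLocalMin u y) (i : Fin m) :
    0 ≤ pd i (pd i u) y := by
  set v : Coord m := EuclideanSpace.single i 1
  set γ : ℝ → Coord m := fun t => y + t • v with hγ
  have hγ0 : γ 0 = y := by simp [hγ]
  have hγc : Continuous γ := by fun_prop
  have hγd : ∀ t, HasDerivAt γ v t := fun t => by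
    have := ((hasDerivAt_id t).smul_const v).const_add y
    rwa [one_smul] at this
  have hev : ∀ᶠ t in nhds (0 : ℝ), γ t ∈ U :=
    hγc.continuousAt.eventually (by rw [hγ0]; exact hU.mem_nhds hy)
  have key : ∀ {w : Coord m → ℝ}, ContDiffOn ℝ ∞ w U → ∀ t, γ t ∈ U →
      HasDerivAt (fun t => w (γ t)) (pd i w (γ t)) t := fun {w} hw t ht =>
    ((hw.differentiableAt_of_isOpen hU ht).hasFDerivAt.comp_hasDerivAt t (hγd t))
  have h1 : deriv (fun t => u (γ t)) =ᶠ[nhds 0] fun t => pd i u (γ t) := by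
    filter_upwards [hev] with t ht using (key hu t ht).deriv
  have h2 : deriv (deriv fun t => u (γ t)) 0 = pd i (pd i u) y := by
    rw [h1.deriv_eq, (key (contDiffOn_pd hU hu i) 0 (by rwa [hγ0])).deriv, hγ0]
  have hmin' : IsLocalMin (fun t => u (γ t)) 0 := by
    have : Filter.Tendsto γ (nhds 0) (nhds y) := by
      simpa [hγ0] using hγc.tendsto 0
    have h := this.eventually hmin
    filter_upwards [h] with t ht
    simpa [hγ0] using ht
  -- A negative second derivative along the line would make the point also a local maximum, so u
  -- would be constant along the line near it and the second derivative zero.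
  by_contra hneg
  push Not at hneg
  rw [← h2] at hneg
  have hmax : IsLocalMax (fun t => u (γ t)) 0 :=
    isLocalMax_of_deriv_deriv_neg hneg hmin'.deriv_eq_zero
      (key hu 0 (by rwa [hγ0])).continuousAt
  have hconst : (fun t => u (γ t)) =ᶠ[nhds 0] fun _ => u (γ 0) := by
    filter_upwards [hmin', hmax] with t h1 h2 using le_antisymm h2 h1
  have : deriv (deriv fun t => u (γ t)) 0 = 0 := by
    rw [hconst.deriv.deriv_eq]; simp
  linarith

section

variable {m : ℕ} {M : Type*} [TopologicalSpace M] [ChartedSpace (Coord m) M]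
  [IsManifold (𝓡 m) ∞ M] {e e₁ : OpenPartialHomeomorph M (Coord m)} {u v : M → ℝ} {p : M}

/-- The Laplacian of a function on a Riemannian manifold. -/
noncomputable def laplacian (g : RiemMetric m M) (u : M → ℝ) (p : M) : ℝ :=
  let e := chartAt (Coord m) p
  coordLaplacian (gram g e) (fun y => u (e.symm y)) (e p)

/-- The global Laplacian and gradient norm use the preferred chart at each point; invariance allows
them to be computed in a normal chart at the point, or in one fixed chart over its whole domain. -/
theorem chart_invariance (g : RiemMetric m M) (he : e ∈ IsManifold.maximalAtlas (𝓡 m) ∞ M)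
    (he₁ : e₁ ∈ IsManifold.maximalAtlas (𝓡 m) ∞ M) (hu : ContMDiff (𝓡 m) 𝓘(ℝ, ℝ) ∞ u)
    (hp : p ∈ e.source) (hp₁ : p ∈ e₁.source) :
    coordLaplacian (gram g e₁) (fun y => u (e₁.symm y)) (e₁ p)
      = coordLaplacian (gram g e) (fun y => u (e.symm y)) (e p) ∧
    gradInner (gram g e₁) (fun y => u (e₁.symm y)) (fun y => u (e₁.symm y)) (e₁ p)
      = gradInner (gram g e) (fun y => u (e.symm y)) (fun y => u (e.symm y)) (e p) := by
  set V : Set (Coord m) := e₁.target ∩ (fun z => id (e₁.symm z)) ⁻¹' e.source with hV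
  have hVo : IsOpen V := isOpen_chart_map e₁ e continuous_id
  set ψ : Coord m → Coord m := fun z => e (id (e₁.symm z)) with hψ
  have hψs : ContDiffOn ℝ ∞ ψ V := contDiffOn_chart_map he₁ he contMDiff_id
  have hG := isMetricOn_gram he g
  have hG₁ := (isMetricOn_gram he₁ g).mono hVo Set.inter_subset_left
  have hz : e₁ p ∈ V := ⟨e₁.map_source hp₁, by simpa [e₁.left_inv hp₁] using hp⟩
  have hm : Set.MapsTo ψ V e.target := fun x hx => e.map_source hx.2
  have htr : ∀ x ∈ V, gram g e₁ x = (jac ψ x).transpose * gram g e (ψ x) * jac ψ x :=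
    fun x hx => gram_transform he he₁ g hx.1 hx.2
  have hus := contDiffOn_comp_symm he hu
  have hψz : ψ (e₁ p) = e p := by simp [hψ, e₁.left_inv hp₁]
  have hcong : Set.EqOn (fun y => u (e₁.symm y)) (fun x => u (e.symm (ψ x))) V := fun x hx => by
    simp only [hψ]
    rw [e.left_inv hx.2]; rfl
  have hψd : DifferentiableAt ℝ ψ (e₁ p) :=
    (hψs.differentiableOn (by simp)).differentiableAt (hVo.mem_nhds hz)
  have hud := hus.differentiableAt_of_isOpen e.open_target (hm hz)
  refine ⟨?_, ?_⟩
  · rw [coordLaplacian_congr hVo hcong hz,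
      hG.laplacian_transform (u := fun y => u (e.symm y)) hG₁ hψs hm htr hz hus, hψz]
  · rw [gradInner_congr hVo hcong hz]
    have := hG₁.gradInner_transform (u := fun y => u (e.symm y)) (v := fun y => u (e.symm y))
      htr hz hψd hud hud
    rw [this, hψz]

theorem laplacian_eq (g : RiemMetric m M) (he : e ∈ IsManifold.maximalAtlas (𝓡 m) ∞ M)
    (hu : ContMDiff (𝓡 m) 𝓘(ℝ, ℝ) ∞ u) (hp : p ∈ e.source) :
    laplacian g u p = coordLaplacian (gram g e) (fun y => u (e.symm y)) (e p) :=
  (chart_invariance g he (IsManifold.chart_mem_maximalAtlas p) hu hp (mem_chart_source _ p)).1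

theorem gradNormSq_eq (g : RiemMetric m M) (he : e ∈ IsManifold.maximalAtlas (𝓡 m) ∞ M)
    (hu : ContMDiff (𝓡 m) 𝓘(ℝ, ℝ) ∞ u) (hp : p ∈ e.source) :
    gradNormSq g u p = gradInner (gram g e) (fun y => u (e.symm y)) (fun y => u (e.symm y)) (e p) :=
  (chart_invariance g he (IsManifold.chart_mem_maximalAtlas p) hu hp (mem_chart_source _ p)).2

theorem laplacian_symm_eq (g : RiemMetric m M) (he : e ∈ IsManifold.maximalAtlas (𝓡 m) ∞ M)
    (hu : ContMDiff (𝓡 m) 𝓘(ℝ, ℝ) ∞ u) {z : Coord m} (hz : z ∈ e.target) :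
    laplacian g u (e.symm z) = coordLaplacian (gram g e) (fun y => u (e.symm y)) z := by
  rw [laplacian_eq g he hu (e.map_target hz), e.right_inv hz]

theorem gradNormSq_symm_eq (g : RiemMetric m M) (he : e ∈ IsManifold.maximalAtlas (𝓡 m) ∞ M)
    (hu : ContMDiff (𝓡 m) 𝓘(ℝ, ℝ) ∞ u) {z : Coord m} (hz : z ∈ e.target) :
    gradNormSq g u (e.symm z)
      = gradInner (gram g e) (fun y => u (e.symm y)) (fun y => u (e.symm y)) z := by
  rw [gradNormSq_eq g he hu (e.map_target hz), e.right_inv hz]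

theorem continuous_of_forall_chart {w : M → ℝ} (h : ∀ p : M, ContinuousOn
    (fun z => w ((chartAt (Coord m) p).symm z)) (chartAt (Coord m) p).target) : Continuous w := by
  rw [continuous_iff_continuousAt]
  intro p
  set e := chartAt (Coord m) p
  have hp : p ∈ e.source := mem_chart_source _ p
  have h1 : ContinuousAt (fun z => w (e.symm z)) (e p) :=
    (h p).continuousAt (e.open_target.mem_nhds (e.map_source hp))
  have h2 := h1.comp (f := e) (e.continuousAt hp)
  refine h2.congr ?_
  filter_upwards [e.open_source.mem_nhds hp] with q hq
  simp [e.left_inv hq]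

/-! ### Continuity, behaviour at minima and algebraic rules for the Laplacian and the gradient norm
-/

theorem continuous_laplacian (g : RiemMetric m M) (hu : ContMDiff (𝓡 m) 𝓘(ℝ, ℝ) ∞ u) :
    Continuous (laplacian g u) :=
  continuous_of_forall_chart fun p => by
    have he := IsManifold.chart_mem_maximalAtlas (I := 𝓡 m) (n := ∞) p
    exact ((isMetricOn_gram he g).smooth_laplacian (contDiffOn_comp_symm he hu)).continuousOn.congr
      fun z hz => laplacian_symm_eq g he hu hz

theorem continuous_gradNormSq (g : RiemMetric m M) (hu : ContMDiff (𝓡 m) 𝓘(ℝ, ℝ) ∞ u) :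
    Continuous (gradNormSq g u) :=
  continuous_of_forall_chart fun p => by
    have he := IsManifold.chart_mem_maximalAtlas (I := 𝓡 m) (n := ∞) p
    have hs := contDiffOn_comp_symm he hu
    exact ((isMetricOn_gram he g).smooth_gradInner hs hs).continuousOn.congr
      fun z hz => gradNormSq_symm_eq g he hu hz

theorem gradNormSq_nonneg (g : RiemMetric m M) (hu : ContMDiff (𝓡 m) 𝓘(ℝ, ℝ) ∞ u) (p : M) :
    0 ≤ gradNormSq g u p := by
  obtain ⟨e, he, hp, hn⟩ := exists_normal_chart g p
  rw [gradNormSq_eq g he hu hp, hn.gradInner_apply]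
  exact Finset.sum_nonneg fun i _ => mul_self_nonneg _

theorem isLocalMin_chart (hp : p ∈ e.source) (h : IsLocalMin u p) :
    IsLocalMin (fun z => u (e.symm z)) (e p) := by
  have h1 : Filter.Tendsto e.symm (nhds (e p)) (nhds p) := e.tendsto_symm hp
  have h2 := h1.eventually h
  filter_upwards [h2] with z hz
  simpa [e.left_inv hp] using hz

theorem gradNormSq_eq_zero_of_isLocalMin (g : RiemMetric m M) (h : IsLocalMin u p) :
    gradNormSq g u p = 0 := by
  have h1 := (isLocalMin_chart (mem_chart_source (Coord m) p) h).fderiv_eq_zero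
  simp only [gradNormSq, gradInner, metricTrace, pd, h1]
  simp

theorem laplacian_nonneg_of_isLocalMin (g : RiemMetric m M) (hu : ContMDiff (𝓡 m) 𝓘(ℝ, ℝ) ∞ u)
    (h : IsLocalMin u p) : 0 ≤ laplacian g u p := by
  obtain ⟨e, he, hp, hn⟩ := exists_normal_chart g p
  rw [laplacian_eq g he hu hp, hn.laplacian_apply]
  refine Finset.sum_nonneg fun i _ => ?_
  rw [hn.hess_apply]
  exact pd_pd_nonneg_of_isLocalMin e.open_target (contDiffOn_comp_symm he hu) hn.mem
    (isLocalMin_chart hp h) i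

theorem laplacian_congr (g : RiemMetric m M) (h : u =ᶠ[nhds p] v) :
    laplacian g u p = laplacian g v p := by
  have hp := mem_chart_source (Coord m) p
  set e := chartAt (Coord m) p with he
  have h1 := (e.tendsto_symm hp).eventually h
  obtain ⟨U, hU, hUo, hpU⟩ := eventually_nhds_iff.1 h1
  exact coordLaplacian_congr hUo hU hpU

theorem gradNormSq_congr (g : RiemMetric m M) (h : u =ᶠ[nhds p] v) :
    gradNormSq g u p = gradNormSq g v p := by
  have hp := mem_chart_source (Coord m) p
  set e := chartAt (Coord m) p with he
  have h1 := (e.tendsto_symm hp).eventually h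
  obtain ⟨U, hU, hUo, hpU⟩ := eventually_nhds_iff.1 h1
  exact gradInner_congr hUo hU hpU

theorem laplacian_sum (g : RiemMetric m M) {ι : Type*} (s : Finset ι) {w : ι → M → ℝ}
    (hw : ∀ k ∈ s, ContMDiff (𝓡 m) 𝓘(ℝ, ℝ) ∞ (w k)) (p : M) :
    laplacian g (fun q => ∑ k ∈ s, w k q) p = ∑ k ∈ s, laplacian g (w k) p := by
  have hsum : ContMDiff (𝓡 m) 𝓘(ℝ, ℝ) ∞ (fun q => ∑ k ∈ s, w k q) := contMDiff_finsetSum hw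
  obtain ⟨e, he, hp, hn⟩ := exists_normal_chart g p
  rw [laplacian_eq g he hsum hp, Finset.sum_congr rfl fun k hk => laplacian_eq g he (hw k hk) hp]
  simp only [hn.laplacian_apply, hn.hess_apply]
  rw [Finset.sum_comm]
  exact Finset.sum_congr rfl fun i _ =>
    pd_pd_sum e.open_target (fun k hk => contDiffOn_comp_symm he (hw k hk)) hn.mem i i

/-- Integrated over a compact manifold this is the form of Green's formula used in the gap argument.
-/
theorem laplacian_mul_self (g : RiemMetric m M) (hu : ContMDiff (𝓡 m) 𝓘(ℝ, ℝ) ∞ u) (p : M) :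
    laplacian g (fun q => u q * u q) p = 2 * (u p * laplacian g u p + gradNormSq g u p) := by
  obtain ⟨e, he, hp, hn⟩ := exists_normal_chart g p
  have hs := contDiffOn_comp_symm he hu
  rw [laplacian_eq (u := fun q => u q * u q) g he (hu.mul hu) hp, laplacian_eq g he hu hp, gradNormSq_eq g he hu hp,
    hn.laplacian_apply, hn.laplacian_apply, hn.gradInner_apply, Finset.mul_sum,
    ← Finset.sum_add_distrib, Finset.mul_sum]
  refine Finset.sum_congr rfl fun i _ => ?_
  rw [hn.hess_apply, hn.hess_apply, pd_pd_mul e.open_target hs hs hn.mem, e.left_inv hp]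
  ring

theorem laplacian_const_sub (g : RiemMetric m M) (hu : ContMDiff (𝓡 m) 𝓘(ℝ, ℝ) ∞ u) (c : ℝ)
    (p : M) : laplacian g (fun q => c - u q) p = - laplacian g u p := by
  obtain ⟨e, he, hp, hn⟩ := exists_normal_chart g p
  have hs := contDiffOn_comp_symm he hu
  rw [laplacian_eq g he (contMDiff_const.sub hu) hp, laplacian_eq g he hu hp, hn.laplacian_apply,
    hn.laplacian_apply, ← Finset.sum_neg_distrib]
  refine Finset.sum_congr rfl fun i _ => ?_
  have h1 : ∀ z ∈ e.target, pd i (fun z => c - u (e.symm z)) z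
      = (-1 : ℝ) * pd i (fun z => u (e.symm z)) z := fun z hz => by
    rw [pd_sub (differentiableAt_const _) (hs.differentiableAt_of_isOpen e.open_target hz)]
    simp
  rw [hn.hess_apply, hn.hess_apply, pd_congr e.open_target h1 hn.mem, pd_const_mul
    (hn.diff (contDiffOn_pd e.open_target hs i))]
  ring

theorem gradNormSq_const_sub (g : RiemMetric m M) (hu : ContMDiff (𝓡 m) 𝓘(ℝ, ℝ) ∞ u) (c : ℝ)
    (p : M) : gradNormSq g (fun q => c - u q) p = gradNormSq g u p := by
  have he := IsManifold.chart_mem_maximalAtlas (I := 𝓡 m) (n := ∞) p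
  have hs := contDiffOn_comp_symm he hu
  have h1 := fun i => pd_sub (u := fun _ => c) (differentiableAt_const _)
    (hs.differentiableAt_of_isOpen (chartAt (Coord m) p).open_target (mem_chart_target _ p)) i
  simp only [gradNormSq, gradInner, h1, pd_const]
  simp

theorem metricTrace_self {G : Matrix (Fin m) (Fin m) ℝ} (hG : G.PosDef) :
    metricTrace G G = m := by
  have h1 : G.transpose = G := by
    have := hG.1.eq
    rwa [Matrix.conjTranspose_eq_transpose_of_trivial] at this
  rw [metricTrace_eq_trace, h1, Matrix.nonsing_inv_mul _ hG.det_pos.ne'.isUnit]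
  simp

end

/-! ### Ricci-harmonic solitons -/

section Soliton

variable {m n : ℕ} {M : Type*} [TopologicalSpace M] [ChartedSpace (Coord m) M]
  [IsManifold (𝓡 m) ∞ M] {N : Type*} [TopologicalSpace N] [ChartedSpace (Coord n) N]
  [IsManifold (𝓡 n) ∞ N] {g : RiemMetric m M} {h : RiemMetric n N} {φ : M → N} {f : M → ℝ}
  {α lam : ℝ}

/-- The trace of the soliton equation: `S + Δf = mλ`. -/
theorem IsRicciHarmonicSoliton.genScalarCurvature_eq (hsol : IsRicciHarmonicSoliton g h φ f α lam)
    (p : M) : genScalarCurvature g h φ α p = m * lam - laplacian g f p := by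
  have he := IsManifold.chart_mem_maximalAtlas (I := 𝓡 m) (n := ∞) p
  have hy := mem_chart_target (Coord m) p
  have hG := (isMetricOn_gram he g).posDef _ hy
  have hs := hsol.soliton _ he _ hy
  set e := chartAt (Coord m) p with he_def
  have h1 : lam * metricTrace (gram g e (e p)) (gram g e (e p)) = lam * m := by
    rw [metricTrace_self hG]
  change metricTrace (gram g e (e p)) (fun i j => ricci (gram g e) i j (e p))
    - α * metricTrace (gram g e (e p)) (pullback h φ e (e p))
    = m * lam - metricTrace (gram g e (e p))
      (fun i j => hess (gram g e) (fun y => f (e.symm y)) i j (e p))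
  rw [mul_comm (m : ℝ), ← h1, eq_sub_iff_add_eq]
  simp only [metricTrace, Finset.mul_sum, ← Finset.sum_sub_distrib, ← Finset.sum_add_distrib]
  refine Finset.sum_congr rfl fun i _ => Finset.sum_congr rfl fun j _ => ?_
  rw [← mul_assoc lam, mul_comm lam, mul_assoc, ← hs i j]
  ring

/-- Data for the coordinate identities: normal charts of the two manifolds at a point. -/
theorem IsRicciHarmonicSoliton.exists_normal_charts
    (hsol : IsRicciHarmonicSoliton g h φ f α lam) (hφ : ContMDiff (𝓡 m) (𝓡 n) ∞ φ)
    (p : M) :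
    ∃ e ∈ IsManifold.maximalAtlas (𝓡 m) ∞ M, ∃ (U : Set (Coord m))
      (H : Coord n → Matrix (Fin n) (Fin n) ℝ) (U' : Set (Coord n)) (Φ : Coord m → Coord n),
      p ∈ e.source ∧ U ⊆ e.target ∧ IsNormalAt (gram g e) U (e p) ∧ IsNormalAt H U' (Φ (e p)) ∧
      ContDiffOn ℝ ∞ Φ U ∧ Set.MapsTo Φ U U' ∧
      (∀ z ∈ U, ∀ i j, ricci (gram g e) i j z - α * coordPullback H Φ z i j
        + hess (gram g e) (fun y => f (e.symm y)) i j z = lam * gram g e z i j) ∧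
      ∀ a, tension (gram g e) H Φ a (e p)
        = gradInner (gram g e) (fun z => Φ z a) (fun y => f (e.symm y)) (e p) := by
  obtain ⟨e, he, hp, hn⟩ := exists_normal_chart g p
  obtain ⟨e', he', hp', hn'⟩ := exists_normal_chart h (φ p)
  have hU := isOpen_chart_map e e' hφ.continuous
  have hpU : e p ∈ e.target ∩ (fun z => φ (e.symm z)) ⁻¹' e'.source :=
    ⟨e.map_source hp, by simpa [e.left_inv hp] using hp'⟩
  refine ⟨e, he, e.target ∩ (fun z => φ (e.symm z)) ⁻¹' e'.source, gram h e', e'.target,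
    fun z => e' (φ (e.symm z)), hp, Set.inter_subset_left,
    hn.mono hU Set.inter_subset_left hpU, ?_, contDiffOn_chart_map he he' hφ,
    fun z hz => e'.map_source hz.2, ?_, ?_⟩
  · simpa [e.left_inv hp] using hn'
  · intro z hz i j
    rw [← pullback_eq_coordPullback he he' h hφ hz.1 hz.2]
    exact hsol.soliton e he z hz.1 i j
  · exact hsol.map_eq e he e' he' (e p) hpU.1 hpU.2

variable (g f lam) in
/-- The function `S + |∇f|² - 2λf`, where `S = mλ - Δf`. -/
noncomputable def conserved (p : M) : ℝ :=
  m * lam - laplacian g f p + gradNormSq g f p - 2 * lam * f p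

theorem conserved_symm_eq {e : OpenPartialHomeomorph M (Coord m)}
    (he : e ∈ IsManifold.maximalAtlas (𝓡 m) ∞ M) (hf : ContMDiff (𝓡 m) 𝓘(ℝ, ℝ) ∞ f)
    {z : Coord m} (hz : z ∈ e.target) :
    conserved g f lam (e.symm z) = m * lam - coordLaplacian (gram g e) (fun y => f (e.symm y)) z
      + gradInner (gram g e) (fun y => f (e.symm y)) (fun y => f (e.symm y)) z
      - 2 * lam * f (e.symm z) := by
  rw [conserved, laplacian_symm_eq g he hf hz, gradNormSq_symm_eq g he hf hz]

theorem contDiffOn_conserved {e : OpenPartialHomeomorph M (Coord m)}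
    (he : e ∈ IsManifold.maximalAtlas (𝓡 m) ∞ M) (hf : ContMDiff (𝓡 m) 𝓘(ℝ, ℝ) ∞ f) :
    ContDiffOn ℝ ∞ (fun z => conserved g f lam (e.symm z)) e.target := by
  have hG := isMetricOn_gram he g
  have hs := contDiffOn_comp_symm he hf
  exact (((contDiffOn_const.sub (hG.smooth_laplacian hs)).add (hG.smooth_gradInner hs hs)).sub
    (contDiffOn_const.mul hs)).congr fun z hz => conserved_symm_eq he hf hz

/-- The identity dW = 0 is known only at the centre of a normal chart. Every point is such a centre,
and the chain rule moves the vanishing to an arbitrary chart. -/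
theorem IsRicciHarmonicSoliton.pd_conserved_chart (hsol : IsRicciHarmonicSoliton g h φ f α lam)
    (hφ : ContMDiff (𝓡 m) (𝓡 n) ∞ φ) (hf : ContMDiff (𝓡 m) 𝓘(ℝ, ℝ) ∞ f)
    {e : OpenPartialHomeomorph M (Coord m)} (he : e ∈ IsManifold.maximalAtlas (𝓡 m) ∞ M)
    {z : Coord m} (hz : z ∈ e.target) (j : Fin m) :
    pd j (fun z => conserved g f lam (e.symm z)) z = 0 := by
  obtain ⟨e₁, he₁, U, H, U', Φ, hp₁, hU, hG, hH, hΦ, hm, hs, hmap⟩ :=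
    hsol.exists_normal_charts hφ (e.symm z)
  have hfs := contDiffOn_comp_symm he₁ hf
  have h1 : ∀ a, pd a (fun x => conserved g f lam (e₁.symm x)) (e₁ (e.symm z)) = 0 := by
    intro a
    rw [pd_congr hG.metric.isOpen (fun x hx => conserved_symm_eq he₁ hf (hU hx)) hG.mem]
    exact pd_conserved hG hH hΦ hm (hfs.mono hU) hs hmap a
  set V : Set (Coord m) := e.target ∩ (fun z => id (e.symm z)) ⁻¹' e₁.source with hV
  have hVo : IsOpen V := isOpen_chart_map e e₁ continuous_id
  have hψs : ContDiffOn ℝ ∞ (fun x => e₁ (id (e.symm x))) V :=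
    contDiffOn_chart_map he he₁ contMDiff_id
  have hzV : z ∈ V := ⟨hz, hp₁⟩
  have hcong : Set.EqOn (fun x => conserved g f lam (e.symm x))
      (fun x => conserved g f lam (e₁.symm (e₁ (id (e.symm x))))) V := fun x hx => by
    simp only
    rw [e₁.left_inv hx.2]; rfl
  rw [pd_congr hVo hcong hzV,
    pd_comp (u := fun y => conserved g f lam (e₁.symm y)) (ψ := fun x => e₁ (id (e.symm x)))
      ((hψs.differentiableOn (by simp)).differentiableAt (hVo.mem_nhds hzV))
      ((contDiffOn_conserved he₁ hf).differentiableAt_of_isOpen e₁.open_target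
        (e₁.map_source hp₁))]
  exact Finset.sum_eq_zero fun a _ => by rw [id, h1 a, mul_zero]

/-- A function with vanishing differential is locally constant. -/
theorem isLocallyConstant_of_pd_eq_zero {w : M → ℝ}
    (hw : ∀ e ∈ IsManifold.maximalAtlas (𝓡 m) ∞ M,
      DifferentiableOn ℝ (fun z => w (e.symm z)) e.target ∧
      ∀ z ∈ e.target, ∀ j, pd j (fun z => w (e.symm z)) z = 0) : IsLocallyConstant w := by
  rw [IsLocallyConstant.iff_eventually_eq]
  intro p
  have he := IsManifold.chart_mem_maximalAtlas (I := 𝓡 m) (n := ∞) p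
  set e := chartAt (Coord m) p with he_def
  have hp : p ∈ e.source := mem_chart_source _ p
  obtain ⟨hd, h0⟩ := hw e he
  obtain ⟨r, hr, hball⟩ := Metric.isOpen_iff.1 e.open_target (e p) (e.map_source hp)
  have h1 : ∀ z ∈ Metric.ball (e p) r, w (e.symm z) = w p := by
    intro z hz
    have := (convex_ball (e p) r).is_const_of_fderivWithin_eq_zero (𝕜 := ℝ)
      (f := fun z => w (e.symm z)) (hd.mono hball) (fun x hx => by
        rw [fderivWithin_of_isOpen Metric.isOpen_ball hx]
        exact fderiv_eq_zero_of_pd (h0 x (hball hx))) hz (Metric.mem_ball_self hr)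
    simpa [e.left_inv hp] using this
  filter_upwards [e.open_source.mem_nhds hp,
    (e.continuousAt hp).eventually (Metric.ball_mem_nhds (e p) hr)] with q hq hqr
  rw [← h1 _ hqr, e.left_inv hq]

theorem IsRicciHarmonicSoliton.isLocallyConstant_conserved
    (hsol : IsRicciHarmonicSoliton g h φ f α lam)
    (hφ : ContMDiff (𝓡 m) (𝓡 n) ∞ φ) (hf : ContMDiff (𝓡 m) 𝓘(ℝ, ℝ) ∞ f) :
    IsLocallyConstant (conserved g f lam) :=
  isLocallyConstant_of_pd_eq_zero fun _ he =>
    ⟨(contDiffOn_conserved he hf).differentiableOn (by simp), fun _ hz j =>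
      hsol.pd_conserved_chart hφ hf he hz j⟩

/-- The generalized scalar curvature of a shrinking soliton is nonnegative at its minima. -/
theorem IsRicciHarmonicSoliton.nonneg_of_isLocalMin
    (hsol : IsRicciHarmonicSoliton g h φ f α lam)
    (hφ : ContMDiff (𝓡 m) (𝓡 n) ∞ φ) (hf : ContMDiff (𝓡 m) 𝓘(ℝ, ℝ) ∞ f) (hlam : 0 < lam)
    {p : M} (hmin : IsLocalMin (fun q => m * lam - laplacian g f q) p) :
    0 ≤ m * lam - laplacian g f p := by
  obtain ⟨e, he, U, H, U', Φ, hp, hU, hG, hH, hΦ, hm, hs, hmap⟩ := hsol.exists_normal_charts hφ p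
  have hUo := hG.metric.isOpen
  have hfs := (contDiffOn_comp_symm he hf).mono hU
  have hsm : ContDiffOn ℝ ∞ (fun z => m * lam - coordLaplacian (gram g e)
    (fun y => f (e.symm y)) z) U := contDiffOn_const.sub (hG.metric.smooth_laplacian hfs)
  have hmin' : IsLocalMin (fun z => m * lam - coordLaplacian (gram g e)
      (fun y => f (e.symm y)) z) (e p) := by
    refine (isLocalMin_chart hp hmin).congr ?_
    filter_upwards [hUo.mem_nhds hG.mem] with z hz
    rw [laplacian_symm_eq g he hf (hU hz)]
  rw [laplacian_eq g he hf hp]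
  refine conserved_nonneg hG hH hΦ hm hfs hs hmap (fun z hz j => ?_) (fun j => ?_)
    (fun i => pd_pd_nonneg_of_isLocalMin hUo hsm hG.mem hmin' i) hsol.coupling_nonneg hlam
  · rw [← pd_congr hUo (fun x hx => conserved_symm_eq he hf (hU hx)) hz]
    exact hsol.pd_conserved_chart hφ hf he (hU hz) j
  · rw [pd, hmin'.fderiv_eq_zero]; rfl

theorem IsRicciHarmonicSoliton.nonneg [CompactSpace M]
    (hsol : IsRicciHarmonicSoliton g h φ f α lam)
    (hφ : ContMDiff (𝓡 m) (𝓡 n) ∞ φ) (hf : ContMDiff (𝓡 m) 𝓘(ℝ, ℝ) ∞ f) (hlam : 0 < lam)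
    (p : M) : 0 ≤ m * lam - laplacian g f p := by
  obtain ⟨q, -, hq⟩ := isCompact_univ.exists_isMinOn ⟨p, Set.mem_univ p⟩
    (continuous_const.sub (continuous_laplacian g hf) :
      Continuous fun q => m * lam - laplacian g f q).continuousOn
  exact (hsol.nonneg_of_isLocalMin hφ hf hlam (hq.isLocalMin Filter.univ_mem)).trans
    (hq (Set.mem_univ p))

theorem pd_eq_zero_of_isLocallyConstant {u : M → ℝ} (hu : IsLocallyConstant u)
    (e : OpenPartialHomeomorph M (Coord m)) {z : Coord m} (hz : z ∈ e.target) (j : Fin m) :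
    pd j (fun z => u (e.symm z)) z = 0 := by
  have h1 := ((e.symm.continuousAt hz).eventually (hu.eventually_eq (e.symm z)))
  have h2 : (fun z => u (e.symm z)) =ᶠ[nhds z] fun _ => u (e.symm z) := h1
  rw [pd, h2.fderiv_eq]
  simp

theorem IsRicciHarmonicSoliton.isHarmonicEinstein_of_isLocallyConstant
    (hsol : IsRicciHarmonicSoliton g h φ f α lam) (hf : IsLocallyConstant f) :
    IsHarmonicEinstein g h φ α lam where
  einstein e he y hy i j := by
    have h0 : hess (gram g e) (fun z => f (e.symm z)) i j y = 0 := by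
      have h1 : pd i (pd j fun z => f (e.symm z)) y = 0 := by
        rw [pd_congr e.open_target (v := fun _ => 0)
          (fun z hz => pd_eq_zero_of_isLocallyConstant hf e hz j) hy, pd_const]
      simp [hess, h1, pd_eq_zero_of_isLocallyConstant hf e hy]
    rw [← hsol.soliton e he y hy i j, h0, add_zero]
  harmonic e he e' he' y hy hy' a := by
    rw [hsol.map_eq e he e' he' y hy hy' a]
    simp [gradInner, metricTrace, pd_eq_zero_of_isLocallyConstant hf e hy]

/-- Subtracting the Einstein equation from the soliton equation leaves Hess f = 0. -/
theorem IsRicciHarmonicSoliton.laplacian_eq_zero (hsol : IsRicciHarmonicSoliton g h φ f α lam)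
    (hE : IsHarmonicEinstein g h φ α lam) (p : M) : laplacian g f p = 0 := by
  have he := IsManifold.chart_mem_maximalAtlas (I := 𝓡 m) (n := ∞) p
  have hy := mem_chart_target (Coord m) p
  have h0 : ∀ i j, hess (gram g (chartAt (Coord m) p))
      (fun y => f ((chartAt (Coord m) p).symm y)) i j (chartAt (Coord m) p p) = 0 := fun i j => by
    have h1 := hsol.soliton _ he _ hy i j
    have h2 := hE.einstein _ he _ hy i j
    linarith
  simp [laplacian, coordLaplacian, metricTrace, h0]

end Soliton

/-! ### The Laplacian in divergence form -/

/-- Jacobi's formula for the derivative of the determinant. -/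
theorem pd_det {m : ℕ} {A : Coord m → Matrix (Fin m) (Fin m) ℝ} {y : Coord m}
    (hA : ∀ k l, DifferentiableAt ℝ (fun z => A z k l) y) (i : Fin m) :
    pd i (fun z => (A z).det) y
      = ∑ k, ∑ l, (A y).adjugate l k * pd i (fun z => A z k l) y := by
  -- The determinant is multilinear in the rows, so its derivative replaces one row at a time;
  -- Cramer's rule expresses each such determinant through the adjugate.
  set D : ContinuousMultilinearMap ℝ (fun _ : Fin m => Fin m → ℝ) ℝ :=
    ⟨(Matrix.detRowAlternating (n := Fin m) (R := ℝ)).toMultilinearMap,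
      Continuous.matrix_det continuous_id⟩ with hD
  have hD' : ∀ B : Fin m → Fin m → ℝ, D B = Matrix.det (Matrix.of B) := fun _ => rfl
  set A' : Coord m → Fin m → Fin m → ℝ := fun z k l => A z k l with hA'
  have h1 : HasFDerivAt A' (ContinuousLinearMap.pi fun k => ContinuousLinearMap.pi fun l =>
      fderiv ℝ (fun z => A z k l) y) y :=
    hasFDerivAt_pi.2 fun k => hasFDerivAt_pi.2 fun l => (hA k l).hasFDerivAt
  have h2 := (D.hasFDerivAt (A' y)).comp y h1
  have h3 : (fun z => (A z).det) = D ∘ A' := rfl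
  rw [pd, h3, h2.fderiv, ContinuousLinearMap.comp_apply]
  rw [ContinuousMultilinearMap.linearDeriv_apply]
  refine Finset.sum_congr rfl fun k _ => ?_
  have h4 : D (Function.update (A' y) k fun l => pd i (fun z => A z k l) y)
      = ((A y).updateRow k fun l => pd i (fun z => A z k l) y).det := rfl
  refine h4.trans ?_
  rw [← Matrix.cramer_transpose_apply, Matrix.cramer_eq_adjugate_mulVec, ← Matrix.adjugate_transpose]
  simp [Matrix.mulVec, dotProduct]

namespace IsMetricOn

variable {m : ℕ} {G : Coord m → Matrix (Fin m) (Fin m) ℝ} {U : Set (Coord m)}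
  {u : Coord m → ℝ} {y : Coord m}

theorem smooth_sqrt_det (hG : IsMetricOn G U) :
    ContDiffOn ℝ ∞ (fun z => Real.sqrt (G z).det) U :=
  (contDiffOn_det hG.smooth).sqrt fun z hz => (hG.posDef z hz).det_pos.ne'

/-- Jacobi's formula gives ∂ᵢ log det G = gᵏˡ ∂ᵢgₖₗ, which is twice the contracted symbol Γᵏₖᵢ; its
other two terms cancel by symmetry. The root is handled by differentiating its square. -/
theorem pd_sqrt_det (hG : IsMetricOn G U) (hy : y ∈ U) (i : Fin m) :
    pd i (fun z => Real.sqrt (G z).det) y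
      = Real.sqrt (G y).det * ∑ k, christoffel G k k i y := by
  have hpos := (hG.posDef y hy).det_pos
  have hs : 0 < Real.sqrt (G y).det := Real.sqrt_pos.2 hpos
  have hdet := (contDiffOn_det hG.smooth).differentiableAt_of_isOpen hG.isOpen hy
  have hsd := hG.smooth_sqrt_det.differentiableAt_of_isOpen hG.isOpen hy
  have h1 : pd i (fun z => (G z).det) y
      = 2 * Real.sqrt (G y).det * pd i (fun z => Real.sqrt (G z).det) y := by
    rw [pd_congr hG.isOpen (v := fun z => Real.sqrt (G z).det * Real.sqrt (G z).det)
      (fun z hz => (Real.mul_self_sqrt (hG.posDef z hz).det_pos.le).symm) hy, pd_mul hsd hsd]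
    ring
  have h2 : pd i (fun z => (G z).det) y
      = (G y).det * ∑ k, ∑ l, (G y)⁻¹ k l * pd i (fun z => G z k l) y := by
    rw [pd_det (hG.differentiableAt hy), Finset.mul_sum]
    refine Finset.sum_congr rfl fun k _ => ?_
    rw [Finset.mul_sum]
    refine Finset.sum_congr rfl fun l _ => ?_
    rw [hG.inv_apply_symm hy k l, Matrix.inv_def, Matrix.smul_apply, Ring.inverse_eq_inv',
      smul_eq_mul]
    field_simp
  have h3 : ∑ k, christoffel G k k i y
      = (1 / 2 : ℝ) * ∑ k, ∑ l, (G y)⁻¹ k l * pd i (fun z => G z k l) y := by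
    simp only [christoffel, ← Finset.mul_sum]
    congr 1
    have e : ∀ k l, (G y)⁻¹ k l * (pd k (fun z => G z i l) y + pd i (fun z => G z k l) y
        - pd l (fun z => G z k i) y) = (G y)⁻¹ k l * pd i (fun z => G z k l) y
        + ((G y)⁻¹ k l * pd k (fun z => G z i l) y
          - (G y)⁻¹ l k * pd l (fun z => G z i k) y) := fun k l => by
      rw [hG.inv_apply_symm hy l k, hG.pd_symm hy l i k]; ring
    simp only [e, Finset.sum_add_distrib, Finset.sum_sub_distrib]
    rw [Finset.sum_comm (f := fun k l => (G y)⁻¹ l k * pd l (fun z => G z i k) y)]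
    ring
  have h4 : (G y).det = Real.sqrt (G y).det * Real.sqrt (G y).det :=
    (Real.mul_self_sqrt hpos.le).symm
  rw [h2] at h1
  nth_rw 1 [h4] at h1
  rw [h3]
  have : Real.sqrt (G y).det * (Real.sqrt (G y).det
      * ∑ k, ∑ l, (G y)⁻¹ k l * pd i (fun z => G z k l) y)
      = Real.sqrt (G y).det * (2 * pd i (fun z => Real.sqrt (G z).det) y) := by linarith
  have := mul_left_cancel₀ hs.ne' this
  linarith

/-- The inverse metric is parallel. -/
theorem pd_inv_eq_christoffel (hG : IsMetricOn G U) (hy : y ∈ U) (i j k : Fin m) :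
    pd i (fun z => (G z)⁻¹ j k) y = - ∑ a, (G y)⁻¹ j a * christoffel G k i a y
      - ∑ b, christoffel G j i b y * (G y)⁻¹ b k := by
  rw [hG.pd_inv hy]
  simp only [hG.pd_eq_christoffel hy, mul_add, add_mul, Finset.sum_add_distrib, neg_add]
  rw [sub_eq_add_neg]
  congr 2
  · refine Finset.sum_congr rfl fun a _ => ?_
    simp only [Finset.mul_sum, Finset.sum_mul]
    rw [Finset.sum_comm]
    have : ∀ c, ∑ b, (G y)⁻¹ j a * (G y b c * christoffel G c i a y) * (G y)⁻¹ b k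
        = (∑ b, G y c b * (G y)⁻¹ b k) * ((G y)⁻¹ j a * christoffel G c i a y) := fun c => by
      rw [Finset.sum_mul]
      exact Finset.sum_congr rfl fun b _ => by rw [hG.apply_symm hy b c]; ring
    simp only [this, hG.sum_mul_inv hy]
    simp
  · rw [Finset.sum_comm]
    refine Finset.sum_congr rfl fun b _ => ?_
    simp only [Finset.mul_sum, Finset.sum_mul]
    rw [Finset.sum_comm]
    have : ∀ c, ∑ a, (G y)⁻¹ j a * (G y a c * christoffel G c i b y) * (G y)⁻¹ b k
        = (∑ a, (G y)⁻¹ j a * G y a c) * (christoffel G c i b y * (G y)⁻¹ b k) := fun c => by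
      rw [Finset.sum_mul]
      exact Finset.sum_congr rfl fun b _ => by ring
    simp only [this, hG.sum_inv_mul hy]
    simp

/-- Weighted by the volume density, the Laplacian is a Euclidean divergence, so its integral in a
chart is accessible to Lebesgue measure. -/
theorem sqrt_det_mul_laplacian (hG : IsMetricOn G U) (hu : ContDiffOn ℝ ∞ u U) (hy : y ∈ U) :
    Real.sqrt (G y).det * coordLaplacian G u y
      = ∑ i, pd i (fun z => Real.sqrt (G z).det * ∑ j, (G z)⁻¹ i j * pd j u z) y := by
  have d := fun {w : Coord m → ℝ} (hw : ContDiffOn ℝ ∞ w U) =>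
    hw.differentiableAt_of_isOpen hG.isOpen hy
  have hs := d hG.smooth_sqrt_det
  have hI := fun i j => d (hG.smooth_inv i j)
  have hd := fun j => d (contDiffOn_pd hG.isOpen hu j)
  have e1 : ∀ i, pd i (fun z => Real.sqrt (G z).det * ∑ j, (G z)⁻¹ i j * pd j u z) y
      = Real.sqrt (G y).det * (∑ j, (∑ k, christoffel G k k i y) * ((G y)⁻¹ i j * pd j u y)
        + (∑ j, pd i (fun z => (G z)⁻¹ i j) y * pd j u y
        + ∑ j, (G y)⁻¹ i j * pd i (pd j u) y)) := by
    intro i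
    rw [pd_mul hs (DifferentiableAt.fun_sum fun j _ => (hI i j).fun_mul (hd j)),
      pd_sum fun j _ => (hI i j).fun_mul (hd j), hG.pd_sqrt_det hy,
      Finset.sum_congr rfl fun j _ => pd_mul (hI i j) (hd j) i, Finset.sum_add_distrib,
      ← Finset.mul_sum]
    ring
  simp only [e1, ← Finset.mul_sum]
  congr 1
  simp only [Finset.sum_add_distrib, coordLaplacian, metricTrace, hess, mul_sub,
    Finset.sum_sub_distrib]
  -- The derivative of the inverse metric supplies the Christoffel term of the Hessian and cancels
  -- the derivative of the density.
  have e2 : ∑ i, ∑ j, pd i (fun z => (G z)⁻¹ i j) y * pd j u y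
      = - ∑ i, ∑ j, (G y)⁻¹ i j * ∑ k, christoffel G k i j y * pd k u y
        - ∑ i, (∑ k, christoffel G k k i y) * ∑ j, (G y)⁻¹ i j * pd j u y := by
    simp only [hG.pd_inv_eq_christoffel hy, sub_mul, neg_mul, Finset.sum_sub_distrib,
      Finset.sum_neg_distrib]
    refine congrArg₂ (fun a b => -a - b) ?_ ?_
    · refine Finset.sum_congr rfl fun i _ => ?_
      simp only [Finset.sum_mul, Finset.mul_sum]
      rw [Finset.sum_comm]
      exact Finset.sum_congr rfl fun a _ => Finset.sum_congr rfl fun j _ => by ring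
    · simp only [Finset.sum_mul, Finset.mul_sum]
      calc _ = ∑ i, ∑ b, ∑ j, christoffel G i i b y * (G y)⁻¹ b j * pd j u y :=
            Finset.sum_congr rfl fun i _ => Finset.sum_comm
        _ = ∑ b, ∑ i, ∑ j, christoffel G i i b y * (G y)⁻¹ b j * pd j u y := Finset.sum_comm
        _ = ∑ b, ∑ j, ∑ i, christoffel G i i b y * (G y)⁻¹ b j * pd j u y :=
            Finset.sum_congr rfl fun i _ => Finset.sum_comm
        _ = _ := Finset.sum_congr rfl fun i _ => Finset.sum_congr rfl fun j _ =>
            Finset.sum_congr rfl fun k _ => by ring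
  rw [e2]
  ring

end IsMetricOn

/-- The integral of a partial derivative of a compactly supported function vanishes. -/
theorem integral_pd_eq_zero {m : ℕ} {X : Coord m → ℝ} (hX : ContDiff ℝ ∞ X)
    (hc : HasCompactSupport X) (i : Fin m) : ∫ y, pd i X y = 0 := by
  have hc' : HasCompactSupport (pd i X) := hc.fderiv_apply (𝕜 := ℝ) _
  have hi : Integrable (pd i X) volume :=
    (continuousOn_univ.1 (contDiffOn_pd isOpen_univ
      hX.contDiffOn i).continuousOn).integrable_of_hasCompactSupport hc'
  have := integral_mul_fderiv_eq_neg_fderiv_mul_of_integrable (μ := (volume : Measure (Coord m)))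
    (f := fun _ => (1 : ℝ)) (g := X) (v := EuclideanSpace.single i (1 : ℝ)) (by simp)
    (by simp only [one_mul]; exact hi) (by simpa using hX.continuous.integrable_of_hasCompactSupport hc)
    (fun x _ => differentiableAt_const _) (fun x _ => hX.differentiable (by simp) x)
  simpa [pd] using this

/-- The divergence theorem in coordinates. -/
theorem IsMetricOn.integral_laplacian_eq_zero {m : ℕ} {G : Coord m → Matrix (Fin m) (Fin m) ℝ}
    {U K : Set (Coord m)} {u : Coord m → ℝ} (hG : IsMetricOn G U) (hu : ContDiffOn ℝ ∞ u U)
    (hK : IsCompact K) (hKU : K ⊆ U) (h0 : ∀ z ∈ U, z ∉ K → u z = 0) :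
    ∫ y in U, Real.sqrt (G y).det * coordLaplacian G u y = 0 := by
  have hU := hG.isOpen
  -- The flux field extended by zero is smooth on the whole space, because it already vanishes on U
  -- outside the compact set K.
  set X : Fin m → Coord m → ℝ := fun i => U.indicator fun z =>
    Real.sqrt (G z).det * ∑ j, (G z)⁻¹ i j * pd j u z with hX
  have hXU : ∀ i, Set.EqOn (X i) (fun z =>
    Real.sqrt (G z).det * ∑ j, (G z)⁻¹ i j * pd j u z) U := fun i z hz =>
    Set.indicator_of_mem hz _
  have hXK : ∀ i z, z ∉ K → X i z = 0 := by
    intro i z hz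
    by_cases hzU : z ∈ U
    · rw [hXU i hzU]
      have : ∀ j, pd j u z = 0 := fun j => by
        rw [pd_congr (hU.inter hK.isClosed.isOpen_compl) (v := fun _ => 0)
          (fun x hx => h0 x hx.1 hx.2) ⟨hzU, hz⟩, pd_const]
      simp [this]
    · exact Set.indicator_of_notMem hzU _
  have hXs : ∀ i, ContDiff ℝ ∞ (X i) := by
    intro i
    rw [contDiff_iff_contDiffAt]
    intro z
    by_cases hz : z ∈ U
    · have : ContDiffOn ℝ ∞ (X i) U := (hG.smooth_sqrt_det.mul (ContDiffOn.sum fun j _ =>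
        (hG.smooth_inv i j).mul (contDiffOn_pd hU hu j))).congr (hXU i)
      exact this.contDiffAt (hU.mem_nhds hz)
    · have hzK : z ∉ K := fun h => hz (hKU h)
      have : X i =ᶠ[nhds z] fun _ => 0 := by
        filter_upwards [hK.isClosed.isOpen_compl.mem_nhds hzK] with x hx using hXK i x hx
      exact contDiffAt_const.congr_of_eventuallyEq this
  have hXc : ∀ i, HasCompactSupport (X i) := fun i =>
    HasCompactSupport.intro hK fun z hz => hXK i z hz
  have h1 : ∀ y ∈ U, Real.sqrt (G y).det * coordLaplacian G u y = ∑ i, pd i (X i) y := by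
    intro y hy
    rw [hG.sqrt_det_mul_laplacian hu hy]
    exact Finset.sum_congr rfl fun i _ => (pd_congr hU (hXU i) hy i).symm
  have h2 : ∀ y, y ∉ U → ∑ i, pd i (X i) y = 0 := by
    intro y hy
    refine Finset.sum_eq_zero fun i _ => ?_
    rw [pd_congr hK.isClosed.isOpen_compl (v := fun _ => 0) (fun x hx => hXK i x hx)
      (fun h => hy (hKU h)), pd_const]
  rw [setIntegral_congr_fun hU.measurableSet h1,
    setIntegral_eq_integral_of_forall_compl_eq_zero h2, integral_finsetSum]
  · exact Finset.sum_eq_zero fun i _ => integral_pd_eq_zero (hXs i) (hXc i) i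
  · intro i _
    have hc' : HasCompactSupport (pd i (X i)) := (hXc i).fderiv_apply (𝕜 := ℝ) _
    exact (continuousOn_univ.1 (contDiffOn_pd isOpen_univ
      (hXs i).contDiffOn i).continuousOn).integrable_of_hasCompactSupport hc'

/-! ### The Riemannian volume measure -/

theorem det_fderiv_eq_det_jac {m : ℕ} {ψ : Coord m → Coord m} {z : Coord m}
    (hψ : DifferentiableAt ℝ ψ z) : (fderiv ℝ ψ z).det = (jac ψ z).det := by
  have h : LinearMap.toMatrix (EuclideanSpace.basisFun (Fin m) ℝ).toBasis
      (EuclideanSpace.basisFun (Fin m) ℝ).toBasis (fderiv ℝ ψ z : Coord m →ₗ[ℝ] Coord m)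
      = jac ψ z := by
    ext a i
    simp [LinearMap.toMatrix_apply, jac_apply hψ]
  rw [← h, LinearMap.det_toMatrix]

section Volume

variable {m : ℕ} {M : Type*} [TopologicalSpace M] [ChartedSpace (Coord m) M]
  [IsManifold (𝓡 m) ∞ M] [MeasurableSpace M] [BorelSpace M]
  {e e₁ : OpenPartialHomeomorph M (Coord m)}

/-- The density of the Riemannian volume in a chart. -/
noncomputable def volDensity (g : RiemMetric m M) (e : OpenPartialHomeomorph M (Coord m))
    (y : Coord m) : ENNReal := ENNReal.ofReal (Real.sqrt (gram g e y).det)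

theorem aemeasurable_symm (e : OpenPartialHomeomorph M (Coord m)) :
    AEMeasurable e.symm (volume.restrict e.target) :=
  e.continuousOn_symm.aemeasurable e.open_target.measurableSet

theorem aemeasurable_volDensity (he : e ∈ IsManifold.maximalAtlas (𝓡 m) ∞ M)
    (g : RiemMetric m M) : AEMeasurable (volDensity g e) (volume.restrict e.target) :=
  ((isMetricOn_gram he g).smooth_sqrt_det.continuousOn.aemeasurable
    e.open_target.measurableSet).ennreal_ofReal

theorem chartVolume_apply (g : RiemMetric m M) (e : OpenPartialHomeomorph M (Coord m)) {A : Set M}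
    (hA : MeasurableSet A) :
    chartVolume g e A = ∫⁻ y in e.symm ⁻¹' A ∩ e.target, volDensity g e y := by
  rw [chartVolume, Measure.map_apply_of_aemeasurable
    ((aemeasurable_symm e).mono_ac (withDensity_absolutelyContinuous _ _)) hA,
    withDensity_apply', Measure.restrict_restrict' e.open_target.measurableSet]
  rfl

theorem measurableSet_symm_preimage (e : OpenPartialHomeomorph M (Coord m)) {A : Set M}
    (hA : MeasurableSet A) : MeasurableSet (e.symm ⁻¹' A ∩ e.target) := by
  have h : Measurable (e.target.domRestrict e.symm) :=
    (continuousOn_iff_continuous_domRestrict.1 e.continuousOn_symm).measurable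
  have := e.open_target.measurableSet.subtype_image (h hA)
  convert this using 1
  ext z
  simp [and_comm, Set.domRestrict]

theorem chartVolume_inter_source (g : RiemMetric m M) (e : OpenPartialHomeomorph M (Coord m))
    {A : Set M} (hA : MeasurableSet A) : chartVolume g e (A ∩ e.source) = chartVolume g e A := by
  rw [chartVolume_apply g e (hA.inter e.open_source.measurableSet), chartVolume_apply g e hA]
  congr 2
  ext z
  simp only [Set.mem_inter_iff, Set.mem_preimage]
  exact ⟨fun h => ⟨h.1.1, h.2⟩, fun h => ⟨⟨h.1, e.map_target h.2⟩, h.2⟩⟩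

/-- The volumes defined by two charts agree on the intersection of their domains. -/
theorem chartVolume_eq (he : e ∈ IsManifold.maximalAtlas (𝓡 m) ∞ M)
    (he₁ : e₁ ∈ IsManifold.maximalAtlas (𝓡 m) ∞ M) (g : RiemMetric m M) {A : Set M}
    (hA : MeasurableSet A) (hAe : A ⊆ e.source) (hAe₁ : A ⊆ e₁.source) :
    chartVolume g e A = chartVolume g e₁ A := by
  set ψ : Coord m → Coord m := fun z => e (id (e₁.symm z)) with hψ
  set V : Set (Coord m) := e₁.target ∩ (fun z => id (e₁.symm z)) ⁻¹' e.source with hV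
  have hVo : IsOpen V := isOpen_chart_map e₁ e continuous_id
  have hψs : ContDiffOn ℝ ∞ ψ V := contDiffOn_chart_map he₁ he contMDiff_id
  set B := e₁.symm ⁻¹' A ∩ e₁.target with hB
  have hBV : B ⊆ V := fun z hz => ⟨hz.2, hAe hz.1⟩
  have hd : ∀ z ∈ B, DifferentiableAt ℝ ψ z := fun z hz =>
    (hψs.differentiableOn (by simp)).differentiableAt (hVo.mem_nhds (hBV hz))
  have himg : ψ '' B = e.symm ⁻¹' A ∩ e.target := by
    ext y
    constructor
    · rintro ⟨z, hz, rfl⟩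
      exact ⟨by simpa [hψ, e.left_inv (hAe hz.1)] using hz.1, e.map_source (hAe hz.1)⟩
    · rintro ⟨hy, hyt⟩
      refine ⟨e₁ (e.symm y), ⟨?_, e₁.map_source (hAe₁ hy)⟩, ?_⟩
      · simpa [e₁.left_inv (hAe₁ hy)] using hy
      · simp [hψ, e₁.left_inv (hAe₁ hy), e.right_inv hyt]
  have hinj : Set.InjOn ψ B := by
    intro z hz w hw hzw
    have := e.injOn (hAe hz.1) (hAe hw.1) hzw
    exact e₁.symm.injOn hz.2 hw.2 this
  -- Change of variables along the transition map: the factor |det J| is absorbed since det G' =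
  -- (det J)² det G.
  rw [chartVolume_apply g e hA, chartVolume_apply g e₁ hA, ← himg,
    lintegral_image_eq_lintegral_abs_det_fderiv_mul volume (measurableSet_symm_preimage e₁ hA)
      (fun z hz => (hd z hz).hasFDerivAt.hasFDerivWithinAt) hinj]
  refine setLIntegral_congr_fun (measurableSet_symm_preimage e₁ hA) fun z hz => ?_
  have htr : gram g e₁ z = (jac ψ z).transpose * gram g e (ψ z) * jac ψ z :=
    gram_transform he he₁ g hz.2 (hAe hz.1)
  simp only [volDensity]
  rw [htr, Matrix.det_mul, Matrix.det_mul, Matrix.det_transpose, det_fderiv_eq_det_jac (hd z hz),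
    ← ENNReal.ofReal_mul (abs_nonneg _),
    show (jac ψ z).det * (gram g e (ψ z)).det * (jac ψ z).det
      = (jac ψ z).det ^ 2 * (gram g e (ψ z)).det by ring,
    Real.sqrt_mul (sq_nonneg _), Real.sqrt_sq_eq_abs]

/-- The supremum could exceed the measure of a single chart. It does not on the domain of e: every
chart volume is at most that of e plus the largest measure on the complement of the domain, which
does not see A. -/
theorem riemannianVolume_apply (he : e ∈ IsManifold.maximalAtlas (𝓡 m) ∞ M) (g : RiemMetric m M)
    {A : Set M} (hA : MeasurableSet A) (hAe : A ⊆ e.source) :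
    riemannianVolume g A = chartVolume g e A := by
  refine le_antisymm ?_ (le_iSup₂ (f := fun e (_ : e ∈ IsManifold.maximalAtlas (𝓡 m) ∞ M) =>
    chartVolume g e) e he A)
  have hle : riemannianVolume g ≤ chartVolume g e + (⊤ : Measure M).restrict e.sourceᶜ := by
    refine iSup₂_le fun e₁ he₁ => Measure.le_iff.2 fun B hB => ?_
    have hs := e.open_source.measurableSet
    rw [Measure.add_apply, Measure.restrict_apply hB, ← measure_inter_add_sdiff B hs]
    refine add_le_add ?_ ?_
    · rw [← chartVolume_inter_source g e₁ (hB.inter hs), ← chartVolume_eq he he₁ g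
        ((hB.inter hs).inter e₁.open_source.measurableSet)
        (fun x hx => hx.1.2) (fun x hx => hx.2)]
      exact measure_mono fun x hx => hx.1.1
    · exact (le_top : chartVolume g e₁ ≤ ⊤) _
  refine (hle A).trans ?_
  have h0 : A ∩ e.sourceᶜ = ∅ := by
    ext x; simp only [Set.mem_inter_iff, Set.mem_compl_iff, Set.mem_empty_iff_false, iff_false]
    exact fun h => h.2 (hAe h.1)
  rw [Measure.add_apply, Measure.restrict_apply hA, h0, measure_empty, add_zero]

theorem riemannianVolume_restrict (he : e ∈ IsManifold.maximalAtlas (𝓡 m) ∞ M)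
    (g : RiemMetric m M) : (riemannianVolume g).restrict e.source = chartVolume g e := by
  ext A hA
  rw [Measure.restrict_apply hA, riemannianVolume_apply he g
    (hA.inter e.open_source.measurableSet) Set.inter_subset_right, chartVolume_inter_source g e hA]

/-- In a chart the measure has positive density with respect to Lebesgue measure. -/
theorem isOpenPosMeasure_riemannianVolume (g : RiemMetric m M) :
    (riemannianVolume g).IsOpenPosMeasure := by
  refine ⟨fun U hU ⟨p, hp⟩ h0 => ?_⟩
  have he := IsManifold.chart_mem_maximalAtlas (I := 𝓡 m) (n := ∞) p
  set e := chartAt (Coord m) p with he_def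
  have hpe : p ∈ e.source := mem_chart_source _ p
  have hUe : IsOpen (U ∩ e.source) := hU.inter e.open_source
  have h1 : riemannianVolume g (U ∩ e.source) = 0 := measure_mono_null Set.inter_subset_left h0
  rw [riemannianVolume_apply he g hUe.measurableSet Set.inter_subset_right,
    chartVolume_apply g e hUe.measurableSet] at h1
  have hB : IsOpen (e.symm ⁻¹' (U ∩ e.source) ∩ e.target) := by
    rw [Set.inter_comm]
    exact e.continuousOn_symm.isOpen_inter_preimage e.open_target hUe
  have hpB : e p ∈ e.symm ⁻¹' (U ∩ e.source) ∩ e.target :=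
    ⟨by simpa [e.left_inv hpe] using ⟨hp, hpe⟩, e.map_source hpe⟩
  have hm : AEMeasurable (volDensity g e)
      (volume.restrict (e.symm ⁻¹' (U ∩ e.source) ∩ e.target)) :=
    (aemeasurable_volDensity he g).mono_measure (Measure.restrict_mono Set.inter_subset_right le_rfl)
  rw [lintegral_eq_zero_iff' hm] at h1
  have h2 : ∀ᵐ y ∂volume.restrict (e.symm ⁻¹' (U ∩ e.source) ∩ e.target), False := by
    filter_upwards [h1, ae_restrict_mem hB.measurableSet] with y hy hyB
    have hpos : 0 < Real.sqrt (gram g e y).det :=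
      Real.sqrt_pos.2 ((isMetricOn_gram he g).posDef y hyB.2).det_pos
    simp only [volDensity, Pi.zero_apply, ENNReal.ofReal_eq_zero] at hy
    linarith
  rw [Filter.eventually_false_iff_eq_bot, ae_eq_bot, Measure.restrict_eq_zero] at h2
  exact hB.measure_ne_zero volume ⟨_, hpB⟩ h2

/-- By compactness it suffices to find a neighbourhood of finite volume at each point; a coordinate
ball with compact closure in the chart has one, the density being continuous there. -/
theorem isFiniteMeasure_riemannianVolume [CompactSpace M] (g : RiemMetric m M) :
    IsFiniteMeasure (riemannianVolume g) := by
  refine ⟨isCompact_univ.measure_lt_top_of_nhdsWithin fun p _ => ?_⟩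
  have he := IsManifold.chart_mem_maximalAtlas (I := 𝓡 m) (n := ∞) p
  set e := chartAt (Coord m) p with he_def
  have hpe : p ∈ e.source := mem_chart_source _ p
  obtain ⟨r, hr, hball⟩ := Metric.nhds_basis_closedBall.mem_iff.1
    (e.open_target.mem_nhds (e.map_source hpe))
  set A : Set M := e.source ∩ e ⁻¹' Metric.ball (e p) r with hA
  have hAo : IsOpen A := e.continuousOn.isOpen_inter_preimage e.open_source Metric.isOpen_ball
  have hpA : p ∈ A := ⟨hpe, Metric.mem_ball_self hr⟩
  refine ⟨A, mem_nhdsWithin_of_mem_nhds (hAo.mem_nhds hpA), ?_⟩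
  rw [riemannianVolume_apply he g hAo.measurableSet Set.inter_subset_left,
    chartVolume_apply g e hAo.measurableSet]
  have hsub : e.symm ⁻¹' A ∩ e.target ⊆ Metric.closedBall (e p) r := by
    intro z hz
    have := hz.1.2
    rw [Set.mem_preimage, e.right_inv hz.2] at this
    exact Metric.ball_subset_closedBall this
  have hint : IntegrableOn (fun y => Real.sqrt (gram g e y).det) (Metric.closedBall (e p) r) :=
    ((isMetricOn_gram he g).smooth_sqrt_det.continuousOn.mono hball).integrableOn_compact
      (isCompact_closedBall _ _)
  refine (lintegral_mono_set hsub).trans_lt ?_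
  exact hint.lintegral_lt_top

theorem setIntegral_riemannianVolume (he : e ∈ IsManifold.maximalAtlas (𝓡 m) ∞ M)
    (g : RiemMetric m M) {k : M → ℝ} (hk : Continuous k) :
    ∫ p in e.source, k p ∂(riemannianVolume g)
      = ∫ y in e.target, Real.sqrt (gram g e y).det * k (e.symm y) := by
  rw [riemannianVolume_restrict he g, chartVolume, integral_map
    ((aemeasurable_symm e).mono_ac (withDensity_absolutelyContinuous _ _))
    hk.measurable.aestronglyMeasurable]
  have hm : AEMeasurable (fun y => ENNReal.ofReal (Real.sqrt (gram g e y).det))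
    (volume.restrict e.target) := aemeasurable_volDensity he g
  rw [integral_withDensity_eq_integral_toReal_smul₀ hm (Filter.Eventually.of_forall fun _ => ENNReal.ofReal_lt_top)]
  simp only [smul_eq_mul, ENNReal.toReal_ofReal (Real.sqrt_nonneg _)]

theorem integral_laplacian_eq_zero_of_tsupport (he : e ∈ IsManifold.maximalAtlas (𝓡 m) ∞ M)
    [CompactSpace M] (g : RiemMetric m M) {w : M → ℝ} (hw : ContMDiff (𝓡 m) 𝓘(ℝ, ℝ) ∞ w)
    (hs : tsupport w ⊆ e.source) : ∫ p, laplacian g w p ∂(riemannianVolume g) = 0 := by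
  have h0 : ∀ p, p ∉ e.source → laplacian g w p = 0 := by
    intro p hp
    have h1 : w =ᶠ[nhds p] fun _ => 0 := notMem_tsupport_iff_eventuallyEq.1 fun h => hp (hs h)
    rw [laplacian_congr g h1]
    have hz : ∀ j : Fin m, pd j (fun _ : Coord m => (0 : ℝ)) = fun _ => 0 := fun j =>
      funext fun y => pd_const 0 j y
    simp [laplacian, coordLaplacian, hess, metricTrace, hz]
  rw [← setIntegral_eq_integral_of_forall_compl_eq_zero h0,
    setIntegral_riemannianVolume he g (continuous_laplacian g hw),
    setIntegral_congr_fun e.open_target.measurableSet fun z hz => by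
      rw [laplacian_symm_eq g he hw hz]]
  have hc : IsCompact (tsupport w) := (isClosed_tsupport w).isCompact
  refine (isMetricOn_gram he g).integral_laplacian_eq_zero (K := e '' tsupport w)
    (contDiffOn_comp_symm he hw) (hc.image_of_continuousOn (e.continuousOn.mono hs))
    (fun z ⟨p, hp, hpz⟩ => hpz ▸ e.map_source (hs hp)) fun z hz hzK => ?_
  by_contra hne
  exact hzK ⟨e.symm z, subset_tsupport w hne, e.right_inv hz⟩

/-- On a compact manifold the integral of the Laplacian of a function vanishes. -/
theorem integral_laplacian_eq_zero [CompactSpace M] [T2Space M] (g : RiemMetric m M) {u : M → ℝ}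
    (hu : ContMDiff (𝓡 m) 𝓘(ℝ, ℝ) ∞ u) : ∫ p, laplacian g u p ∂(riemannianVolume g) = 0 := by
  have := isFiniteMeasure_riemannianVolume g
  obtain ⟨ρ, hρ⟩ := SmoothPartitionOfUnity.exists_isSubordinate_chartAt_source (𝓡 m) M
  -- Local finiteness and compactness leave finitely many nonzero functions, so u is a finite sum of
  -- smooth functions each supported in one chart.
  have hfin : {k | (Function.support (ρ k)).Nonempty}.Finite :=
    ρ.locallyFinite.finite_nonempty_of_compact
  set s := hfin.toFinset with hs
  have hsum : ∀ p, ∑ k ∈ s, ρ k p = 1 := by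
    intro p
    rw [← ρ.sum_eq_one (Set.mem_univ p)]
    symm
    refine finsum_eq_sum_of_support_subset _ fun k hk => ?_
    simp only [hs, Set.Finite.coe_toFinset, Set.mem_ofPred_eq]
    exact ⟨p, hk⟩
  have hw : ∀ k, ContMDiff (𝓡 m) 𝓘(ℝ, ℝ) ∞ (fun p => ρ k p * u p) := fun k =>
    (ρ k).contMDiff.mul hu
  have h1 : u = fun p => ∑ k ∈ s, ρ k p * u p := by
    ext p
    rw [← Finset.sum_mul, hsum, one_mul]
  have h2 : ∀ p, laplacian g u p = ∑ k ∈ s, laplacian g (fun p => ρ k p * u p) p := fun p => by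
    conv_lhs => rw [h1]
    exact laplacian_sum g s (fun k _ => hw k) p
  simp only [h2]
  rw [integral_finsetSum]
  · refine Finset.sum_eq_zero fun k _ => ?_
    refine integral_laplacian_eq_zero_of_tsupport (IsManifold.chart_mem_maximalAtlas k) g (hw k) ?_
    exact (closure_mono (Function.support_mul_subset_left _ _)).trans (hρ k)
  · intro k _
    exact (continuous_laplacian g (hw k)).integrable_of_hasCompactSupport
      (HasCompactSupport.of_compactSpace _)

end Volume

/-! ### The gap theorem -/

section Gap

variable {m n : ℕ} {M : Type*} [TopologicalSpace M] [ChartedSpace (Coord m) M]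
  [IsManifold (𝓡 m) ∞ M] {N : Type*} [TopologicalSpace N] [ChartedSpace (Coord n) N]
  [IsManifold (𝓡 n) ∞ N] {g : RiemMetric m M} {h : RiemMetric n N} {φ : M → N} {f : M → ℝ}
  {α lam : ℝ}

theorem _root_.IsLocallyConstant.contMDiff_real {F : M → ℝ} (hF : IsLocallyConstant F) :
    ContMDiff (𝓡 m) 𝓘(ℝ, ℝ) ∞ F := fun p =>
  contMDiffAt_const.congr_of_eventuallyEq (hF.eventually_eq p)

theorem laplacian_isLocallyConstant_sub {F : M → ℝ} (hF : IsLocallyConstant F)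
    (hf : ContMDiff (𝓡 m) 𝓘(ℝ, ℝ) ∞ f) (p : M) :
    laplacian g (fun q => F q - f q) p = - laplacian g f p := by
  rw [← laplacian_const_sub g hf (F p)]
  exact laplacian_congr g ((hF.eventually_eq p).mono fun q hq => by simp only [hq])

theorem gradNormSq_isLocallyConstant_sub {F : M → ℝ} (hF : IsLocallyConstant F)
    (hf : ContMDiff (𝓡 m) 𝓘(ℝ, ℝ) ∞ f) (p : M) :
    gradNormSq g (fun q => F q - f q) p = gradNormSq g f p := by
  rw [← gradNormSq_const_sub g hf (F p)]
  exact gradNormSq_congr g ((hF.eventually_eq p).mono fun q hq => by simp only [hq])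

/-- The maximum of `f` over the level sets of a locally constant function. -/
theorem exists_isLocallyConstant_max [CompactSpace M] {W : M → ℝ} (hW : IsLocallyConstant W)
    (hf : Continuous f) :
    ∃ F : M → ℝ, IsLocallyConstant F ∧ (∀ p, f p ≤ F p) ∧
      ∀ p, ∃ q, W q = W p ∧ F q = F p ∧ f q = F p := by
  have h1 : ∀ c : ℝ, ∃ Fc : ℝ, ∀ p, W p = c → f p ≤ Fc ∧ ∃ q, W q = c ∧ f q = Fc := by
    intro c
    by_cases hne : (W ⁻¹' {c}).Nonempty
    · have hcl : IsClosed (W ⁻¹' {c}) := isClosed_singleton.preimage hW.continuous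
      obtain ⟨q, hq, hmax⟩ := hcl.isCompact.exists_isMaxOn hne hf.continuousOn
      exact ⟨f q, fun p hp => ⟨hmax hp, q, hq, rfl⟩⟩
    -- On values not taken by W the choice is irrelevant.
    · exact ⟨0, fun p hp => (hne ⟨p, hp⟩).elim⟩
  choose Fc hFc using h1
  -- F factors through the locally constant W, hence is locally constant whatever `Fc` is.
  refine ⟨fun p => Fc (W p), hW.comp Fc, fun p => (hFc _ p rfl).1, fun p => ?_⟩
  obtain ⟨q, hq, hfq⟩ := (hFc _ p rfl).2
  exact ⟨q, hq, congrArg Fc hq, hfq⟩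

/-- A nonnegative function `u` with `uS = 0`, where `S = mλ + Δu ≥ 0`, vanishes on a compact
manifold. -/
theorem eq_zero_of_mul_eq_zero [CompactSpace M] (hm : 0 < m) (hlam : 0 < lam) {u : M → ℝ}
    (hu : ContMDiff (𝓡 m) 𝓘(ℝ, ℝ) ∞ u) (hu0 : ∀ p, 0 ≤ u p)
    (h0 : ∀ p, u p * (m * lam + laplacian g u p) = 0) (p : M) : u p = 0 := by
  have hml : 0 < m * lam := by positivity
  have hLc := continuous_laplacian g hu
  -- One description of the set {u ≠ 0} is open, the other closed. A minimum of u over this clopen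
  -- set is therefore a local minimum of u on M.
  have hS : ∀ q, u q ≠ 0 ↔ m * lam + laplacian g u q ≤ 0 := by
    intro q
    constructor
    · intro hq
      exact ((mul_eq_zero.1 (h0 q)).resolve_left hq).le
    · intro hq hq0
      have : IsLocalMin u q := Filter.Eventually.of_forall fun r => hq0 ▸ hu0 r
      have := laplacian_nonneg_of_isLocalMin g hu this
      linarith
  by_contra hp
  set Z : Set M := {q | u q ≠ 0} with hZ
  have hZo : IsOpen Z := isOpen_ne.preimage hu.continuous
  have hZc : IsClosed Z := by
    have : Z = {q | m * lam + laplacian g u q ≤ 0} := Set.ext hS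
    rw [this]
    exact isClosed_le (continuous_const.add hLc) continuous_const
  obtain ⟨q, hq, hmin⟩ := hZc.isCompact.exists_isMinOn ⟨p, hp⟩ hu.continuous.continuousOn
  have h1 := laplacian_nonneg_of_isLocalMin g hu (hmin.isLocalMin (hZo.mem_nhds hq))
  have h2 := (hS q).1 hq
  linarith

/-- The integral of uS, with u the deficit of f from its maximum on level sets of W, is forced to be
nonpositive, while both factors are nonnegative. -/
theorem IsRicciHarmonicSoliton.isLocallyConstant_of_le [T2Space M] [CompactSpace M]
    [Nonempty M] [MeasurableSpace M] [BorelSpace M] (hm : 0 < m)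
    (hsol : IsRicciHarmonicSoliton g h φ f α lam)
    (hφ : ContMDiff (𝓡 m) (𝓡 n) ∞ φ) (hf : ContMDiff (𝓡 m) 𝓘(ℝ, ℝ) ∞ f) (hlam : 0 < lam)
    {Smax : ℝ} (hmax : ∀ p, m * lam - laplacian g f p ≤ Smax)
    (hle : Smax - m * lam ≤ (1 + 2 / (m : ℝ)) * (1 / (riemannianVolume g).real Set.univ *
      ∫ p, gradNormSq g f p ∂(riemannianVolume g))) : IsLocallyConstant f := by
  have hfin := isFiniteMeasure_riemannianVolume g
  have hpos := isOpenPosMeasure_riemannianVolume g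
  set μ := riemannianVolume g with hμ
  have hint : ∀ {k : M → ℝ}, Continuous k → Integrable k μ := fun hk =>
    hk.integrable_of_hasCompactSupport (HasCompactSupport.of_compactSpace _)
  have hW := hsol.isLocallyConstant_conserved hφ hf
  obtain ⟨F, hF, hfF, hex⟩ := exists_isLocallyConstant_max hW hf.continuous
  set u : M → ℝ := fun q => F q - f q with hu_def
  have hu : ContMDiff (𝓡 m) 𝓘(ℝ, ℝ) ∞ u := hF.contMDiff_real.sub hf
  have hu0 : ∀ p, 0 ≤ u p := fun p => sub_nonneg.2 (hfF p)
  have hLu : ∀ p, laplacian g u p = - laplacian g f p := laplacian_isLocallyConstant_sub hF hf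
  have hAu : ∀ p, gradNormSq g u p = gradNormSq g f p := gradNormSq_isLocallyConstant_sub hF hf
  have hLc := continuous_laplacian g hf
  have hAc := continuous_gradNormSq g hf
  have huc := hu.continuous
  have hi_uL : Integrable (fun p => u p * laplacian g f p) μ := hint (huc.mul hLc)
  have hi_S : Integrable (fun p => m * lam - laplacian g f p) μ := hint (continuous_const.sub hLc)
  have hi_SA : Integrable (fun p => m * lam - laplacian g f p + gradNormSq g f p) μ :=
    hi_S.add (hint hAc)
  have hi_u : ∀ c : ℝ, Integrable (fun p => c * u p) μ := fun c => (hint huc).const_mul c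
  -- pointwise lower bound of the maximum
  have hptw : ∀ p, m * lam - laplacian g f p + gradNormSq g f p + 2 * lam * u p ≤ Smax := by
    intro p
    obtain ⟨q, hWq, hFq, hfq⟩ := hex p
    have huq : u q = 0 := by simp [hu_def, hFq, hfq]
    have hqmin : IsLocalMin u q := Filter.Eventually.of_forall fun r => huq ▸ hu0 r
    have hAq : gradNormSq g f q = 0 := by
      rw [← hAu]; exact gradNormSq_eq_zero_of_isLocalMin g hqmin
    have hSq := hmax q
    have hWq' := hWq
    simp only [conserved, hAq] at hWq'
    rw [hfq] at hWq'
    simp only [hu_def]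
    linarith
  have hL0 : ∫ p, laplacian g f p ∂μ = 0 := integral_laplacian_eq_zero g hf
  have huu : ∫ p, u p * laplacian g f p ∂μ = ∫ p, gradNormSq g f p ∂μ := by
    have h1 : ∫ p, laplacian g (fun q => u q * u q) p ∂μ = 0 :=
      integral_laplacian_eq_zero g (hu.mul hu)
    have h2 : ∀ p, laplacian g (fun q => u q * u q) p
        = 2 * (gradNormSq g f p - u p * laplacian g f p) := fun p => by
      rw [laplacian_mul_self g hu, hLu, hAu]; ring
    simp only [h2] at h1
    rw [integral_const_mul, integral_sub (hint hAc) hi_uL] at h1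
    linarith
  have hV : 0 < μ.real Set.univ :=
    ENNReal.toReal_pos (isOpen_univ.measure_ne_zero μ Set.univ_nonempty) (measure_ne_top _ _)
  have hm' : (0 : ℝ) < m := by exact_mod_cast hm
  have hS0 : ∀ p, 0 ≤ m * lam - laplacian g f p := hsol.nonneg hφ hf hlam
  have hI1 : m * lam * μ.real Set.univ + ∫ p, gradNormSq g f p ∂μ + 2 * lam * ∫ p, u p ∂μ
      ≤ Smax * μ.real Set.univ := by
    have h1 : ∫ p, (m * lam - laplacian g f p + gradNormSq g f p + 2 * lam * u p) ∂μ
        ≤ ∫ _, Smax ∂μ := integral_mono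
      (hi_SA.add (hi_u _)) (integrable_const _) hptw
    rw [integral_add hi_SA (hi_u _), integral_add hi_S (hint hAc),
      integral_sub (integrable_const _) (hint hLc), hL0, integral_const_mul (2 * lam), integral_const,
      integral_const] at h1
    simp only [smul_eq_mul] at h1
    linarith
  have hI2 : (Smax - m * lam) * μ.real Set.univ
      ≤ (1 + 2 / (m : ℝ)) * ∫ p, gradNormSq g f p ∂μ := by
    have h1 := mul_le_mul_of_nonneg_right hle hV.le
    refine h1.trans_eq ?_
    field_simp
  have hI3 : ∫ p, u p * (m * lam - laplacian g f p) ∂μ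
      = m * lam * ∫ p, u p ∂μ - ∫ p, gradNormSq g f p ∂μ := by
    rw [← huu, ← integral_const_mul, ← integral_sub (hi_u _) hi_uL]
    exact integral_congr_ae (Filter.Eventually.of_forall fun p => by simp only; ring)
  -- Here the constant 1 + 2/m is used exactly: the 1 cancels the gradient integral in `hI1`, and
  -- 2/m gives mλ∫u ≤ ∫|∇f|².
  have hI4 : ∫ p, u p * (m * lam - laplacian g f p) ∂μ ≤ 0 := by
    rw [hI3]
    have h1 : 2 * lam * ∫ p, u p ∂μ ≤ 2 / (m : ℝ) * ∫ p, gradNormSq g f p ∂μ := by linarith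
    have h2 := mul_le_mul_of_nonneg_left h1 hm'.le
    have h3 : (m : ℝ) * (2 / (m : ℝ) * ∫ p, gradNormSq g f p ∂μ)
        = 2 * ∫ p, gradNormSq g f p ∂μ := by field_simp
    rw [h3] at h2
    linarith
  have hprod : Continuous fun p => u p * (m * lam - laplacian g f p) :=
    huc.mul (continuous_const.sub hLc)
  have hnn : ∀ p, 0 ≤ u p * (m * lam - laplacian g f p) := fun p => mul_nonneg (hu0 p) (hS0 p)
  -- Vanishing almost everywhere becomes vanishing everywhere by continuity, the volume being
  -- positive on nonempty open sets.
  have hzero : (fun p => u p * (m * lam - laplacian g f p)) = 0 := by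
    have h1 := (integral_eq_zero_iff_of_nonneg hnn (hint hprod)).1
      (le_antisymm hI4 (integral_nonneg hnn))
    exact (hprod.ae_eq_iff_eq μ continuous_const).1 h1
  have huz := eq_zero_of_mul_eq_zero (g := g) hm hlam hu hu0 fun p => by
    rw [hLu, ← sub_eq_add_neg]; exact congrFun hzero p
  have : f = F := funext fun p => (sub_eq_zero.1 (huz p)).symm
  rw [this]
  exact hF

end Gap

end RicciHarmonic

/-! ### The characterisation of harmonic-Einstein solitons -/

theorem theorem3p1 {m n : ℕ} (hm : 0 < m)
    {M : Type*} [TopologicalSpace M] [ChartedSpace (RicciHarmonic.Coord m) M]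
    [IsManifold (𝓡 m) ∞ M] [T2Space M] [CompactSpace M] [Nonempty M]
    [MeasurableSpace M] [BorelSpace M]
    {N : Type*} [TopologicalSpace N] [ChartedSpace (RicciHarmonic.Coord n) N]
    [IsManifold (𝓡 n) ∞ N]
    (g : RicciHarmonic.RiemMetric m M) (h : RicciHarmonic.RiemMetric n N)
    (φ : M → N) (hφ : ContMDiff (𝓡 m) (𝓡 n) ∞ φ)
    (f : M → ℝ) (hf : ContMDiff (𝓡 m) 𝓘(ℝ, ℝ) ∞ f)
    (α lam : ℝ) (hsol : RicciHarmonic.IsRicciHarmonicSoliton g h φ f α lam) (hlam : 0 < lam) :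
    ∃ Smax : ℝ, IsGreatest (Set.range (RicciHarmonic.genScalarCurvature g h φ α)) Smax ∧
      (RicciHarmonic.IsHarmonicEinstein g h φ α lam ↔
        Smax - m * lam ≤ (1 + 2 / (m : ℝ)) *
          (1 / (RicciHarmonic.riemannianVolume g).real Set.univ *
            ∫ p, RicciHarmonic.gradNormSq g f p ∂(RicciHarmonic.riemannianVolume g))) := by
  have hS := hsol.genScalarCurvature_eq
  have hc : Continuous (RicciHarmonic.genScalarCurvature g h φ α) := by
    rw [funext hS]
    exact continuous_const.sub (RicciHarmonic.continuous_laplacian g hf)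
  obtain ⟨p, -, hp⟩ := isCompact_univ.exists_isMaxOn Set.univ_nonempty hc.continuousOn
  have hmax : ∀ q, RicciHarmonic.genScalarCurvature g h φ α q
      ≤ RicciHarmonic.genScalarCurvature g h φ α p := fun q => hp (Set.mem_univ q)
  refine ⟨RicciHarmonic.genScalarCurvature g h φ α p, ⟨⟨p, rfl⟩, ?_⟩, fun hE => ?_, fun hle => ?_⟩
  · rintro _ ⟨q, rfl⟩
    exact hmax q
  -- In the harmonic-Einstein case S is identically mλ, so the left side is 0.
  · rw [hS p, hsol.laplacian_eq_zero hE p, sub_zero, sub_self]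
    have h1 : 0 ≤ ∫ p, RicciHarmonic.gradNormSq g f p ∂(RicciHarmonic.riemannianVolume g) :=
      integral_nonneg fun q => RicciHarmonic.gradNormSq_nonneg g hf q
    positivity
  · exact hsol.isHarmonicEinstein_of_isLocallyConstant
      (hsol.isLocallyConstant_of_le hm hφ hf hlam (fun q => hS q ▸ hmax q) hle)
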